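/- **Setting.** Let $K$ be a subfield of $\mathbb C$ (for example $\mathbb Q$ or $\mathbb C$), let $H=\bigoplus_{d\ge 0}H^d$ be a finite-dimensional graded-commutative $K$-algebra, let $m,n\ge 0$ be integers, and let $\mathcal B=\{x_h\}$ be a finite totally ordered basis of $H$ consisting of homogeneous elements; write $|x_h|$ for the degree of $x_h$. (The case of interest is $H=H^*(X;K)$ for a smooth complex projective variety $X$ of complex dimension $m$.) The Križ algebra $E(X,n)$ is the graded-commutative algebra generated over $H^{\otimes n}$ (graded tensor power, with $p_i^*(x)$ denoting $x$ placed in the $i$-th factor) by exterior generators $G_{ij}$, $1\le i\ne j\le n$, of degree $2m-1$, modulo $$G_{ji}=G_{ij},\qquad p_j^*(x)G_{ij}=p_i^*(x)G_{ij}\ (i<j,\ x\in H),\qquad G_{ik}G_{jk}=G_{ij}G_{jk}-G_{ij}G_{ik}\ (i<j<k).$$ The group $\mathcal S_n$ acts on it by algebra automorphisms, $\sigma(p_i^*(x))=p_{\sigma(i)}^*(x)$, $\sigma(G_{ij})=G_{\sigma(i)\sigma(j)}$. The subspace $E_q^k(X,n)$ is spanned by the products of homogeneous classes $p_i^*(x)$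 and of exactly $q$ generators $G_{ij}$ that have total degree $k$. A *type* is a sequence $(L_*,H_*)=((\lambda_1,h_1),\dots,(\lambda_t,h_t))$ with $\lambda_1\ge\dots\ge\lambda_t\ge1$, $\sum\lambda_i=n$, marks $x_{h_i}\in\mathcal B$, and $x_{h_i}\succeq x_{h_{i+1}}$ whenever $\lambda_i=\lambda_{i+1}$. Put $|L_*|=\sum_i(\lambda_i-1)$ and $|H_*|=\sum_i|x_{h_i}|$. To a forest on the vertices $\{1,\dots,n\}$ whose connected components are marked by elements of $\mathcal B$ one associates (up to sign) the monomial which is the product of the classes $p_v^*(x_h)$, one for each component, where $v$ is a vertex of the component and $x_h$ its mark, and of the $G_{ij}$ over the edges $\{i,j\}$. The type submodule $E_*^*(L_*,H_*)$ is the span of the monomials of the marked forests whose components have, up to order, sizes and marks $(\lambda_1,h_1),\dots,(\lambda_t,h_t)$. Let $L_i=\lambda_1+\dots+\lambda_i$ ($L_0=0$) and let $c_{\lambda_i}=(L_{i-1}+1,L_{i-1}+2,\dots,L_i)$. Let $C_{L_*}=\langle c_{\lambda_1}\rangle\times\dots\times\langle c_{\lambda_t}\rangle$, and let $N_{(L_*,H_*)}$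 be generated by the block transpositions $v_i=\prod_{a=1}^{\lambda_i}(L_{i-1}+a,\ L_i+a)$ for those $i<t$ with $(\lambda_i,h_i)=(\lambda_{i+1},h_{i+1})$. Let $Z_{(L_*,H_*)}\le\mathcal S_n$ be the subgroup generated by $C_{L_*}$ and $N_{(L_*,H_*)}$, and let $\varepsilon_n$ be the sign character of $\mathcal S_n$. **Theorem.** $E(X,n)$ is finite-dimensional, $Z_{(L_*,H_*)}=C_{L_*}\rtimes N_{(L_*,H_*)}$ for every type, and there is a unique linear character $\xi_{(L_*,H_*)}:Z_{(L_*,H_*)}\to\mathbb C^*$ with $$\xi_{(L_*,H_*)}(c_{\lambda_i})=e^{2\pi\sqrt{-1}/\lambda_i}\,\varepsilon_n(c_{\lambda_i})\quad(1\le i\le t),\qquad \xi_{(L_*,H_*)}(v_i)=\begin{cases}(-1)^{\lambda_i+1}&\text{if }|x_{h_i}|\text{ is even},\\(-1)^{\lambda_i}&\text{if }|x_{h_i}|\text{ is odd}\end{cases}$$ for the generators $v_i$ of $N_{(L_*,H_*)}$. Moreover: a) for every type, the representation of $\mathcal S_n$ on $E_*^*(L_*,H_*)$ has the character $\mathrm{Ind}_{Z_{(L_*,H_*)}}^{\mathcal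 S_n}(\xi_{(L_*,H_*)})$; b) for all $q,k$, the representation of $\mathcal S_n$ on $E_q^k(X,n)$ has the character $$\sum_{\substack{|L_*|=q\\ |H_*|+q(2m-1)=k}}\mathrm{Ind}_{Z_{(L_*,H_*)}}^{\mathcal S_n}(\xi_{(L_*,H_*)});$$ c) the representation of $\mathcal S_n$ on $E(X,n)$ has the character $\sum_{(L_*,H_*)}\mathrm{Ind}_{Z_{(L_*,H_*)}}^{\mathcal S_n}(\xi_{(L_*,H_*)})$, the sum being over all types. -/

import Mathlib

namespace Kriz

/-! ### The Križ algebra by generators and relations -/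

/-- Generators: `cls i x` stands for `p_i^*(x)` with `x` in the cohomology algebra `H`,
and `edge i j` for the exterior generator `G_{ij}`. -/
inductive Gen (n : ℕ) (H : Type*) where
  | cls (i : Fin n) (x : H) : Gen n H
  | edge (i j : Fin n) : Gen n H

section Algebra

variable {K : Type*} [Field K] {H : Type*} [Ring H] [Algebra K H]

/-- `p_i^*(x)` in the free algebra on the generators. -/
def fcls (K : Type*) [Field K] {H : Type*} {n : ℕ} (i : Fin n) (x : H) :
    FreeAlgebra K (Gen n H) :=
  FreeAlgebra.ι K (Gen.cls i x)

/-- `G_{ij}` in the free algebra on the generators. -/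
def fedge (K : Type*) [Field K] (H : Type*) {n : ℕ} (i j : Fin n) :
    FreeAlgebra K (Gen n H) :=
  FreeAlgebra.ι K (Gen.edge i j)

/-- The defining relations. The `cls_*` relations present the graded tensor power `H^{⊗ n}`;
the relations `edge_sq`, `edge_anticomm`, `edge_cls` say that the `G_{ij}` (of odd degree) generate
an exterior algebra with coefficients in `H^{⊗ n}`; the last three are the relations of Križ.
There is no generator `G_{ii}`, which is expressed by putting `G_{ii} = 0`. -/
inductive Rel (𝒜 : ℕ → Submodule K H) (n : ℕ) :
    FreeAlgebra K (Gen n H) → FreeAlgebra K (Gen n H) → Prop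
  | cls_add (i : Fin n) (x y : H) : Rel 𝒜 n (fcls K i (x + y)) (fcls K i x + fcls K i y)
  | cls_smul (i : Fin n) (a : K) (x : H) : Rel 𝒜 n (fcls K i (a • x)) (a • fcls K i x)
  | cls_one (i : Fin n) : Rel 𝒜 n (fcls K i 1) 1
  | cls_mul (i : Fin n) (x y : H) : Rel 𝒜 n (fcls K i (x * y)) (fcls K i x * fcls K i y)
  | cls_comm (i j : Fin n) (hij : i ≠ j) (d e : ℕ) (x y : H) (hx : x ∈ 𝒜 d) (hy : y ∈ 𝒜 e) :
      Rel 𝒜 n (fcls K i x * fcls K j y) ((-1 : K) ^ (d * e) • (fcls K j y * fcls K i x))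
  | edge_diag (i : Fin n) : Rel 𝒜 n (fedge K H i i) 0
  | edge_sq (i j : Fin n) : Rel 𝒜 n (fedge K H i j * fedge K H i j) 0
  | edge_anticomm (i j k l : Fin n) :
      Rel 𝒜 n (fedge K H i j * fedge K H k l) (-(fedge K H k l * fedge K H i j))
  | edge_cls (i j k : Fin n) (d : ℕ) (x : H) (hx : x ∈ 𝒜 d) :
      Rel 𝒜 n (fedge K H i j * fcls K k x) ((-1 : K) ^ d • (fcls K k x * fedge K H i j))
  | edge_symm (i j : Fin n) : Rel 𝒜 n (fedge K H j i) (fedge K H i j)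
  | move (i j : Fin n) (hij : i < j) (x : H) :
      Rel 𝒜 n (fcls K j x * fedge K H i j) (fcls K i x * fedge K H i j)
  | arnold (i j k : Fin n) (hij : i < j) (hjk : j < k) :
      Rel 𝒜 n (fedge K H i k * fedge K H j k)
        (fedge K H i j * fedge K H j k - fedge K H i j * fedge K H i k)

/-- The Križ algebra `E(X, n)` attached to the graded-commutative algebra `H = H^*(X)` with
homogeneous components `𝒜 d = H^d(X)`. -/
abbrev Model (𝒜 : ℕ → Submodule K H) (n : ℕ) : Type _ := RingQuot (Rel 𝒜 n)

variable (𝒜 : ℕ → Submodule K H) {n : ℕ}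

/-- The element `p_i^*(x)` of the Križ algebra. -/
def cls (i : Fin n) (x : H) : Model 𝒜 n := RingQuot.mkAlgHom K (Rel 𝒜 n) (fcls K i x)

/-- The exterior generator `G_{ij}` of the Križ algebra. -/
def G (i j : Fin n) : Model 𝒜 n := RingQuot.mkAlgHom K (Rel 𝒜 n) (fedge K H i j)

theorem cls_add (i : Fin n) (x y : H) : cls 𝒜 i (x + y) = cls 𝒜 i x + cls 𝒜 i y := by
  simpa [cls] using RingQuot.mkAlgHom_rel K (Rel.cls_add (𝒜 := 𝒜) i x y)

theorem cls_smul (i : Fin n) (a : K) (x : H) : cls 𝒜 i (a • x) = a • cls 𝒜 i x := by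
  simpa [cls] using RingQuot.mkAlgHom_rel K (Rel.cls_smul (𝒜 := 𝒜) i a x)

theorem cls_one (i : Fin n) : cls 𝒜 i 1 = 1 := by
  simpa [cls] using RingQuot.mkAlgHom_rel K (Rel.cls_one (𝒜 := 𝒜) i)

theorem cls_mul (i : Fin n) (x y : H) : cls 𝒜 i (x * y) = cls 𝒜 i x * cls 𝒜 i y := by
  simpa [cls] using RingQuot.mkAlgHom_rel K (Rel.cls_mul (𝒜 := 𝒜) i x y)

theorem cls_comm {i j : Fin n} (hij : i ≠ j) {d e : ℕ} {x y : H} (hx : x ∈ 𝒜 d) (hy : y ∈ 𝒜 e) :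
    cls 𝒜 i x * cls 𝒜 j y = (-1 : K) ^ (d * e) • (cls 𝒜 j y * cls 𝒜 i x) := by
  simpa only [cls, map_mul, map_smul] using
    RingQuot.mkAlgHom_rel K (Rel.cls_comm (𝒜 := 𝒜) i j hij d e x y hx hy)

theorem G_diag (i : Fin n) : G 𝒜 i i = 0 := by
  simpa [G] using RingQuot.mkAlgHom_rel K (Rel.edge_diag (𝒜 := 𝒜) i)

theorem G_sq (i j : Fin n) : G 𝒜 i j * G 𝒜 i j = 0 := by
  simpa only [G, map_mul, map_zero] using RingQuot.mkAlgHom_rel K (Rel.edge_sq (𝒜 := 𝒜) i j)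

theorem G_anticomm (i j k l : Fin n) : G 𝒜 i j * G 𝒜 k l = -(G 𝒜 k l * G 𝒜 i j) := by
  simpa only [G, map_mul, map_neg] using
    RingQuot.mkAlgHom_rel K (Rel.edge_anticomm (𝒜 := 𝒜) i j k l)

theorem G_cls (i j k : Fin n) {d : ℕ} {x : H} (hx : x ∈ 𝒜 d) :
    G 𝒜 i j * cls 𝒜 k x = (-1 : K) ^ d • (cls 𝒜 k x * G 𝒜 i j) := by
  simpa only [G, cls, map_mul, map_smul] using
    RingQuot.mkAlgHom_rel K (Rel.edge_cls (𝒜 := 𝒜) i j k d x hx)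

theorem G_symm (i j : Fin n) : G 𝒜 j i = G 𝒜 i j := by
  simpa only [G] using RingQuot.mkAlgHom_rel K (Rel.edge_symm (𝒜 := 𝒜) i j)

theorem cls_mul_G (i j : Fin n) (x : H) : cls 𝒜 j x * G 𝒜 i j = cls 𝒜 i x * G 𝒜 i j := by
  rcases lt_trichotomy i j with h | h | h
  · simpa only [G, cls, map_mul] using RingQuot.mkAlgHom_rel K (Rel.move (𝒜 := 𝒜) i j h x)
  · rw [h]
  · rw [← G_symm 𝒜 i j]
    simpa only [G, cls, map_mul] using (RingQuot.mkAlgHom_rel K (Rel.move (𝒜 := 𝒜) j i h x)).symm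

theorem arnold_lt {i j k : Fin n} (hij : i < j) (hjk : j < k) :
    G 𝒜 i k * G 𝒜 j k = G 𝒜 i j * G 𝒜 j k - G 𝒜 i j * G 𝒜 i k := by
  simpa only [G, map_mul, map_sub] using
    RingQuot.mkAlgHom_rel K (Rel.arnold (𝒜 := 𝒜) i j k hij hjk)

/-- The Arnold relation in its symmetric form, for any three distinct indices. -/
theorem arnold_symm {i j k : Fin n} (hij : i ≠ j) (hjk : j ≠ k) (hik : i ≠ k) :
    G 𝒜 i j * G 𝒜 j k + G 𝒜 j k * G 𝒜 k i + G 𝒜 k i * G 𝒜 i j = 0 := by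
  have key : ∀ a b c : Fin n, a < b → b < c →
      G 𝒜 a b * G 𝒜 b c + G 𝒜 b c * G 𝒜 a c + G 𝒜 a c * G 𝒜 a b = 0 := by
    intro a b c hab hbc
    have h1 := arnold_lt 𝒜 hab hbc
    rw [G_anticomm 𝒜 b c a c, h1, G_anticomm 𝒜 a c a b]
    abel
  have flip : ∀ x y z : Model 𝒜 n, x * y = -(y * x) → y * z = -(z * y) → z * x = -(x * z) →
      x * y + y * z + z * x = 0 → x * z + z * y + y * x = 0 := by
    intro x y z h1 h2 h3 h
    rw [h1, h2, h3] at h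
    rw [← neg_eq_zero, ← h]
    abel
  have A := fun a b c d : Fin n => G_anticomm 𝒜 a b c d
  rcases lt_or_gt_of_ne hij with h1 | h1 <;> rcases lt_or_gt_of_ne hjk with h2 | h2 <;>
    rcases lt_or_gt_of_ne hik with h3 | h3
  · rw [G_symm 𝒜 i k]; exact key i j k h1 h2
  · exact absurd (h1.trans h2) (not_lt.mpr h3.le)
  · have := flip _ _ _ (A _ _ _ _) (A _ _ _ _) (A _ _ _ _) (key i k j h3 h2)
    rw [G_symm 𝒜 i k, G_symm 𝒜 k j, ← this]; abel
  · have := key k i j h3 h1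
    rw [G_symm 𝒜 k j, ← this]; abel
  · have := flip _ _ _ (A _ _ _ _) (A _ _ _ _) (A _ _ _ _) (key j i k h1 h3)
    rw [G_symm 𝒜 j i, G_symm 𝒜 i k, ← this]
  · have := key j k i h2 h3
    rw [G_symm 𝒜 j i, ← this]; abel
  · exact absurd (h2.trans h1) (not_lt.mpr h3.le)
  · have := flip _ _ _ (A _ _ _ _) (A _ _ _ _) (A _ _ _ _) (key k j i h2 h1)
    rw [G_symm 𝒜 j i, G_symm 𝒜 k j, ← this]; abel

/-- The image of a generator under a permutation of the indices. -/
def genMap (σ : Equiv.Perm (Fin n)) : Gen n H → Model 𝒜 n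
  | .cls i x => cls 𝒜 (σ i) x
  | .edge i j => G 𝒜 (σ i) (σ j)

theorem lift_genMap_rel (σ : Equiv.Perm (Fin n)) ⦃a b : FreeAlgebra K (Gen n H)⦄
    (h : Rel 𝒜 n a b) :
    FreeAlgebra.lift K (genMap 𝒜 σ) a = FreeAlgebra.lift K (genMap 𝒜 σ) b := by
  have hc : ∀ (i : Fin n) (x : H),
      FreeAlgebra.lift K (genMap 𝒜 σ) (fcls K i x) = cls 𝒜 (σ i) x := by
    intro i x; simp [fcls, genMap]
  have he : ∀ i j : Fin n,
      FreeAlgebra.lift K (genMap 𝒜 σ) (fedge K H i j) = G 𝒜 (σ i) (σ j) := by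
    intro i j; simp [fedge, genMap]
  cases h with
  | cls_add i x y => simp only [map_add, hc]; exact cls_add 𝒜 _ x y
  | cls_smul i a x => simp only [map_smul, hc]; exact cls_smul 𝒜 _ a x
  | cls_one i => simp only [map_one, hc]; exact cls_one 𝒜 _
  | cls_mul i x y => simp only [map_mul, hc]; exact cls_mul 𝒜 _ x y
  | cls_comm i j hij d e x y hx hy =>
    simp only [map_mul, map_smul, hc]
    exact cls_comm 𝒜 (σ.injective.ne hij) hx hy
  | edge_diag i => simp only [map_zero, he]; exact G_diag 𝒜 _
  | edge_sq i j => simp only [map_mul, map_zero, he]; exact G_sq 𝒜 _ _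
  | edge_anticomm i j k l => simp only [map_mul, map_neg, he]; exact G_anticomm 𝒜 _ _ _ _
  | edge_cls i j k d x hx => simp only [map_mul, map_smul, hc, he]; exact G_cls 𝒜 _ _ _ hx
  | edge_symm i j => simp only [he]; exact G_symm 𝒜 _ _
  | move i j hij x => simp only [map_mul, hc, he]; exact cls_mul_G 𝒜 _ _ x
  | arnold i j k hij hjk =>
    simp only [map_mul, map_sub, he]
    have := arnold_symm 𝒜 (σ.injective.ne hij.ne) (σ.injective.ne hjk.ne)
      (σ.injective.ne (hij.trans hjk).ne)
    rw [G_symm 𝒜 (σ i) (σ k), G_anticomm 𝒜 (σ j) (σ k) (σ i) (σ k),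
      G_anticomm 𝒜 (σ i) (σ k) (σ i) (σ j)] at this
    rw [← sub_eq_zero, ← neg_eq_zero, ← this]
    abel

/-- The algebra endomorphism `p_i^*(x) ↦ p_{σ(i)}^*(x)`, `G_{ij} ↦ G_{σ(i)σ(j)}`. -/
def permHom (σ : Equiv.Perm (Fin n)) : Model 𝒜 n →ₐ[K] Model 𝒜 n :=
  RingQuot.liftAlgHom K ⟨FreeAlgebra.lift K (genMap 𝒜 σ), lift_genMap_rel 𝒜 σ⟩

@[simp]
theorem permHom_cls (σ : Equiv.Perm (Fin n)) (i : Fin n) (x : H) :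
    permHom 𝒜 σ (cls 𝒜 i x) = cls 𝒜 (σ i) x := by
  rw [permHom, cls, RingQuot.liftAlgHom_mkAlgHom_apply]
  simp [fcls, genMap]

@[simp]
theorem permHom_G (σ : Equiv.Perm (Fin n)) (i j : Fin n) :
    permHom 𝒜 σ (G 𝒜 i j) = G 𝒜 (σ i) (σ j) := by
  rw [permHom, G, RingQuot.liftAlgHom_mkAlgHom_apply]
  simp [fedge, genMap]

theorem model_hom_ext {f g : Model 𝒜 n →ₐ[K] Model 𝒜 n}
    (hc : ∀ i x, f (cls 𝒜 i x) = g (cls 𝒜 i x)) (he : ∀ i j, f (G 𝒜 i j) = g (G 𝒜 i j)) :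
    f = g := by
  apply RingQuot.ringQuot_ext'
  apply FreeAlgebra.hom_ext
  funext a
  cases a with
  | cls i x => exact hc i x
  | edge i j => exact he i j

/-- The representation of the symmetric group `S_n` on the Križ algebra. -/
def rep (𝒜 : ℕ → Submodule K H) (n : ℕ) : Representation K (Equiv.Perm (Fin n)) (Model 𝒜 n) where
  toFun σ := (permHom 𝒜 σ).toLinearMap
  map_one' := by
    have : permHom 𝒜 (1 : Equiv.Perm (Fin n)) = AlgHom.id K _ := by
      apply model_hom_ext <;> simp
    rw [this]; rfl
  map_mul' σ τ := by
    have : permHom 𝒜 (σ * τ) = (permHom 𝒜 σ).comp (permHom 𝒜 τ) := by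
      apply model_hom_ext <;> simp
    rw [this]; rfl

theorem rep_apply (σ : Equiv.Perm (Fin n)) (v : Model 𝒜 n) : rep 𝒜 n σ v = permHom 𝒜 σ v := rfl

/-! ### Bigraded components -/

/-- The products of homogeneous classes `p_i^*(x)` and of `q` exterior generators which have total
degree `k`, where `deg p_i^*(x) = deg x` and `deg G_{ij} = 2m - 1`. An entry `(i, d, x)` of `c`
stands for the factor `p_i^*(x)` with `x` homogeneous of degree `d`. -/
def bigradedSet (𝒜 : ℕ → Submodule K H) (m n q : ℕ) (k : ℤ) : Set (Model 𝒜 n) :=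
  {z | ∃ (c : List (Fin n × ℕ × H)) (e : List (Fin n × Fin n)),
    (∀ p ∈ c, p.2.2 ∈ 𝒜 p.2.1) ∧ e.length = q ∧
    (((c.map fun p => p.2.1).sum : ℕ) : ℤ) + (q : ℤ) * (2 * (m : ℤ) - 1) = k ∧
    z = (c.map fun p => cls 𝒜 p.1 p.2.2).prod * (e.map fun p => G 𝒜 p.1 p.2).prod}

/-- The bigraded component `E_q^k(X, n)`, where `m` is the complex dimension of `X`. -/
def bigraded (𝒜 : ℕ → Submodule K H) (m n q : ℕ) (k : ℤ) : Subrepresentation (rep 𝒜 n) where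
  toSubmodule := Submodule.span K (bigradedSet 𝒜 m n q k)
  apply_mem_toSubmodule σ v hv := by
    induction hv using Submodule.span_induction with
    | mem z hz =>
      obtain ⟨c, e, h1, h2, h3, rfl⟩ := hz
      apply Submodule.subset_span
      refine ⟨c.map fun p => (σ p.1, p.2), e.map fun p => (σ p.1, σ p.2), ?_, ?_, ?_, ?_⟩
      · intro p hp
        obtain ⟨p', hp', rfl⟩ := List.mem_map.mp hp
        exact h1 p' hp'
      · simpa using h2
      · simpa [Function.comp_def] using h3
      · simp [rep_apply, map_list_prod, Function.comp_def]
    | zero => simp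
    | add x y _ _ hx hy => rw [map_add]; exact Submodule.add_mem _ hx hy
    | smul a x _ hx => rw [map_smul]; exact Submodule.smul_mem _ a hx

end Algebra

/-! ### Types and type submodules -/

/-- A type `(L_*, H_*)`: the list of the pairs `(λ_i, h_i)`, where the `λ_i ≥ 1` are decreasing with
sum `n` and, for equal lengths, the marks are (weakly) decreasing. -/
structure BambooType (n : ℕ) (ι : Type*) [LinearOrder ι] where
  parts : List (ℕ × ι)
  pos : ∀ p ∈ parts, 1 ≤ p.1
  sum_eq : (parts.map Prod.fst).sum = n
  sorted : parts.Pairwise fun a b => b.1 < a.1 ∨ (b.1 = a.1 ∧ b.2 ≤ a.2)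

namespace BambooType

variable {n : ℕ} {ι : Type*} [LinearOrder ι]

instance instFinite [Finite ι] : Finite (BambooType n ι) := by
  have hle : ∀ (l : List ℕ), (∀ a ∈ l, 1 ≤ a) → l.length ≤ l.sum := by
    intro l
    induction l with
    | nil => simp
    | cons a l ih =>
      intro h
      have h1 := h a (by simp)
      have h2 := ih fun b hb => h b (by simp [hb])
      simp only [List.length_cons, List.sum_cons]
      omega
  let f : BambooType n ι → {l : List (Fin (n + 1) × ι) | l.length ≤ n} := fun τ =>
    ⟨τ.parts.map fun p => (Fin.ofNat (n + 1) p.1, p.2), by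
      have h := hle (τ.parts.map Prod.fst) (by
        intro a ha
        obtain ⟨p, hp, rfl⟩ := List.mem_map.mp ha
        exact τ.pos p hp)
      rw [τ.sum_eq] at h
      simpa using h⟩
  have hfin : Finite {l : List (Fin (n + 1) × ι) | l.length ≤ n} :=
    (List.finite_length_le (Fin (n + 1) × ι) n).to_subtype
  apply Finite.of_injective f
  have hback : ∀ τ : BambooType n ι,
      ((f τ).1.map fun p => ((p.1 : ℕ), p.2)) = τ.parts := by
    intro τ
    simp only [f, List.map_map]
    conv_rhs => rw [← List.map_id τ.parts]
    apply List.map_congr_left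
    intro p hp
    have h : p.1 ≤ n := by
      rw [← τ.sum_eq]
      exact List.le_sum_of_mem (List.mem_map_of_mem hp)
    simp [Fin.ofNat, Nat.mod_eq_of_lt (Nat.lt_succ_of_le h)]
  intro τ τ' h
  have hp : τ.parts = τ'.parts := by rw [← hback τ, ← hback τ', h]
  cases τ; cases τ'; simp_all

noncomputable instance instFintype [Finite ι] : Fintype (BambooType n ι) := Fintype.ofFinite _

/-- `|L_*| = ∑ (λ_i - 1)` -/
def lengthDeg (τ : BambooType n ι) : ℕ := (τ.parts.map fun p => p.1 - 1).sum

/-- `|H_*| = ∑ deg x_{h_i}` -/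
def markDeg (τ : BambooType n ι) (deg : ι → ℕ) : ℕ := (τ.parts.map fun p => deg p.2).sum

end BambooType

/-- The graph on `{1, …, n}` with the given list of edges. -/
def edgeGraph {n : ℕ} (e : List (Fin n × Fin n)) : SimpleGraph (Fin n) :=
  SimpleGraph.fromEdgeSet {s | s ∈ e.map fun p => s(p.1, p.2)}

/-- `c` and `e` describe a marked forest of type `τ`: the edges in `e` are pairwise distinct,
they form a forest, each connected component carries exactly one mark (an entry `(v, h)` of `c` puts
the mark `h` on the component of the vertex `v`), and the sizes and the marks of the components
are, up to order, the pairs `(λ_i, h_i)` of `τ`. -/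
structure IsMarkedForest {n : ℕ} {ι : Type*} [LinearOrder ι] (τ : BambooType n ι)
    (c : List (Fin n × ι)) (e : List (Fin n × Fin n)) : Prop where
  loopless : ∀ p ∈ e, p.1 ≠ p.2
  edges_nodup : (e.map fun p => s(p.1, p.2)).Nodup
  acyclic : (edgeGraph e).IsAcyclic
  marks_nodup : (c.map fun p => (edgeGraph e).connectedComponentMk p.1).Nodup
  marks_cover : ∀ C : (edgeGraph e).ConnectedComponent,
    C ∈ c.map fun p => (edgeGraph e).connectedComponentMk p.1
  type_eq : (c.map fun p => (((edgeGraph e).connectedComponentMk p.1).supp.ncard, p.2)).Perm τ.parts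

theorem edgeGraph_adj {n : ℕ} (e : List (Fin n × Fin n)) (a b : Fin n) :
    (edgeGraph e).Adj a b ↔ s(a, b) ∈ (e.map fun p => s(p.1, p.2)) ∧ a ≠ b := by
  simp only [edgeGraph, SimpleGraph.fromEdgeSet_adj, Set.mem_ofPred_eq]

/-- A permutation of the vertices is an isomorphism onto the graph with permuted edges. -/
def edgeGraphIso {n : ℕ} (σ : Equiv.Perm (Fin n)) (e : List (Fin n × Fin n)) :
    edgeGraph e ≃g edgeGraph (e.map fun p => (σ p.1, σ p.2)) where
  toEquiv := σ
  map_rel_iff' := by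
    intro a b
    rw [edgeGraph_adj, edgeGraph_adj]
    have h : (e.map fun p => (σ p.1, σ p.2)).map (fun p => s(p.1, p.2)) =
        (e.map fun p => s(p.1, p.2)).map (Sym2.map σ) := by
      simp [Function.comp_def]
    rw [h, σ.injective.ne_iff, ← Sym2.map_mk, List.mem_map_of_injective (Sym2.map.injective σ.injective)]

theorem IsMarkedForest.perm {n : ℕ} {ι : Type*} [LinearOrder ι] {τ : BambooType n ι}
    {c : List (Fin n × ι)} {e : List (Fin n × Fin n)} (h : IsMarkedForest τ c e)
    (σ : Equiv.Perm (Fin n)) :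
    IsMarkedForest τ (c.map fun p => (σ p.1, p.2)) (e.map fun p => (σ p.1, σ p.2)) := by
  set I := edgeGraphIso σ e with hI
  have hmk : ∀ v, (edgeGraph (e.map fun p => (σ p.1, σ p.2))).connectedComponentMk (σ v) =
      I.connectedComponentEquiv ((edgeGraph e).connectedComponentMk v) := fun v => rfl
  have hcomp : ((c.map fun p => (σ p.1, p.2)).map fun p =>
      (edgeGraph (e.map fun p => (σ p.1, σ p.2))).connectedComponentMk p.1) =
      (c.map fun p => (edgeGraph e).connectedComponentMk p.1).map I.connectedComponentEquiv := by
    simp [Function.comp_def, hmk]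
  refine ⟨?_, ?_, ?_, ?_, ?_, ?_⟩
  · intro p hp
    obtain ⟨p', hp', rfl⟩ := List.mem_map.mp hp
    exact σ.injective.ne (h.loopless p' hp')
  · have : (e.map fun p => (σ p.1, σ p.2)).map (fun p => s(p.1, p.2)) =
        (e.map fun p => s(p.1, p.2)).map (Sym2.map σ) := by
      simp [Function.comp_def]
    rw [this]
    exact h.edges_nodup.map (Sym2.map.injective σ.injective)
  · exact I.isAcyclic_iff.mp h.acyclic
  · rw [hcomp]
    exact h.marks_nodup.map I.connectedComponentEquiv.injective
  · intro C
    rw [hcomp]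
    obtain ⟨D, rfl⟩ := I.connectedComponentEquiv.surjective C
    exact List.mem_map_of_mem (h.marks_cover D)
  · have hsz : ∀ v, ((edgeGraph (e.map fun p => (σ p.1, σ p.2))).connectedComponentMk
        (σ v)).supp.ncard = ((edgeGraph e).connectedComponentMk v).supp.ncard := by
      intro v
      have : ((edgeGraph (e.map fun p => (σ p.1, σ p.2))).connectedComponentMk (σ v)).supp =
          σ '' ((edgeGraph e).connectedComponentMk v).supp := by
        ext w
        obtain ⟨u, rfl⟩ := σ.surjective w
        rw [σ.injective.mem_set_image, SimpleGraph.ConnectedComponent.mem_supp_iff,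
          SimpleGraph.ConnectedComponent.mem_supp_iff, hmk, hmk,
          I.connectedComponentEquiv.injective.eq_iff]
      rw [this, Set.ncard_image_of_injective _ σ.injective]
    have := h.type_eq
    simpa [Function.comp_def, hsz] using this

section TypeSubmodule

variable {K : Type*} [Field K] {H : Type*} [Ring H] [Algebra K H] (𝒜 : ℕ → Submodule K H)
  {n : ℕ} {ι : Type*} [LinearOrder ι]

/-- The monomials `p_{v_1}^*(x_{h_1}) ⋯ p_{v_t}^*(x_{h_t}) G_{i_1 j_1} ⋯ G_{i_q j_q}` whose associated
marked graph is a forest of type `τ`; here `x : ι → H` is the chosen basis. As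
`p_i^*(x) G_{ij} = p_j^*(x) G_{ij}`, the vertex of its component on which a mark is written
is immaterial. -/
def typeSet (x : ι → H) (τ : BambooType n ι) : Set (Model 𝒜 n) :=
  {z | ∃ (c : List (Fin n × ι)) (e : List (Fin n × Fin n)), IsMarkedForest τ c e ∧
    z = (c.map fun p => cls 𝒜 p.1 (x p.2)).prod * (e.map fun p => G 𝒜 p.1 p.2).prod}

/-- The type submodule `E(L_*, H_*)`. -/
def typeSub (x : ι → H) (τ : BambooType n ι) : Subrepresentation (rep 𝒜 n) where
  toSubmodule := Submodule.span K (typeSet 𝒜 x τ)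
  apply_mem_toSubmodule σ v hv := by
    induction hv using Submodule.span_induction with
    | mem z hz =>
      obtain ⟨c, e, h, rfl⟩ := hz
      apply Submodule.subset_span
      refine ⟨_, _, h.perm σ, ?_⟩
      simp [rep_apply, map_list_prod, Function.comp_def]
    | zero => simp
    | add x y _ _ hx hy => rw [map_add]; exact Submodule.add_mem _ hx hy
    | smul a x _ hx => rw [map_smul]; exact Submodule.smul_mem _ a hx

end TypeSubmodule

/-! ### The groups `C`, `N`, `Z` and the character `ξ` -/

namespace BambooType

variable {n : ℕ} {ι : Type*} [LinearOrder ι] (τ : BambooType n ι)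

/-- `L_i = λ_1 + ⋯ + λ_i` -/
def partialSum (i : ℕ) : ℕ := ((τ.parts.take i).map Prod.fst).sum

/-- The `i`-th block `L_i, L_i + 1, …, L_{i+1} - 1` (blocks and points are counted from `0`),
in increasing order. -/
def block (i : ℕ) : List (Fin n) :=
  (List.finRange n).filter fun a => τ.partialSum i ≤ (a : ℕ) ∧ (a : ℕ) < τ.partialSum (i + 1)

/-- The cycle `c_{λ_i}`, running through the `i`-th block in increasing order. -/
def blockCycle (i : ℕ) : Equiv.Perm (Fin n) := (τ.block i).formPerm

/-- The block transposition `v_i`: the product of the transpositions exchanging the `a`-th elements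
of the blocks `i` and `i + 1`. -/
def blockSwap (i : ℕ) : Equiv.Perm (Fin n) :=
  (((τ.block i).zip (τ.block (i + 1))).map fun p => Equiv.swap p.1 p.2).prod

/-- `C_{L_*} = ⟨c_{λ_1}⟩ × ⋯ × ⟨c_{λ_t}⟩` -/
def C : Subgroup (Equiv.Perm (Fin n)) :=
  Subgroup.closure {g | ∃ i : ℕ, i < τ.parts.length ∧ g = τ.blockCycle i}

/-- `N_{(L_*, H_*)}` is generated by the `v_i` with `λ_i = λ_{i+1}` and `h_i = h_{i+1}`. -/
def N : Subgroup (Equiv.Perm (Fin n)) :=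
  Subgroup.closure {g | ∃ (i : ℕ) (_ : i + 1 < τ.parts.length),
    τ.parts[i] = τ.parts[i + 1] ∧ g = τ.blockSwap i}

/-- `Z_{(L_*, H_*)} = C_{L_*} ⋊ N_{(L_*, H_*)}` -/
def Z : Subgroup (Equiv.Perm (Fin n)) := τ.C ⊔ τ.N

theorem blockCycle_mem {i : ℕ} (hi : i < τ.parts.length) : τ.blockCycle i ∈ τ.Z :=
  (le_sup_left : τ.C ≤ τ.Z) (Subgroup.subset_closure ⟨i, hi, rfl⟩)

theorem blockSwap_mem {i : ℕ} (hi : i + 1 < τ.parts.length)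
    (h : τ.parts[i] = τ.parts[i + 1]) : τ.blockSwap i ∈ τ.Z :=
  (le_sup_right : τ.N ≤ τ.Z) (Subgroup.subset_closure ⟨i, hi, h, rfl⟩)

/-- `ξ` is the linear character `φ_{L_*} · α_{(L_*, H_*)}` of `Z_{(L_*, H_*)}`. On the cyclic factors,
`φ_{L_*}(c_{λ_i}) = e^{2 π √-1 / λ_i} ε(c_{λ_i})` with `ε` the sign character of `S_n`; on the block
transpositions, `α(v_i) = (-1)^{λ_i + 1}` if `deg x_{h_i}` is even and `(-1)^{λ_i}` if it is odd. -/
structure IsXi (deg : ι → ℕ) (ξ : τ.Z →* ℂˣ) : Prop where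
  on_cycle : ∀ (i : ℕ) (hi : i < τ.parts.length),
    (ξ ⟨τ.blockCycle i, τ.blockCycle_mem hi⟩ : ℂ) =
      Complex.exp (2 * Real.pi * Complex.I / (τ.parts[i].1 : ℂ)) *
        ((Equiv.Perm.sign (τ.blockCycle i) : ℤ) : ℂ)
  on_swap_even : ∀ (i : ℕ) (hi : i + 1 < τ.parts.length) (h : τ.parts[i] = τ.parts[i + 1]),
    Even (deg τ.parts[i].2) →
      (ξ ⟨τ.blockSwap i, τ.blockSwap_mem hi h⟩ : ℂ) = (-1) ^ (τ.parts[i].1 + 1)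
  on_swap_odd : ∀ (i : ℕ) (hi : i + 1 < τ.parts.length) (h : τ.parts[i] = τ.parts[i + 1]),
    Odd (deg τ.parts[i].2) →
      (ξ ⟨τ.blockSwap i, τ.blockSwap_mem hi h⟩ : ℂ) = (-1) ^ τ.parts[i].1

end BambooType

/-- The character of a representation over a subfield `K` of `ℂ`, as a complex-valued function. -/
noncomputable def complexChar {K : Type*} [Field K] [Algebra K ℂ] {G : Type*} [Group G]
    {V : Type*} [AddCommMonoid V] [Module K V] (ρ : Representation K G V) (g : G) : ℂ :=
  algebraMap K ℂ (LinearMap.trace K V (ρ g))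

open Classical in
/-- The character of a finite group `G` induced from a linear character `ξ` of a subgroup `Z`:
`(Ind_Z^G ξ)(g) = |Z|⁻¹ ∑_{s ∈ G, s⁻¹ g s ∈ Z} ξ(s⁻¹ g s)`. -/
noncomputable def inducedChar {G : Type*} [Group G] [Fintype G] (Z : Subgroup G) (ξ : Z →* ℂˣ)
    (g : G) : ℂ :=
  (Nat.card Z : ℂ)⁻¹ * ∑ s : G, if h : s⁻¹ * g * s ∈ Z then (ξ ⟨s⁻¹ * g * s, h⟩ : ℂ) else 0

end Kriz

/-!
# The characters of the symmetric group on the Križ algebra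

The basic monomials are the *bamboos*: for a word `w = w₁ … w_l` in the letters `1, …, n` and a
class `x`, the product `G_{w₁w₂} ⋯ G_{w_{l-1}w_l} p_{w_l}^*(x)`. By the Arnold relation a product of
edges is a combination of products of paths (`prod_G_mem_pathSpan`). Hence, for each type `τ`, the
type submodule is spanned by the orbit of one product of bamboos, `typeVec τ 1`, whose words are the
blocks of `τ` (`span_typeSet`), and the sum of these submodules is the whole algebra
(`span_typeVec`).

*Upper bound.* The Arnold relation also yields a shuffle relation: a path through `z` is a signed
sum of paths which end in `z` (`bamboo_middle`). With `z` the greatest letter of each word, it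
follows that the permutations which take their greatest value on each block at its end suffice.
Up to sign there is one such monomial for each coset of `Z`, since `N` acts on the monomials by
signs (`exists_coset_vectors`).

*Lower bound.* It is provided by functionals. On words, let `f(w) = sgn(w) r^{D(w)}`, where `r` is
a primitive root of unity of order the length of `w` and `D` is a weighted count of descents
(`wordVal`; this is Klyachko's idempotent, twisted by the sign). A `q`-binomial identity shows that
`f` satisfies the shuffle relation (`wordVal_middle`), and cyclic shifts multiply `f` by
`(-1)^{l-1} r`. To obtain from `f` a functional on the algebra itself, the algebra is represented
on a tensor power of endomorphism algebras over the points `1, …, n`, made supercommutative by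
parity operators: once the elements of each block are ordered, `G_{ij}` with `i`, `j` in the same
block acts at the earlier of the two points, and `p_i^*(x)` at the last point of the block of `i`.
The coefficients of these operators detect single monomials (`exists_detects`), and suitable
combinations of them form, for each type `τ`, a functional `m_τ` with the values `∏ f` on the
monomials of `τ` which respect the blocks, and vanishing on all the other types
(`exists_typeFunctional`).

The functional `m_τ` is an eigenvector of `Z`, and its character is `ξ` (`exists_xi_functional`);
summing over the powers of the cycles, one sees that `m_τ` separates the cosets of `Z`, because the
Fourier coefficient of `f` on the rotations of a word vanishes unless the word is a rotation of the
increasing one (`exists_rotate_sorted_of_sum_ne_zero`). Thus the vectors of the upper bound are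
linearly independent, and the action is the sum of the representations induced from the
characters `ξ` (`complexChar_eq_sum_inducedChar`).
-/

namespace Kriz

/-! ### A criterion for a character to be a sum of induced characters -/

section InducedCharacters

theorem mk_out_mul_bijective {G : Type*} [Group G] (Z : Subgroup G) :
    Function.Bijective fun p : (G ⧸ Z) × Z => p.1.out * (p.2 : G) := by
  constructor
  · rintro ⟨q, z⟩ ⟨q', z'⟩ h
    have hq : q = q' := by
      have h' : (QuotientGroup.mk (q.out * (z : G)) : G ⧸ Z) =
        QuotientGroup.mk (q'.out * (z' : G)) := congrArg _ h
      rwa [QuotientGroup.mk_mul_of_mem _ z.2, QuotientGroup.mk_mul_of_mem _ z'.2,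
        QuotientGroup.out_eq', QuotientGroup.out_eq'] at h'
    subst hq
    have h2 : (z : G) = z' := mul_left_cancel h
    rw [Subtype.ext h2]
  · intro s
    obtain ⟨z, hz⟩ := QuotientGroup.mk_out_eq_mul Z s
    exact ⟨(QuotientGroup.mk s, z⁻¹), by simp [hz]⟩

open Classical in
/-- The induced character as a sum over the cosets which `g` fixes. -/
theorem inducedChar_eq_sum_quotient {G : Type*} [Group G] [Fintype G] (Z : Subgroup G)
    (ξ : Z →* ℂˣ) (g : G) :
    inducedChar Z ξ g =
      ∑ q : G ⧸ Z, if h : q.out⁻¹ * g * q.out ∈ Z then (ξ ⟨q.out⁻¹ * g * q.out, h⟩ : ℂ) else 0 := by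
  have hcard : (Nat.card Z : ℂ) ≠ 0 := by exact_mod_cast Nat.card_pos.ne'
  rw [inducedChar, inv_mul_eq_iff_eq_mul₀ hcard]
  rw [← (mk_out_mul_bijective Z).sum_comp fun s =>
    if h : s⁻¹ * g * s ∈ Z then (ξ ⟨s⁻¹ * g * s, h⟩ : ℂ) else 0]
  rw [Fintype.sum_prod_type, Finset.mul_sum]
  refine Finset.sum_congr rfl fun q _ => ?_
  have key : ∀ z : Z, (if h : (q.out * (z : G))⁻¹ * g * (q.out * z) ∈ Z then
      (ξ ⟨(q.out * (z : G))⁻¹ * g * (q.out * z), h⟩ : ℂ) else 0) =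
      if h : q.out⁻¹ * g * q.out ∈ Z then (ξ ⟨q.out⁻¹ * g * q.out, h⟩ : ℂ) else 0 := by
    intro z
    have e : (q.out * (z : G))⁻¹ * g * (q.out * z) = (z : G)⁻¹ * (q.out⁻¹ * g * q.out) * z := by
      group
    by_cases h : q.out⁻¹ * g * q.out ∈ Z
    · have h' : (q.out * (z : G))⁻¹ * g * (q.out * z) ∈ Z := by
        rw [e]; exact Z.mul_mem (Z.mul_mem (Z.inv_mem z.2) h) z.2
      rw [dif_pos h, dif_pos h']
      have : (⟨_, h'⟩ : Z) = z⁻¹ * ⟨_, h⟩ * z := Subtype.ext e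
      rw [this, map_mul, map_mul, map_inv, mul_comm, mul_inv_cancel_left]
    · have h' : (q.out * (z : G))⁻¹ * g * (q.out * z) ∉ Z := by
        rw [e]
        intro h'
        apply h
        have := Z.mul_mem (Z.mul_mem z.2 h') (Z.inv_mem z.2)
        convert this using 1
        group
      rw [dif_neg h, dif_neg h']
  simp only [key]
  simp [Nat.card_eq_fintype_card]

/-- Let `V` be spanned by vectors `v τ q` indexed by the cosets `q` of subgroups `Z τ` of `G`, and
let `m τ` be `ξ τ`-equivariant functionals which, on the orbits of vectors `P τ`, separate the
different `τ` and the different cosets. Then the character of `V` is `∑ Ind (ξ τ)`: evaluated on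
the vectors `v`, the translates of the functionals form a square matrix which has a right inverse,
so that `v` is a basis, and this matrix conjugates the action of `g` into a monomial matrix. -/
theorem complexChar_eq_sum_inducedChar {K : Type*} [Field K] [Algebra K ℂ] {G : Type*} [Group G]
    [Fintype G] {V : Type*} [AddCommGroup V] [Module K V] (ρ : Representation K G V)
    {T : Type*} [Fintype T] (Z : T → Subgroup G) (ξ : ∀ τ, Z τ →* ℂˣ)
    (v : (Σ τ, G ⧸ Z τ) → V) (hspan : ⊤ ≤ Submodule.span K (Set.range v))
    (m : T → V →ₗ[K] ℂ) (hm : ∀ τ (z : Z τ) x, m τ (ρ z x) = ξ τ z * m τ x)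
    (P : T → V) (γ : T → G → ℂ)
    (hne : ∀ τ τ' g, τ ≠ τ' → m τ (ρ g (P τ')) = 0)
    (hnot : ∀ τ g, g ∉ Z τ → ∑ s, γ τ s * m τ (ρ (g * s) (P τ)) = 0)
    (hone : ∀ τ, ∑ s, γ τ s * m τ (ρ s (P τ)) ≠ 0) (g : G) :
    complexChar ρ g = ∑ τ, inducedChar (Z τ) (ξ τ) g := by
  classical
  have hc : ∀ x : V, ∃ c : (Σ τ, G ⧸ Z τ) → K, ∑ j, c j • v j = x := fun x =>
    (Submodule.mem_span_range_iff_exists_fun K).mp (hspan trivial)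
  choose c hc using hc
  obtain ⟨A, hAd⟩ : ∃ A : Matrix (Σ τ, G ⧸ Z τ) (Σ τ, G ⧸ Z τ) ℂ,
      ∀ i j, A i j = m i.1 (ρ i.2.out⁻¹ (v j)) := ⟨Matrix.of _, fun _ _ => rfl⟩
  obtain ⟨B, hBd⟩ : ∃ B : Matrix (Σ τ, G ⧸ Z τ) (Σ τ, G ⧸ Z τ) ℂ, ∀ j i,
      B j i = ∑ s, γ i.1 s * algebraMap K ℂ (c (ρ (i.2.out * s) (P i.1)) j) :=
    ⟨Matrix.of _, fun _ _ => rfl⟩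
  have hA : ∀ i x, ∑ j, A i j * algebraMap K ℂ (c x j) = m i.1 (ρ i.2.out⁻¹ x) := by
    intro i x
    conv_rhs => rw [← hc x]
    simp only [map_sum, map_smul, Algebra.smul_def, hAd, mul_comm]
  have hAB : A * B = Matrix.diagonal fun i => ∑ s, γ i.1 s * m i.1 (ρ s (P i.1)) := by
    ext i i'
    have h1 : (A * B) i i' = ∑ s, γ i'.1 s * m i.1 (ρ (i.2.out⁻¹ * i'.2.out * s) (P i'.1)) := by
      simp only [Matrix.mul_apply, hBd, Finset.mul_sum]
      rw [Finset.sum_comm]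
      refine Finset.sum_congr rfl fun s _ => ?_
      have h2 : ρ (i.2.out⁻¹ * i'.2.out * s) = ρ i.2.out⁻¹ * ρ (i'.2.out * s) := by
        rw [mul_assoc, map_mul]
      rw [h2, Module.End.mul_apply, ← hA, Finset.mul_sum]
      exact Finset.sum_congr rfl fun j _ => by ring
    rw [h1]
    by_cases hii : i = i'
    · subst hii
      simp
    · rw [Matrix.diagonal_apply_ne _ hii]
      obtain ⟨τ, q⟩ := i
      obtain ⟨τ', q'⟩ := i'
      by_cases hτ : τ = τ'
      · subst hτ
        apply hnot
        intro hz
        apply hii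
        have : q = q' := by
          rw [← QuotientGroup.out_eq' q, ← QuotientGroup.out_eq' q']
          exact QuotientGroup.eq.mpr hz
        rw [this]
      · exact Finset.sum_eq_zero fun s _ => by rw [hne _ _ _ hτ, mul_zero]
  have hdet : IsUnit A.det := by
    have : (A * B).det ≠ 0 := by
      rw [hAB, Matrix.det_diagonal]
      exact Finset.prod_ne_zero_iff.mpr fun i _ => hone i.1
    rw [Matrix.det_mul] at this
    exact isUnit_iff_ne_zero.mpr (left_ne_zero_of_mul this)
  have hinj : Function.Injective (algebraMap K ℂ) := (algebraMap K ℂ).injective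
  have hli : LinearIndependent K v := by
    rw [Fintype.linearIndependent_iff]
    intro k hk
    have h0 : A.mulVec (fun j => algebraMap K ℂ (k j)) = 0 := by
      ext i
      have : m i.1 (ρ i.2.out⁻¹ (∑ j, k j • v j)) = 0 := by rw [hk, map_zero, map_zero]
      rw [map_sum, map_sum] at this
      simp only [map_smul, Algebra.smul_def] at this
      simp only [Matrix.mulVec, dotProduct, hAd, Pi.zero_apply, ← this]
      exact Finset.sum_congr rfl fun j _ => mul_comm _ _
    have h1 := Matrix.eq_zero_of_mulVec_eq_zero hdet.ne_zero h0
    intro j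
    apply hinj
    rw [map_zero]
    exact congrFun h1 j
  let b := Module.Basis.mk hli hspan
  let X := LinearMap.toMatrix b b (ρ g)
  have hmem : ∀ τ (q : G ⧸ Z τ), (g⁻¹ • q).out⁻¹ * (g⁻¹ * q.out) ∈ Z τ := fun τ q => by
    rw [← QuotientGroup.eq, QuotientGroup.out_eq', ← smul_eq_mul,
      ← MulAction.Quotient.smul_mk, QuotientGroup.out_eq']
  obtain ⟨M, hMd⟩ : ∃ M : Matrix (Σ τ, G ⧸ Z τ) (Σ τ, G ⧸ Z τ) ℂ, ∀ i j, M i j =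
      if j = ⟨i.1, g⁻¹ • i.2⟩ then (((ξ i.1 ⟨_, hmem i.1 i.2⟩)⁻¹ : ℂˣ) : ℂ) else 0 :=
    ⟨Matrix.of _, fun _ _ => rfl⟩
  have hAX : A * X.map (algebraMap K ℂ) = M * A := by
    ext i j
    have h1 : (A * X.map (algebraMap K ℂ)) i j = m i.1 (ρ i.2.out⁻¹ (ρ g (v j))) := by
      have : ρ g (v j) = ∑ k, X k j • v k := by
        have h2 : v j = b j := by simp [b]
        rw [h2, ← b.sum_repr (ρ g (b j))]
        refine Finset.sum_congr rfl fun k _ => ?_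
        simp [X, LinearMap.toMatrix_apply, b]
      rw [this]
      simp only [map_sum, map_smul, Matrix.mul_apply, Matrix.map_apply, hAd, Algebra.smul_def]
      exact Finset.sum_congr rfl fun k _ => mul_comm _ _
    rw [h1]
    simp only [Matrix.mul_apply, hMd, ite_mul, zero_mul, Finset.sum_ite_eq',
      Finset.mem_univ, if_true, hAd]
    rw [Units.val_inv_eq_inv_val, eq_inv_mul_iff_mul_eq₀ (Units.ne_zero _), ← hm,
      ← Module.End.mul_apply, ← Module.End.mul_apply, ← map_mul, ← map_mul]
    congr 3
    group
  have htr : algebraMap K ℂ X.trace = M.trace := by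
    have hX : X.map (algebraMap K ℂ) = A⁻¹ * (M * A) := by
      rw [← hAX, ← mul_assoc, Matrix.nonsing_inv_mul _ hdet, one_mul]
    have h2 : algebraMap K ℂ X.trace = (X.map (algebraMap K ℂ)).trace := by
      simp [Matrix.trace]
    rw [h2]
    rw [hX, Matrix.trace_mul_comm, mul_assoc, Matrix.mul_nonsing_inv _ hdet, mul_one]
  rw [complexChar, LinearMap.trace_eq_matrix_trace K b]
  change algebraMap K ℂ X.trace = _
  rw [htr, Matrix.trace, Fintype.sum_sigma]
  refine Finset.sum_congr rfl fun τ _ => ?_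
  rw [inducedChar_eq_sum_quotient]
  refine Finset.sum_congr rfl fun q _ => ?_
  have hfix : q = g⁻¹ • q ↔ q.out⁻¹ * g * q.out ∈ Z τ := by
    rw [eq_inv_smul_iff, mul_assoc, ← QuotientGroup.eq, QuotientGroup.out_eq', ← smul_eq_mul,
      ← MulAction.Quotient.smul_mk, QuotientGroup.out_eq', eq_comm]
  simp only [Matrix.diag_apply, hMd]
  by_cases h : q = g⁻¹ • q
  · rw [dif_pos (hfix.mp h), if_pos (by rw [← h]), ← map_inv]
    congr 2
    apply Subtype.ext
    simp only [InvMemClass.coe_inv, ← h]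
    group
  · rw [dif_neg (fun h' => h (hfix.mpr h')), if_neg]
    intro h'
    apply h
    simpa using h'

end InducedCharacters

end Kriz

namespace Kriz

/-! ### Words: inversions, descents and shuffles -/

section Words

/-- The sum of `φ` over the shuffles of two words, each shuffle being followed by the word `w`.
The two words are given in reverse order, so that the recursion moves their last letters to the
front of `w`; a shuffle carries the sign of the permutation which separates the two words. -/
def shSum {α M : Type*} [AddCommGroup M] (φ : List α → M) : List α → List α → List α → M
  | [], v, w => φ (v.reverse ++ w)
  | x :: u, [], w => φ ((x :: u).reverse ++ w)
  | x :: u, y :: v, w =>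
    shSum φ (x :: u) v (y :: w) + (-1 : ℤ) ^ (v.length + 1) • shSum φ u (y :: v) (x :: w)
  termination_by u v => u.length + v.length

theorem shSum_nil_right {α M : Type*} [AddCommGroup M] (φ : List α → M) (u w : List α) :
    shSum φ u [] w = φ (u.reverse ++ w) := by
  cases u <;> simp [shSum]

theorem map_shSum {α M N : Type*} [AddCommGroup M] [AddCommGroup N] (g : M →+ N)
    (φ : List α → M) (u v w : List α) :
    g (shSum φ u v w) = shSum (fun l => g (φ l)) u v w := by
  fun_induction shSum φ u v w with
  | case1 => simp [shSum]
  | case2 => simp [shSum]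
  | case3 x u y v w h1 h2 => rw [shSum, ← h1, ← h2, map_add, map_zsmul]

theorem shSum_congr {α M : Type*} [AddCommGroup M] (φ ψ : List α → M) (u v w : List α)
    (h : ∀ s : List α, s.Perm (u ++ v) → φ (s ++ w) = ψ (s ++ w)) :
    shSum φ u v w = shSum ψ u v w := by
  fun_induction shSum φ u v w with
  | case1 v w => simpa [shSum] using h v.reverse (by simp [List.reverse_perm])
  | case2 x u w =>
    simpa [shSum] using h (x :: u).reverse (by simpa using List.reverse_perm (x :: u))
  | case3 x u y v w h1 h2 =>
    rw [shSum, h1, h2]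
    · intro s hs
      have := h (s ++ [x]) (by
        refine (List.perm_append_singleton x s).trans ?_
        exact hs.cons x)
      simpa using this
    · intro s hs
      have := h (s ++ [y]) (by
        refine (List.perm_append_singleton y s).trans ((hs.cons y).trans ?_)
        exact List.perm_middle.symm)
      simpa using this

theorem shSum_mem {R α M : Type*} [Ring R] [AddCommGroup M] [Module R M] (N : Submodule R M)
    (φ : List α → M) (u v w : List α)
    (h : ∀ s : List α, s.Perm (u ++ v) → φ (s ++ w) ∈ N) : shSum φ u v w ∈ N := by
  fun_induction shSum φ u v w with
  | case1 v w => exact h v.reverse (by simp [List.reverse_perm])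
  | case2 x u w => exact h (x :: u).reverse (by simpa using List.reverse_perm (x :: u))
  | case3 x u y v w h1 h2 =>
    refine N.add_mem (h1 ?_) (zsmul_mem (h2 ?_) _)
    · intro s hs
      have := h (s ++ [y]) (by
        refine (List.perm_append_singleton y s).trans ((hs.cons y).trans ?_)
        exact List.perm_middle.symm)
      simpa using this
    · intro s hs
      have := h (s ++ [x]) (by
        refine (List.perm_append_singleton x s).trans ?_
        exact hs.cons x)
      simpa using this

variable {α : Type*} [LinearOrder α]

/-- The sign of a word: `(-1)` to the number of inversions. -/
def invSign : List α → ℤ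
  | [] => 1
  | x :: l => (-1) ^ l.countP (· < x) * invSign l

theorem invSign_mul_self (l : List α) : invSign l * invSign l = 1 := by
  induction l with
  | nil => rfl
  | cons x l ih =>
    rw [invSign, mul_mul_mul_comm, ih, ← pow_add, Even.neg_one_pow ⟨_, rfl⟩, mul_one]

theorem invSign_swap (A B : List α) {x y : α} (h : x ≠ y) :
    invSign (A ++ x :: y :: B) = -invSign (A ++ y :: x :: B) := by
  induction A with
  | nil =>
    simp only [List.nil_append, invSign, List.countP_cons, decide_eq_true_eq]
    rcases lt_or_gt_of_ne h with h' | h'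
    · rw [if_neg h'.not_gt, if_pos h']; ring
    · rw [if_neg h'.not_gt, if_pos h']; ring
  | cons a A ih =>
    have : (A ++ x :: y :: B).countP (· < a) = (A ++ y :: x :: B).countP (· < a) :=
      ((List.Perm.swap y x B).append_left A).countP_eq _
    rw [List.cons_append, invSign, this, ih, List.cons_append, invSign, mul_neg]

theorem invSign_move (A V B : List α) {x : α} (h : x ∉ V) :
    invSign (A ++ x :: (V ++ B)) = (-1) ^ V.length * invSign (A ++ (V ++ x :: B)) := by
  induction V generalizing A with
  | nil => simp
  | cons y V ih =>
    rw [List.mem_cons, not_or] at h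
    have := ih (A ++ [y]) h.2
    simp only [List.append_assoc, List.cons_append, List.nil_append] at this
    rw [List.cons_append, invSign_swap A _ h.1, this, List.length_cons, pow_succ]
    simp

theorem invSign_reverse_middle (A V B : List α) (h : V.Nodup) :
    invSign (A ++ (V.reverse ++ B)) =
      (-1) ^ (V.length * (V.length - 1) / 2) * invSign (A ++ (V ++ B)) := by
  induction V generalizing B with
  | nil => simp
  | cons y V ih =>
    rw [List.nodup_cons] at h
    have h1 := ih (y :: B) h.2
    have h2 : (-1 : ℤ) ^ V.length * (-1) ^ V.length = 1 := by
      rw [← pow_add, Even.neg_one_pow ⟨_, rfl⟩]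
    have h3 : (y :: V).length * ((y :: V).length - 1) / 2 =
        V.length + V.length * (V.length - 1) / 2 := by
      rw [← Finset.sum_range_id, ← Finset.sum_range_id, List.length_cons, Finset.sum_range_succ,
        add_comm]
    rw [List.reverse_cons, List.append_assoc, List.singleton_append, h1, List.cons_append,
      invSign_move A V B h.1, h3, pow_add]
    linear_combination (-(-1 : ℤ) ^ (V.length * (V.length - 1) / 2) *
      invSign (A ++ (V ++ y :: B))) * h2

theorem invSign_map {β : Type*} [LinearOrder β] (c : α → β) (l : List α)
    (hc : ∀ x ∈ l, ∀ y ∈ l, (c x < c y ↔ x < y)) : invSign (l.map c) = invSign l := by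
  induction l with
  | nil => rfl
  | cons x l ih =>
    rw [List.map_cons, invSign, invSign, ih fun a ha b hb => hc a (by simp [ha]) b (by simp [hb]),
      List.countP_map]
    congr 2
    refine List.countP_congr fun y hy => ?_
    simpa using hc y (by simp [hy]) x (by simp)

/-- The sum, over the adjacent letters `x, y` of a word with `R x y`, of the number of letters
from `y` on. For `R = (· > ·)` and a word of length `n` this is minus the major index modulo `n`;
for `R = (· < ·)` it is the major index of the reversed word. -/
def descWeight (R : α → α → Prop) [DecidableRel R] : List α → ℕ
  | [] => 0
  | [_] => 0
  | x :: y :: l => (if R x y then l.length + 1 else 0) + descWeight R (y :: l)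

/-- The number of descents of a word. -/
def descCount : List α → ℕ
  | [] => 0
  | [_] => 0
  | x :: y :: l => (if y < x then 1 else 0) + descCount (y :: l)

theorem descWeight_map {β : Type*} [LinearOrder β] (c : α → β) (l : List α)
    (hc : ∀ x ∈ l, ∀ y ∈ l, (c x < c y ↔ x < y)) :
    descWeight (· > ·) (l.map c) = descWeight (· > ·) l := by
  induction l with
  | nil => rfl
  | cons x l ih =>
    have ih' := ih fun a ha b hb => hc a (by simp [ha]) b (by simp [hb])
    cases l with
    | nil => rfl
    | cons y l =>
      simp only [List.map_cons] at ih' ⊢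
      rw [descWeight, descWeight, ih', List.length_map]
      congr 1
      have := hc y (by simp) x (by simp)
      simp only [gt_iff_lt, this]

theorem descWeight_lt_add_gt (l : List α) (h : l.Nodup) :
    descWeight (· < ·) l + descWeight (· > ·) l = l.length * (l.length - 1) / 2 := by
  induction l with
  | nil => simp [descWeight]
  | cons x l ih =>
    cases l with
    | nil => simp [descWeight]
    | cons y l =>
      have ih' := ih (List.nodup_cons.mp h).2
      have hxy : x ≠ y := by
        rintro rfl
        simp at h
      have h3 : (x :: y :: l).length * ((x :: y :: l).length - 1) / 2 =
          l.length + 1 + (y :: l).length * ((y :: l).length - 1) / 2 := by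
        rw [← Finset.sum_range_id, ← Finset.sum_range_id, List.length_cons, Finset.sum_range_succ,
          add_comm, List.length_cons]
      rw [h3, ← ih', descWeight, descWeight]
      rcases lt_or_gt_of_ne hxy with h' | h'
      · rw [if_pos h', if_neg (by simpa using h'.le)]; ring
      · rw [if_neg h'.not_gt, if_pos h']; ring

variable {F : Type*} [Field F]

/-- The `q`-binomial coefficient `[p + r choose p]`, by its Pascal recursion. -/
def qBinom (q : F) : ℕ → ℕ → F
  | 0, _ => 1
  | _ + 1, 0 => 1
  | p + 1, r + 1 => q ^ (p + 1) * qBinom q (p + 1) r + qBinom q p (r + 1)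

theorem qBinom_zero_right (q : F) (p : ℕ) : qBinom q p 0 = 1 := by
  cases p <;> simp [qBinom]

theorem qBinom_zero_left (q : F) (p : ℕ) : qBinom q 0 p = 1 := by
  simp [qBinom]

theorem qBinom_succ_succ (q : F) (p r : ℕ) :
    qBinom q (p + 1) (r + 1) = q ^ (p + 1) * qBinom q (p + 1) r + qBinom q p (r + 1) := by
  rw [qBinom]

theorem qBinom_succ_succ' (q : F) (p r : ℕ) :
    qBinom q (p + 1) (r + 1) = qBinom q (p + 1) r + q ^ (r + 1) * qBinom q p (r + 1) := by
  induction hN : p + r using Nat.strong_induction_on generalizing p r with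
  | _ N ih =>
    rw [qBinom_succ_succ]
    rcases p with _ | p <;> rcases r with _ | r
    · simp [qBinom]; ring
    · have h1 := ih (0 + r) (by omega) 0 r rfl
      have d1 := qBinom_succ_succ q 0 r
      simp only [qBinom_zero_left] at h1 d1 ⊢
      linear_combination q * h1 - d1
    · have h2 := ih (p + 0) (by omega) p 0 rfl
      have d2 := qBinom_succ_succ q p 0
      simp only [qBinom_zero_right] at h2 d2 ⊢
      linear_combination h2 - q * d2
    · have h1 := ih (p + 1 + r) (by omega) (p + 1) r rfl
      have h2 := ih (p + (r + 1)) (by omega) p (r + 1) rfl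
      have d1 := qBinom_succ_succ q (p + 1) r
      have d2 := qBinom_succ_succ q p (r + 1)
      linear_combination q ^ (p + 2) * h1 + h2 - d1 - q ^ (r + 2) * d2

theorem qBinom_comm (q : F) (p r : ℕ) : qBinom q p r = qBinom q r p := by
  induction hN : p + r using Nat.strong_induction_on generalizing p r with
  | _ N ih =>
    rcases p with _ | p <;> rcases r with _ | r
    · rfl
    · rw [qBinom_zero_left, qBinom_zero_right]
    · rw [qBinom_zero_left, qBinom_zero_right]
    · rw [qBinom_succ_succ, qBinom_succ_succ', ih _ _ (p + 1) r rfl, ih _ _ p (r + 1) rfl]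
      · ring
      · omega
      · omega

theorem one_sub_mul_qBinom_succ (q : F) (p r : ℕ) :
    (1 - q ^ (r + 1)) * qBinom q p (r + 1) = (1 - q ^ (p + r + 1)) * qBinom q p r := by
  induction p with
  | zero => simp [qBinom_zero_left]
  | succ p ih =>
    have d1 := qBinom_succ_succ q p r
    rcases r with _ | r
    · rw [qBinom_zero_right] at ih d1 ⊢
      linear_combination (1 - q) * d1 + ih
    · have d2 := qBinom_succ_succ q p r
      have d3 := qBinom_succ_succ' q p r
      linear_combination (1 - q ^ (r + 2)) * d1 + ih - d2 + q ^ (p + 1) * d3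

/-- The value of the `q`-binomial coefficients `[n - 1 choose k]` at an `n`-th root of unity. -/
theorem qBinom_of_isPrimitiveRoot {q r : F} (hqr : q * r = 1) {p k : ℕ}
    (hq : IsPrimitiveRoot q (p + k + 1)) :
    qBinom q p k = (-1) ^ k * r ^ (k * (k + 1) / 2) := by
  induction k generalizing p with
  | zero => simp [qBinom_zero_right]
  | succ k ih =>
    have h1 := one_sub_mul_qBinom_succ q p k
    have h2 := one_sub_mul_qBinom_succ q k p
    rw [qBinom_comm q k p, qBinom_comm q k (p + 1), show k + p = p + k from add_comm _ _] at h2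
    have h3 := ih (p := p + 1) (by convert hq using 1; ring)
    have hp : q ^ (p + 1) = r ^ (k + 1) := by
      have h4 := hq.pow_eq_one
      have h5 : q ^ (k + 1) * r ^ (k + 1) = 1 := by rw [← mul_pow, hqr, one_pow]
      have h6 : q ^ (p + 1) * q ^ (k + 1) = 1 := by rw [← pow_add, ← h4]; congr 1; ring
      calc q ^ (p + 1) = q ^ (p + 1) * q ^ (k + 1) * r ^ (k + 1) := by rw [mul_assoc, h5, mul_one]
        _ = _ := by rw [h6, one_mul]
    have hne : 1 - q ^ (k + 1) ≠ 0 := by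
      intro h
      exact hq.pow_ne_one_of_pos_of_lt (Nat.succ_ne_zero k) (by omega) (sub_eq_zero.mp h).symm
    have h5 : q ^ (k + 1) * r ^ (k + 1) = 1 := by rw [← mul_pow, hqr, one_pow]
    have h6 : (k + 1) * (k + 1 + 1) / 2 = (k + 1) + k * (k + 1) / 2 := by
      have : (k + 1) * (k + 1 + 1) = (k + 1) * 2 + k * (k + 1) := by ring
      omega
    apply mul_left_cancel₀ hne
    rw [h1, ← h2, h3, hp, h6, pow_succ (-1 : F), pow_add r (k + 1)]
    linear_combination (-(-1) ^ k * r ^ (k * (k + 1) / 2)) * h5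

/-! ### The Klyachko functional on words -/

/-- The value of the Klyachko functional on a word: up to the sign of the word it is `r` to the
weight of the descents. -/
def wordVal (r : F) (w : List α) : F := (invSign w : F) * r ^ descWeight (· > ·) w

theorem wordVal_map {β : Type*} [LinearOrder β] (r : F) (c : α → β) (l : List α)
    (hc : ∀ x ∈ l, ∀ y ∈ l, (c x < c y ↔ x < y)) : wordVal r (l.map c) = wordVal r l := by
  rw [wordVal, wordVal, invSign_map c l hc, descWeight_map c l hc]

theorem wordVal_ne_zero {r : F} (hr : r ≠ 0) (w : List α) : wordVal r w ≠ 0 := by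
  refine mul_ne_zero (fun h => ?_) (pow_ne_zero _ hr)
  have := congrArg (Int.cast : ℤ → F) (invSign_mul_self w)
  rw [Int.cast_mul, h] at this
  simp at this

theorem pow_eq_pow_of_add {q r : F} (hqr : q * r = 1) {N a b : ℕ} (hq : q ^ N = 1)
    (h : a + b = N) : r ^ a = q ^ b := by
  have h1 : q ^ a * r ^ a = 1 := by rw [← mul_pow, hqr, one_pow]
  have h2 : q ^ a * q ^ b = 1 := by rw [← pow_add, h, hq]
  have : q ^ a ≠ 0 := left_ne_zero_of_mul_eq_one h1
  exact mul_left_cancel₀ this (h1.trans h2.symm)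

theorem pow_descWeight_append {q r : F} (hqr : q * r = 1) {N : ℕ} (hq : q ^ N = 1)
    (u : List α) (z : α) (w : List α)
    (h : u.length + (w.length + 1) = N) :
    r ^ descWeight (· > ·) (u.reverse ++ z :: w) =
      q ^ descWeight (· < ·) (z :: u) * r ^ descWeight (· > ·) (z :: w) := by
  induction u generalizing z w with
  | nil => simp [descWeight]
  | cons x u ih =>
    have h1 := ih x (z :: w) (by simp only [List.length_cons] at h ⊢; omega)
    have h2 : r ^ (w.length + 1) = q ^ (u.length + 1) :=
      pow_eq_pow_of_add hqr hq (by simp only [List.length_cons] at h; omega)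
    rw [List.reverse_cons, List.append_assoc, List.singleton_append, h1, descWeight,
      descWeight.eq_3]
    by_cases hzx : z < x
    · rw [if_pos hzx, if_pos hzx, pow_add r, pow_add q, h2]; ring
    · rw [if_neg hzx, if_neg hzx, zero_add, zero_add]

/-- The generating function of the descents over the shuffles of two words. -/
theorem shSum_wordVal {q r : F} (hqr : q * r = 1) {N : ℕ} (hq : q ^ N = 1)
    (u v : List α) (z : α) (w : List α)
    (h : u.length + v.length + (w.length + 1) = N) (hnd : (u ++ (v ++ z :: w)).Nodup) :
    shSum (wordVal r) u v (z :: w) =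
      (invSign (u.reverse ++ (v.reverse ++ z :: w)) : F) * (qBinom q u.length v.length *
        q ^ (descWeight (· < ·) (z :: u) + descWeight (· < ·) (z :: v)) *
        r ^ descWeight (· > ·) (z :: w)) := by
  induction hM : u.length + v.length using Nat.strong_induction_on generalizing u v z w with
  | _ M ih =>
    rcases u with _ | ⟨x, u⟩
    · rw [shSum, wordVal, pow_descWeight_append hqr hq v z w (by simpa using h)]
      simp [descWeight, qBinom_zero_left]
    rcases v with _ | ⟨y, v⟩
    · rw [shSum_nil_right, wordVal, pow_descWeight_append hqr hq (x :: u) z w (by simpa using h)]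
      simp [descWeight, qBinom_zero_right]
    simp only [List.length_cons] at h hM
    have hnd' := hnd
    simp only [List.cons_append, List.nodup_cons, List.mem_append, List.mem_cons, not_or,
      List.nodup_append] at hnd'
    have hxy : x ≠ y := hnd'.1.2.1
    have h1 := ih (u.length + 1 + v.length) (by omega) (x :: u) v y (z :: w)
      (by simp only [List.length_cons]; omega)
      ((List.perm_middle.symm.append_left (x :: u)).nodup_iff.mp hnd) (by simp)
    have h2 := ih (u.length + (v.length + 1)) (by omega) u (y :: v) x (z :: w)
      (by simp only [List.length_cons]; omega)
      (by
        have p : (x :: u ++ (y :: v ++ z :: w)).Perm (u ++ (y :: v ++ x :: z :: w)) := by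
          refine List.perm_middle.symm.trans (List.Perm.append_left u ?_)
          exact List.perm_middle.symm
        exact p.nodup_iff.mp hnd) (by simp)
    have hs : invSign (u.reverse ++ ((y :: v).reverse ++ x :: z :: w)) =
        (-1) ^ (v.length + 1) * invSign ((x :: u).reverse ++ ((y :: v).reverse ++ z :: w)) := by
      have := invSign_move u.reverse (y :: v).reverse (z :: w) (x := x) (by
        simp only [List.mem_reverse, List.mem_cons, not_or]
        exact ⟨hxy, hnd'.1.2.2.1⟩)
      rw [List.length_reverse, List.length_cons] at this
      rw [List.reverse_cons (a := x), List.append_assoc, List.singleton_append, this, ← mul_assoc,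
        ← pow_add, Even.neg_one_pow ⟨_, rfl⟩, one_mul]
    have hc : r ^ (w.length + 1) = q ^ (u.length + v.length + 2) :=
      pow_eq_pow_of_add hqr hq (by omega)
    have e : ((-1 : F) ^ (v.length + 1)) * (-1) ^ (v.length + 1) = 1 := by
      rw [← pow_add, Even.neg_one_pow ⟨_, rfl⟩]
    rw [shSum, h1, h2, hs, List.reverse_cons (a := y), List.append_assoc, List.singleton_append]
    simp only [List.length_cons, descWeight.eq_3 _ y z, descWeight.eq_3 _ x z,
      descWeight.eq_3 _ y x, descWeight.eq_3 _ x y, descWeight.eq_3 _ z x, descWeight.eq_3 _ z y,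
      zsmul_eq_mul, Int.cast_mul, Int.cast_pow, Int.cast_neg, Int.cast_one, gt_iff_lt]
    have hP := qBinom_succ_succ q u.length v.length
    have hP' := qBinom_succ_succ' q u.length v.length
    generalize (invSign ((x :: u).reverse ++ (v.reverse ++ y :: z :: w)) : F) = s
    generalize qBinom q (u.length + 1) v.length = A at *
    generalize qBinom q u.length (v.length + 1) = B at *
    generalize qBinom q (u.length + 1) (v.length + 1) = C at *
    generalize (-1 : F) ^ (v.length + 1) = t at *
    generalize descWeight (· < ·) (x :: u) = a
    generalize descWeight (· < ·) (y :: v) = b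
    generalize descWeight (· > ·) (z :: w) = d
    have pif : ∀ (c : Prop) [Decidable c] (x : F) (i j : ℕ),
        x ^ ((if c then i else 0) + j) = (if c then x ^ i else 1) * x ^ j := by
      intro c _ x i j
      split_ifs <;> simp [pow_add]
    simp only [pow_add q (_ + a), pow_add q a, pif, hc]
    rcases lt_or_gt_of_ne hxy with h' | h'
    · rw [if_pos h', if_neg h'.not_gt]
      by_cases hx : z < x
      · rw [if_pos hx, if_pos hx, if_pos (hx.trans h'), if_pos (hx.trans h'), hP']
        linear_combination s * q ^ (u.length + v.length + 2) * q ^ (v.length + 1) * B * q ^ a *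
          q ^ b * r ^ d * e
      · rw [if_neg hx, if_neg hx]
        by_cases hy : z < y
        · rw [if_pos hy, if_pos hy, hP]
          linear_combination s * q ^ (v.length + 1) * B * q ^ a * q ^ b * r ^ d * e
        · rw [if_neg hy, if_neg hy, hP']
          linear_combination s * q ^ (v.length + 1) * B * q ^ a * q ^ b * r ^ d * e
    · rw [if_pos h', if_neg h'.not_gt]
      by_cases hy : z < y
      · rw [if_pos hy, if_pos hy, if_pos (hy.trans h'), if_pos (hy.trans h'), hP]
        linear_combination s * q ^ (u.length + v.length + 2) * B * q ^ a *
          q ^ b * r ^ d * e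
      · rw [if_neg hy, if_neg hy]
        by_cases hx : z < x
        · rw [if_pos hx, if_pos hx, hP']
          linear_combination s * q ^ (u.length + v.length + 2) * B * q ^ a * q ^ b * r ^ d * e
        · rw [if_neg hx, if_neg hx, hP]
          linear_combination s * B * q ^ a * q ^ b * r ^ d * e

end Words
end Kriz

namespace Kriz

section Words

variable {α : Type*} [LinearOrder α] {F : Type*} [Field F]

theorem descWeight_lt_cons_of_forall_lt (z : α) (u : List α) (h : ∀ x ∈ u, x < z) :
    descWeight (· < ·) (z :: u) = descWeight (· < ·) u := by
  cases u with
  | nil => simp [descWeight]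
  | cons x u => rw [descWeight, if_neg (h x (by simp)).not_gt, zero_add]

/-- The Klyachko functional respects the relation which moves the largest letter of a word to
the end. -/
theorem wordVal_middle {q r : F} (hqr : q * r = 1) (u v : List α) (z : α)
    (hq : IsPrimitiveRoot q (u.length + v.length + 1))
    (hnd : (u ++ z :: v).Nodup) (hz : ∀ x ∈ u ++ v, x < z) :
    wordVal r (u ++ z :: v) =
      (-1) ^ (v.length * (v.length - 1) / 2) * shSum (wordVal r) u.reverse v [z] := by
  have hnd' := hnd
  rw [List.nodup_middle, List.nodup_cons] at hnd'
  have hv : v.Nodup := (List.nodup_append.mp hnd'.2).2.1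
  have hN := hq.pow_eq_one
  have e : ∀ k : ℕ, ((-1 : F) ^ k) * (-1) ^ k = 1 := fun k => by
    rw [← pow_add, Even.neg_one_pow ⟨_, rfl⟩]
  rw [shSum_wordVal hqr hN u.reverse v z [] (by simp) (by
    refine List.Perm.nodup ?_ hnd
    refine (List.Perm.append (List.reverse_perm u).symm ?_)
    exact (List.perm_append_singleton z v).symm)]
  have hs := invSign_reverse_middle u v [z] hv
  have hs2 := invSign_move u v [] (x := z) (fun h => hnd'.1 (by simp [h]))
  rw [List.append_nil] at hs2
  have hD := pow_descWeight_append hqr hN u.reverse z v (by simp; ring)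
  rw [List.reverse_reverse] at hD
  have hlt : ∀ x ∈ u.reverse, x < z := fun x hx => hz x (by simp_all)
  have hlt' : ∀ x ∈ v, x < z := fun x hx => hz x (by simp_all)
  rw [descWeight_lt_cons_of_forall_lt z _ hlt] at hD ⊢
  rw [descWeight_lt_cons_of_forall_lt z _ hlt', List.reverse_reverse, hs, wordVal, hs2, hD,
    List.length_reverse, qBinom_of_isPrimitiveRoot hqr hq]
  have hzv : r ^ descWeight (· > ·) (z :: v) = r ^ v.length * r ^ descWeight (· > ·) v := by
    cases v with
    | nil => simp [descWeight]
    | cons y v => rw [descWeight, if_pos (hlt' y (by simp)), pow_add, List.length_cons]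
  have h1 : q ^ descWeight (· < ·) v =
      q ^ (v.length * (v.length - 1) / 2) * r ^ descWeight (· > ·) v := by
    rw [← descWeight_lt_add_gt v hv, pow_add, mul_assoc, ← mul_pow, hqr, one_pow, mul_one]
  have h2 : v.length * (v.length + 1) / 2 = v.length * (v.length - 1) / 2 + v.length := by
    have := Finset.sum_range_id (v.length + 1)
    rw [Nat.add_sub_cancel, mul_comm] at this
    rw [← this, Finset.sum_range_succ, Finset.sum_range_id]
  have h3 : r ^ (v.length * (v.length - 1) / 2) * q ^ (v.length * (v.length - 1) / 2) = 1 := by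
    rw [← mul_pow, mul_comm r, hqr, one_pow]
  rw [hzv, pow_add q, h1, h2, pow_add r]
  simp only [descWeight, pow_zero, mul_one]
  push_cast
  linear_combination (-(invSign (u ++ (v ++ [z])) : F) * (-1) ^ v.length * r ^ v.length *
    q ^ descWeight (· < ·) u.reverse * r ^ descWeight (· > ·) v) * h3 -
    ((invSign (u ++ (v ++ [z])) : F) * (-1) ^ v.length * r ^ v.length *
    q ^ descWeight (· < ·) u.reverse * r ^ descWeight (· > ·) v *
    r ^ (v.length * (v.length - 1) / 2) * q ^ (v.length * (v.length - 1) / 2)) *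
      e (v.length * (v.length - 1) / 2)

theorem countP_lt_eq_length (z : α) (u : List α) (h : ∀ x ∈ u, x < z) :
    u.countP (· < z) = u.length := by
  rw [List.countP_eq_length]
  simpa using h

theorem countP_lt_eq_zero (z : α) (u : List α) (h : ∀ x ∈ u, z < x) :
    u.countP (· < z) = 0 := by
  rw [List.countP_eq_zero]
  intro x hx
  simpa using (h x hx).le

/-- The Klyachko functional is an eigenvector of the cyclic shift of the letters. -/
theorem wordVal_cyclic_shift {q r : F} (hqr : q * r = 1) (u v : List α) (z : α)
    (hr : r ^ (u.length + v.length + 1) = 1)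
    (hnd : (u ++ z :: v).Nodup) (hz : ∀ x ∈ u ++ v, x < z) (c : α → α)
    (hc : ∀ x ∈ u ++ v, ∀ y ∈ u ++ v, (c x < c y ↔ x < y)) (hcz : ∀ x ∈ u ++ v, c z < c x) :
    wordVal r ((u ++ z :: v).map c) =
      (-1) ^ (u.length + v.length) * r * wordVal r (u ++ z :: v) := by
  have hq : q ^ (u.length + v.length + 1) = 1 := by
    have : (q * r) ^ (u.length + v.length + 1) = 1 := by rw [hqr, one_pow]
    rwa [mul_pow, hr, mul_one] at this
  have hnd' := hnd
  rw [List.nodup_middle, List.nodup_cons, List.mem_append, not_or] at hnd'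
  have hczu : c z ∉ u.map c := by
    intro h
    obtain ⟨x, hx, hx'⟩ := List.mem_map.mp h
    exact (hcz x (by simp [hx])).ne' hx'
  have s1 := invSign_move [] u v hnd'.1.1
  have s2 := invSign_move [] (u.map c) (v.map c) hczu
  simp only [List.nil_append, List.length_map] at s1 s2
  rw [← List.map_append, invSign, countP_lt_eq_zero, pow_zero, one_mul,
    invSign_map c _ hc] at s2
  · rw [invSign, countP_lt_eq_length z _ hz, List.length_append] at s1
    have D1 := pow_descWeight_append hqr hq u.reverse z v (by simp; ring)
    have D2 := pow_descWeight_append hqr hq (u.map c).reverse (c z) (v.map c) (by simp; ring)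
    rw [List.reverse_reverse] at D1 D2
    rw [descWeight_lt_cons_of_forall_lt z _ fun x hx => hz x (by simp_all)] at D1
    have D3 : q ^ descWeight (· < ·) (c z :: (u.map c).reverse) =
        q ^ u.length * q ^ descWeight (· < ·) u.reverse := by
      have : descWeight (· < ·) (u.map c).reverse = descWeight (· < ·) u.reverse := by
        have h1 : ∀ (l : List α), (∀ x ∈ l, ∀ y ∈ l, (c x < c y ↔ x < y)) →
            descWeight (· < ·) (l.map c) = descWeight (· < ·) l := by
          intro l hl
          induction l with
          | nil => rfl
          | cons x l ih =>
            have ih' := ih fun a ha b hb => hl a (by simp [ha]) b (by simp [hb])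
            cases l with
            | nil => rfl
            | cons y l =>
              simp only [List.map_cons] at ih' ⊢
              rw [descWeight, descWeight, ih', List.length_map]
              simp only [hl x (by simp) y (by simp)]
        rw [← List.map_reverse]
        exact h1 _ fun x hx y hy => hc x (by simp_all) y (by simp_all)
      rw [← this]
      rcases h : (u.map c).reverse with _ | ⟨x, l⟩
      · have : u = [] := by simpa using h
        simp [this, descWeight]
      · have hx : x ∈ u.map c := by rw [← List.mem_reverse, h]; simp
        obtain ⟨y, hy, rfl⟩ := List.mem_map.mp hx
        have hl : l.length + 1 = u.length := by
          have := congrArg List.length h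
          simpa using this.symm
        rw [descWeight, if_pos (hcz y (by simp [hy])), pow_add, hl]
    have D4 : r ^ descWeight (· > ·) (z :: v) = r ^ v.length * r ^ descWeight (· > ·) v := by
      cases v with
      | nil => simp [descWeight]
      | cons y v => rw [descWeight, if_pos (hz y (by simp)), pow_add, List.length_cons]
    have D5 : r ^ descWeight (· > ·) (c z :: v.map c) = r ^ descWeight (· > ·) v := by
      rw [← descWeight_map c v fun x hx y hy => hc x (by simp_all) y (by simp_all)]
      cases v with
      | nil => simp [descWeight]
      | cons y v =>
        simp only [List.map_cons]
        rw [descWeight, if_neg (hcz y (by simp)).not_gt, zero_add]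
    have e : q ^ u.length = r * r ^ v.length := by
      rw [← pow_succ']
      exact (pow_eq_pow_of_add hqr hq (by ring)).symm
    rw [wordVal, wordVal, List.map_append, List.map_cons, D2, D1, D3, D4, D5, e]
    have s3 : (invSign (u.map c ++ c z :: v.map c) : F) =
        (-1) ^ (u.length + v.length) * invSign (u ++ z :: v) := by
      have e1 : ((-1 : ℤ) ^ u.length) * (-1) ^ u.length = 1 := by
        rw [← pow_add, Even.neg_one_pow ⟨_, rfl⟩]
      have e2 : ((-1 : ℤ) ^ v.length) * (-1) ^ v.length = 1 := by
        rw [← pow_add, Even.neg_one_pow ⟨_, rfl⟩]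
      have : invSign (u.map c ++ c z :: v.map c) =
          (-1) ^ (u.length + v.length) * invSign (u ++ z :: v) := by
        rw [pow_add] at s1 ⊢
        linear_combination (-(-1) ^ u.length) * s2 - invSign (u.map c ++ c z :: v.map c) * e1 +
          (-1) ^ v.length * s1 * 1 -
          ((-1) ^ u.length * invSign (u ++ v)) * e2 
      rw [this]
      push_cast
      rfl
    rw [s3]
    ring
  · intro x hx
    obtain ⟨y, hy, rfl⟩ := List.mem_map.mp hx
    exact hcz y hy

theorem descCount_append_pair (l : List α) (x y : α) :
    descCount (l ++ [x, y]) = descCount (l ++ [x]) + if y < x then 1 else 0 := by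
  induction l with
  | nil => simp [descCount]
  | cons a l ih =>
    cases l with
    | nil => simp [descCount]
    | cons b l =>
      simp only [List.cons_append] at ih ⊢
      rw [descCount, ih, descCount, add_assoc]

theorem descWeight_append_singleton (l : List α) (x : α) :
    descWeight (· > ·) (l ++ [x]) = descWeight (· > ·) l + descCount (l ++ [x]) := by
  induction l with
  | nil => simp [descWeight, descCount]
  | cons a l ih =>
    cases l with
    | nil => simp [descWeight, descCount]
    | cons b l =>
      simp only [List.cons_append] at ih ⊢
      rw [descWeight, ih, descCount, descWeight]
      by_cases h : b < a
      · simp only [gt_iff_lt, if_pos h, List.length_append, List.length_singleton]; ring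
      · simp only [gt_iff_lt, if_neg h]; ring

/-- The number of cyclic descents of a word. -/
def cyclicDescCount : List α → ℕ
  | [] => 0
  | x :: l => descCount (x :: l ++ [x])

theorem cyclicDescCount_rotate_one (l : List α) :
    cyclicDescCount (l.rotate 1) = cyclicDescCount l := by
  rcases l with _ | ⟨x, _ | ⟨y, l⟩⟩
  · rfl
  · simp
  · simp only [List.rotate_cons_succ, List.rotate_zero, List.cons_append, cyclicDescCount]
    have := descCount_append_pair (y :: l) x y
    simp only [List.cons_append, List.append_assoc, List.nil_append] at this ⊢
    rw [this, descCount, add_comm]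

theorem cyclicDescCount_rotate (l : List α) (j : ℕ) :
    cyclicDescCount (l.rotate j) = cyclicDescCount l := by
  induction j with
  | zero => simp
  | succ j ih => rw [← List.rotate_rotate, cyclicDescCount_rotate_one, ih]

theorem wordVal_rotate_one {r : F} (w : List α) (hnd : w.Nodup) (hr : r ^ w.length = 1) :
    wordVal r (w.rotate 1) = (-1) ^ (w.length - 1) * r ^ cyclicDescCount w * wordVal r w := by
  rcases w with _ | ⟨x, l⟩
  · simp [wordVal, invSign, cyclicDescCount]
  · have hx : x ∉ l := (List.nodup_cons.mp hnd).1
    have s := invSign_move [] l [] hx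
    simp only [List.nil_append, List.append_nil] at s
    have e1 : ((-1 : ℤ) ^ l.length) * (-1) ^ l.length = 1 := by
      rw [← pow_add, Even.neg_one_pow ⟨_, rfl⟩]
    have s' : invSign (l ++ [x]) = (-1) ^ l.length * invSign (x :: l) := by
      rw [s, ← mul_assoc, e1, one_mul]
    have hD : r ^ descWeight (· > ·) (l ++ [x]) =
        r ^ cyclicDescCount (x :: l) * r ^ descWeight (· > ·) (x :: l) := by
      rw [descWeight_append_singleton, cyclicDescCount]
      cases l with
      | nil => simp [descWeight, descCount]
      | cons y l =>
        rw [descWeight.eq_3 _ x y]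
        simp only [List.cons_append, descCount]
        by_cases h : y < x
        · simp only [gt_iff_lt, if_pos h, pow_add]
          simp only [List.length_cons, pow_add] at hr
          linear_combination (-r ^ descWeight (· > ·) (y :: l) *
            r ^ descCount (y :: (l ++ [x]))) * hr
        · simp only [gt_iff_lt, if_neg h, pow_add]; ring
    simp only [List.rotate_cons_succ, List.rotate_zero, wordVal, s', hD, List.length_cons,
      Nat.add_sub_cancel]
    push_cast
    ring

theorem wordVal_rotate {r : F} (w : List α) (hnd : w.Nodup) (hr : r ^ w.length = 1) (j : ℕ) :
    wordVal r (w.rotate j) = ((-1) ^ (w.length - 1) * r ^ cyclicDescCount w) ^ j * wordVal r w := by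
  induction j with
  | zero => simp
  | succ j ih =>
    rw [← List.rotate_rotate, wordVal_rotate_one _ (by simpa using hnd) (by simpa using hr), ih,
      cyclicDescCount_rotate, List.length_rotate, pow_succ]
    ring

theorem descCount_lt_length (l : List α) (hl : l ≠ []) : descCount l < l.length := by
  induction l with
  | nil => exact absurd rfl hl
  | cons x l ih =>
    cases l with
    | nil => simp [descCount]
    | cons y l =>
      have := ih (by simp)
      rw [descCount, List.length_cons]
      split_ifs <;> omega

theorem sortedLT_of_descCount_eq_zero (l : List α) (hnd : l.Nodup) (h : descCount l = 0) :
    l.Pairwise (· < ·) := by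
  rw [← List.isChain_iff_pairwise]
  induction l with
  | nil => exact List.IsChain.nil
  | cons x l ih =>
    cases l with
    | nil => exact List.IsChain.singleton _
    | cons y l =>
      rw [descCount, Nat.add_eq_zero_iff] at h
      refine List.IsChain.cons_cons ?_ (ih (List.nodup_cons.mp hnd).2 h.2)
      have hxy : x ≠ y := by rintro rfl; simp at hnd
      by_contra h'
      simp [lt_of_le_of_ne (not_lt.mp h') hxy.symm] at h

theorem cyclicDescCount_cons (x y : α) (l : List α) (hx : ∀ z ∈ y :: l, x < z) :
    cyclicDescCount (x :: y :: l) = descCount (y :: l) + 1 := by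
  rw [cyclicDescCount, List.cons_append, List.cons_append, descCount,
    if_neg (hx y (by simp)).not_gt, zero_add]
  induction l generalizing y with
  | nil => simp [descCount, hx y (by simp)]
  | cons z l ih =>
    rw [List.cons_append, descCount, ih z (fun a ha => hx a (by simp_all)), descCount, add_assoc]

/-- The weighted sum of the Klyachko functional over the rotations of a word vanishes unless the
word is a rotation of the increasing one. -/
theorem exists_rotate_sorted_of_sum_ne_zero {q r : F} (hqr : q * r = 1) (w : List α) (hnd : w.Nodup)
    (hr : IsPrimitiveRoot r w.length)
    (h : ∑ j ∈ Finset.range w.length,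
      ((-1) ^ (w.length - 1) * q) ^ j * wordVal r (w.rotate j) ≠ 0) :
    ∃ i, (w.rotate i).Pairwise (· < ·) := by
  have e : ((-1 : F) ^ (w.length - 1)) * (-1) ^ (w.length - 1) = 1 := by
    rw [← pow_add, Even.neg_one_pow ⟨_, rfl⟩]
  have h1 : ∑ j ∈ Finset.range w.length, ((-1) ^ (w.length - 1) * q) ^ j * wordVal r (w.rotate j) =
      (∑ j ∈ Finset.range w.length, (q * r ^ cyclicDescCount w) ^ j) * wordVal r w := by
    rw [Finset.sum_mul]
    refine Finset.sum_congr rfl fun j _ => ?_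
    rw [wordVal_rotate w hnd hr.pow_eq_one, ← mul_assoc, ← mul_pow]
    congr 2
    linear_combination q * r ^ cyclicDescCount w * e
  rw [h1] at h
  have hS := left_ne_zero_of_mul h
  by_cases hw : w = []
  · subst hw; simp at hS
  obtain ⟨x, hx, hmin⟩ : ∃ x ∈ w, ∀ y ∈ w, x ≤ y := by
    have := w.toFinset.min'_mem (by simpa [List.toFinset_nonempty_iff] using hw)
    refine ⟨_, List.mem_toFinset.mp this, fun y hy => ?_⟩
    exact Finset.min'_le _ _ (List.mem_toFinset.mpr hy)
  obtain ⟨A, B, rfl⟩ := List.append_of_mem hx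
  have hrot : (A ++ x :: B).rotate A.length = x :: B ++ A := List.rotate_append_length_eq _ _
  have hlen : (x :: B ++ A).length = (A ++ x :: B).length := by simp; ring
  have hndr : (x :: (B ++ A)).Nodup := by
    rw [← List.cons_append, ← hrot]; exact List.nodup_rotate.mpr hnd
  have hlt : ∀ z ∈ B ++ A, x < z := by
    intro z hz
    refine lt_of_le_of_ne (hmin z ?_) ?_
    · simp only [List.mem_append, List.mem_cons] at hz ⊢; tauto
    · rintro rfl
      exact (List.nodup_cons.mp hndr).1 hz
  refine ⟨A.length, ?_⟩
  rw [hrot, List.cons_append]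
  refine List.pairwise_cons.mpr ⟨hlt, ?_⟩
  rw [← cyclicDescCount_rotate _ A.length, hrot, ← hlen, List.cons_append] at hS
  rw [← hlen, List.cons_append] at hr
  rcases hBA : B ++ A with _ | ⟨y, l⟩
  · exact List.Pairwise.nil
  rw [hBA] at hS hr hlt hndr
  apply sortedLT_of_descCount_eq_zero _ (List.nodup_cons.mp hndr).2
  rw [cyclicDescCount_cons x y l hlt] at hS
  by_contra hd
  have hlt2 := descCount_lt_length (y :: l) (by simp)
  have hq1 : q * r ^ (descCount (y :: l) + 1) = r ^ descCount (y :: l) := by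
    rw [pow_succ]; linear_combination r ^ descCount (y :: l) * hqr
  rw [hq1] at hS
  have hne := hr.pow_ne_one_of_pos_of_lt hd (by simp only [List.length_cons] at hlt2 ⊢; omega)
  apply hS
  have hg := mul_geom_sum (r ^ descCount (y :: l)) (x :: y :: l).length
  rw [← pow_mul, mul_comm (descCount _), pow_mul, hr.pow_eq_one, one_pow, sub_self] at hg
  exact (mul_eq_zero.mp hg).resolve_left (sub_ne_zero.mpr hne)

/-- The weighted sum of the Klyachko functional over the rotations of the increasing word. -/
theorem sum_rotate_ne_zero_of_sorted [CharZero F] {q r : F} (hqr : q * r = 1) (w : List α)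
    (hw : w ≠ [])
    (hs : w.Pairwise (· < ·)) (hr : IsPrimitiveRoot r w.length) :
    ∑ j ∈ Finset.range w.length, ((-1) ^ (w.length - 1) * q) ^ j * wordVal r (w.rotate j) ≠ 0 := by
  have e : ((-1 : F) ^ (w.length - 1)) * (-1) ^ (w.length - 1) = 1 := by
    rw [← pow_add, Even.neg_one_pow ⟨_, rfl⟩]
  have hnd : w.Nodup := hs.imp fun h => h.ne
  have hcd : q * r ^ cyclicDescCount w = 1 ∨ w.length = 1 := by
    rcases w with _ | ⟨x, _ | ⟨y, l⟩⟩
    · exact absurd rfl hw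
    · right; rfl
    · left
      rw [cyclicDescCount_cons x y l (List.pairwise_cons.mp hs).1]
      have : descCount (y :: l) = 0 := by
        have hs' := (List.pairwise_cons.mp hs).2
        clear hs hnd hr hw e
        induction l generalizing y with
        | nil => rfl
        | cons z l ih =>
          rw [descCount, ih z (List.pairwise_cons.mp hs').2,
            if_neg ((List.pairwise_cons.mp hs').1 z (by simp)).not_gt]
      rw [this, zero_add, pow_one, hqr]
  have hterm : ∀ j ∈ Finset.range w.length,
      ((-1) ^ (w.length - 1) * q) ^ j * wordVal r (w.rotate j) = wordVal r w := by
    intro j hj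
    rw [wordVal_rotate w hnd hr.pow_eq_one, ← mul_assoc, ← mul_pow]
    rcases hcd with h | h
    · have : (-1) ^ (w.length - 1) * q * ((-1) ^ (w.length - 1) * r ^ cyclicDescCount w) = 1 := by
        linear_combination e + (-1) ^ (w.length - 1) * (-1) ^ (w.length - 1) * h
      rw [this, one_pow, one_mul]
    · rw [h] at hj
      simp only [Finset.range_one, Finset.mem_singleton] at hj
      simp [hj]
  rw [Finset.sum_congr rfl hterm, Finset.sum_const, Finset.card_range, nsmul_eq_mul]
  refine mul_ne_zero ?_ (wordVal_ne_zero (right_ne_zero_of_mul_eq_one hqr) w)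
  exact_mod_cast (List.length_pos_iff.mpr hw).ne'

end Words
end Kriz

namespace Kriz

/-! ### Path monomials and the shuffle relations -/

section Paths

variable {K : Type*} [Field K] {H : Type*} [Ring H] [Algebra K H] (𝒜 : ℕ → Submodule K H) {n : ℕ}

/-- The monomial `G_{i_1 i_2} G_{i_2 i_3} ⋯ G_{i_{r-1} i_r}` of a word `i_1 i_2 ⋯ i_r`. -/
def path : List (Fin n) → Model 𝒜 n
  | [] => 1
  | [_] => 1
  | i :: j :: l => G 𝒜 i j * path (j :: l)

@[simp] theorem path_nil : path 𝒜 ([] : List (Fin n)) = 1 := rfl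

@[simp] theorem path_singleton (i : Fin n) : path 𝒜 [i] = 1 := rfl

theorem path_cons_cons (i j : Fin n) (l : List (Fin n)) :
    path 𝒜 (i :: j :: l) = G 𝒜 i j * path 𝒜 (j :: l) := rfl

theorem path_append (u : List (Fin n)) (z : Fin n) (v : List (Fin n)) :
    path 𝒜 (u ++ z :: v) = path 𝒜 (u ++ [z]) * path 𝒜 (z :: v) := by
  induction u with
  | nil => simp
  | cons x u ih =>
    cases u with
    | nil => simp [path_cons_cons]
    | cons y u =>
      simp only [List.cons_append, path_cons_cons] at ih ⊢
      rw [ih, mul_assoc]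

theorem path_append_pair (u : List (Fin n)) (x z : Fin n) :
    path 𝒜 (u ++ [x, z]) = path 𝒜 (u ++ [x]) * G 𝒜 x z := by
  rw [path_append, path_cons_cons, path_singleton, mul_one]

theorem G_mul_G_comm (i j k l : Fin n) :
    G 𝒜 i j * G 𝒜 k l = (-1 : ℤ) • (G 𝒜 k l * G 𝒜 i j) := by
  rw [neg_one_zsmul, G_anticomm]

theorem G_mul_path (i j : Fin n) (w : List (Fin n)) :
    G 𝒜 i j * path 𝒜 w = (-1 : ℤ) ^ (w.length - 1) • (path 𝒜 w * G 𝒜 i j) := by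
  induction w with
  | nil => simp
  | cons x w ih =>
    cases w with
    | nil => simp
    | cons y w =>
      rw [path_cons_cons, ← mul_assoc, G_mul_G_comm, smul_mul_assoc, mul_assoc, ih, mul_smul_comm,
        mul_assoc, smul_smul]
      simp [pow_succ']

theorem path_reverse (w : List (Fin n)) :
    path 𝒜 w.reverse = (-1 : ℤ) ^ ((w.length - 1) * (w.length - 1 - 1) / 2) • path 𝒜 w := by
  induction w with
  | nil => simp
  | cons x w ih =>
    cases w with
    | nil => simp
    | cons y w =>
      have h : (w.length + 1) * w.length / 2 = w.length + w.length * (w.length - 1) / 2 := by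
        have h1 := Finset.sum_range_id (w.length + 1)
        rw [Nat.add_sub_cancel] at h1
        rw [← h1, Finset.sum_range_succ, Finset.sum_range_id, add_comm]
      have e : ((-1 : ℤ) ^ w.length) * (-1) ^ w.length = 1 := by
        rw [← pow_add, Even.neg_one_pow ⟨_, rfl⟩]
      rw [List.reverse_cons, List.reverse_cons, List.append_assoc, List.singleton_append,
        path_append_pair, ← List.reverse_cons, ih, path_cons_cons, G_mul_path, G_symm]
      simp only [List.length_cons, Nat.add_sub_cancel, smul_mul_assoc, smul_smul]
      rw [h, pow_add]
      congr 1
      linear_combination (-(-1 : ℤ) ^ (w.length * (w.length - 1) / 2)) * e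

theorem G_mul_G_arnold {x y z : Fin n} (hxy : x ≠ y) (hyz : y ≠ z) (hxz : x ≠ z) :
    G 𝒜 x z * G 𝒜 y z = G 𝒜 x y * G 𝒜 y z - G 𝒜 x y * G 𝒜 x z := by
  have h := arnold_symm 𝒜 hxy hyz hxz
  rw [G_symm 𝒜 x z, G_anticomm 𝒜 y z x z, G_anticomm 𝒜 x z x y] at h
  rw [← sub_eq_zero, ← neg_eq_zero, ← h]
  abel

/-- Two paths which end at the beginning of a third one are the signed sum of the paths that
shuffle them. -/
theorem path_mul_path_mul_path (u v : List (Fin n)) (z : Fin n) (w : List (Fin n))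
    (hnd : (u ++ (v ++ z :: w)).Nodup) :
    path 𝒜 (u.reverse ++ [z]) * path 𝒜 (v.reverse ++ [z]) * path 𝒜 (z :: w) =
      shSum (path 𝒜) u v (z :: w) := by
  induction hM : u.length + v.length using Nat.strong_induction_on generalizing u v z w with
  | _ M ih =>
    rcases u with _ | ⟨x, u⟩
    · simp [shSum, path_append 𝒜 v.reverse z w]
    rcases v with _ | ⟨y, v⟩
    · rw [shSum_nil_right, path_append 𝒜 _ z w]
      simp
    have hnd' := hnd
    simp only [List.cons_append, List.nodup_cons, List.mem_append, List.mem_cons, not_or,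
      List.nodup_append] at hnd'
    have hxy : x ≠ y := hnd'.1.2.1
    have hxz : x ≠ z := hnd'.1.2.2.2.1
    have hyz : y ≠ z := by
      rintro rfl
      simp at hnd'
    simp only [List.length_cons] at hM
    have h1 := ih (u.length + 1 + v.length) (by omega) (x :: u) v y (z :: w)
      ((List.perm_middle.symm.append_left (x :: u)).nodup_iff.mp hnd) (by simp)
    have h2 := ih (u.length + (v.length + 1)) (by omega) u (y :: v) x (z :: w)
      (by
        have p : (x :: u ++ (y :: v ++ z :: w)).Perm (u ++ (y :: v ++ x :: z :: w)) := by
          refine List.perm_middle.symm.trans (List.Perm.append_left u ?_)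
          exact List.perm_middle.symm
        exact p.nodup_iff.mp hnd) (by simp)
    rw [shSum, ← h1, ← h2]
    simp only [List.reverse_cons, List.append_assoc, List.singleton_append, path_append_pair,
      path_cons_cons]
    have c1 := G_mul_path 𝒜 x z (v.reverse ++ [y])
    have c2 := G_mul_path 𝒜 x y (v.reverse ++ [y])
    simp only [List.length_append, List.length_reverse, List.length_singleton,
      Nat.add_sub_cancel] at c1 c2
    have ha := G_mul_G_arnold 𝒜 hxy hyz hxz
    have ha' : G 𝒜 x z * G 𝒜 y z = G 𝒜 x y * G 𝒜 y z + (-1 : ℤ) • (G 𝒜 x y * G 𝒜 x z) := by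
      rw [ha, neg_one_zsmul]
      exact sub_eq_add_neg (_ : Model 𝒜 n) _
    rw [G_symm 𝒜 x y]
    generalize path 𝒜 (u.reverse ++ [x]) = Pu at *
    generalize path 𝒜 (v.reverse ++ [y]) = Pv at *
    generalize path 𝒜 (z :: w) = Pw at *
    calc Pu * G 𝒜 x z * (Pv * G 𝒜 y z) * Pw = Pu * (G 𝒜 x z * Pv) * G 𝒜 y z * Pw := by
          simp only [mul_assoc]
      _ = (-1 : ℤ) ^ v.length • (Pu * Pv * (G 𝒜 x z * G 𝒜 y z) * Pw) := by
          rw [c1]; simp only [smul_mul_assoc, mul_smul_comm, mul_assoc]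
      _ = Pu * ((-1 : ℤ) ^ v.length • (Pv * G 𝒜 x y)) * G 𝒜 y z * Pw +
          (-1 : ℤ) ^ (v.length + 1) • (Pu * (Pv * G 𝒜 x y) * (G 𝒜 x z * Pw)) := by
          rw [ha', pow_succ, mul_smul]
          simp only [smul_mul_assoc, mul_smul_comm, mul_assoc, mul_add, add_mul]
          exact smul_add _ _ _
      _ = _ := by rw [← c2]; simp only [mul_assoc]

/-- The relation which moves a letter of a word to the end. -/
theorem path_middle (u v : List (Fin n)) (z : Fin n) (hnd : (u ++ z :: v).Nodup) :
    path 𝒜 (u ++ z :: v) =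
      (-1 : ℤ) ^ (v.length * (v.length - 1) / 2) • shSum (path 𝒜) u.reverse v [z] := by
  have h := path_mul_path_mul_path 𝒜 u.reverse v z [] (by
    refine List.Perm.nodup ?_ hnd
    exact (List.reverse_perm u).symm.append (List.perm_append_singleton z v).symm)
  have h2 := path_reverse 𝒜 (z :: v)
  rw [List.reverse_cons, List.length_cons, Nat.add_sub_cancel] at h2
  rw [← h, List.reverse_reverse, h2, path_append]
  simp only [path_singleton, mul_one, mul_smul_comm, smul_smul]
  rw [← mul_pow]
  simp

theorem G_mul_path_eq_zero {i j : Fin n} (w : List (Fin n)) (hi : i ∈ w) (hj : j ∈ w) :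
    G 𝒜 i j * path 𝒜 w = 0 := by
  induction w generalizing i j with
  | nil => simp at hi
  | cons a w ih =>
    cases w with
    | nil =>
      simp only [List.mem_singleton] at hi hj
      rw [hi, hj, G_diag, zero_mul]
    | cons b l =>
      have key : ∀ j ∈ b :: l, G 𝒜 a j * (G 𝒜 a b * path 𝒜 (b :: l)) = 0 := by
        intro j hj
        by_cases hab : a = b
        · rw [hab, G_diag, zero_mul, mul_zero]
        by_cases hjb : j = b
        · rw [hjb, ← mul_assoc, G_sq, zero_mul]
        by_cases hja : j = a
        · rw [hja, G_diag, zero_mul]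
        have h1 := ih (i := j) (j := b) hj (by simp)
        have h := G_mul_G_arnold 𝒜 (x := j) (y := b) (z := a) hjb (Ne.symm hab) hja
        rw [G_symm 𝒜 a b, G_symm 𝒜 a j] at h
        rw [← mul_assoc, h, sub_mul, G_mul_G_comm 𝒜 j b, G_mul_G_comm 𝒜 j b, smul_mul_assoc,
          smul_mul_assoc, mul_assoc, mul_assoc, h1]
        simp
      rw [path_cons_cons]
      rcases List.mem_cons.mp hi with rfl | hi' <;> rcases List.mem_cons.mp hj with rfl | hj'
      · rw [G_diag, zero_mul]
      · exact key j hj'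
      · rw [G_symm]; exact key i hi'
      · rw [← mul_assoc, G_mul_G_comm, smul_mul_assoc, mul_assoc, ih hi' hj', mul_zero]
        exact smul_zero _

theorem path_mem_span_getLast {w : List (Fin n)} (hw : w.Nodup) {i : Fin n} (hi : i ∈ w) :
    path 𝒜 w ∈ Submodule.span K {x | ∃ s, (s ++ [i]).Perm w ∧ x = path 𝒜 (s ++ [i])} := by
  obtain ⟨u, v, rfl⟩ := List.append_of_mem hi
  rw [path_middle 𝒜 u v i hw]
  refine zsmul_mem (shSum_mem _ _ _ _ _ fun s hs => ?_) _
  refine Submodule.subset_span ⟨s, ?_, rfl⟩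
  refine ((hs.trans (List.Perm.append_right v (List.reverse_perm u))).append_right [i]).trans ?_
  rw [List.append_assoc]
  exact (List.perm_append_singleton i v).append_left u

theorem path_mem_span_head {w : List (Fin n)} (hw : w.Nodup) {i : Fin n} (hi : i ∈ w) :
    path 𝒜 w ∈ Submodule.span K {x | ∃ s, (i :: s).Perm w ∧ x = path 𝒜 (i :: s)} := by
  have h : Submodule.span K {x | ∃ s, (s ++ [i]).Perm w ∧ x = path 𝒜 (s ++ [i])} ≤
      Submodule.span K {x | ∃ s, (i :: s).Perm w ∧ x = path 𝒜 (i :: s)} := by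
    rw [Submodule.span_le]
    rintro _ ⟨s, hs, rfl⟩
    have := path_reverse 𝒜 (i :: s.reverse)
    rw [List.reverse_cons, List.reverse_reverse] at this
    rw [this]
    refine zsmul_mem ?_ _
    refine Submodule.subset_span ⟨s.reverse, ?_, rfl⟩
    exact ((List.reverse_perm s).cons i).trans ((List.perm_append_singleton i s).symm.trans hs)
  exact h (path_mem_span_getLast 𝒜 hw hi)

end Paths
end Kriz

namespace Kriz

/-! ### Equality up to sign -/

section SignEq

variable {R : Type*} [Ring R]

/-- Equality up to sign. -/
def SignEq (a b : R) : Prop := ∃ s : ℤˣ, a = (s : ℤ) • b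

theorem SignEq.refl (a : R) : SignEq a a := ⟨1, by simp⟩

theorem SignEq.symm {a b : R} (h : SignEq a b) : SignEq b a := by
  obtain ⟨s, rfl⟩ := h
  refine ⟨s, ?_⟩
  rw [smul_smul, ← Units.val_mul, Int.units_mul_self, Units.val_one, one_smul]

theorem SignEq.trans {a b c : R} (h : SignEq a b) (h' : SignEq b c) : SignEq a c := by
  obtain ⟨s, rfl⟩ := h
  obtain ⟨t, rfl⟩ := h'
  exact ⟨s * t, by rw [smul_smul, Units.val_mul]⟩

theorem SignEq.mul {a b c d : R} (h : SignEq a b) (h' : SignEq c d) : SignEq (a * c) (b * d) := by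
  obtain ⟨s, rfl⟩ := h
  obtain ⟨t, rfl⟩ := h'
  exact ⟨s * t, by rw [smul_mul_smul_comm, Units.val_mul]⟩

theorem SignEq.mem {K : Type*} [Ring K] [Module K R] {N : Submodule K R} {a b : R}
    (h : SignEq a b) (hb : b ∈ N) : a ∈ N := by
  obtain ⟨s, rfl⟩ := h
  exact zsmul_mem hb _

theorem SignEq.of_zsmul {a b : R} {k : ℕ} (h : a = (-1 : ℤ) ^ k • b) : SignEq a b :=
  ⟨(-1) ^ k, by simpa using h⟩

theorem SignEq.of_smul {K : Type*} [Ring K] [Module K R] {a b : R} {k : ℕ}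
    (h : a = (-1 : K) ^ k • b) : SignEq a b := by
  rcases neg_one_pow_eq_or K k with hk | hk
  · exact ⟨1, by simpa [hk] using h⟩
  · exact ⟨-1, by simpa [hk] using h⟩

theorem SignEq.list_prod_perm {l l' : List R} (hp : l.Perm l')
    (h : ∀ a ∈ l, ∀ b ∈ l, SignEq (a * b) (b * a)) : SignEq l.prod l'.prod := by
  induction hp with
  | nil => exact SignEq.refl _
  | cons x _ ih =>
    simp only [List.prod_cons]
    exact (SignEq.refl x).mul (ih fun a ha b hb => h a (by simp [ha]) b (by simp [hb]))
  | swap x y l =>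
    simp only [List.prod_cons, ← mul_assoc]
    exact (h y (by simp) x (by simp)).mul (SignEq.refl _)
  | trans p q ih1 ih2 =>
    exact (ih1 h).trans (ih2 fun a ha b hb => h a (p.mem_iff.mpr ha) b (p.mem_iff.mpr hb))

end SignEq

/-! ### Bamboo monomials -/

section Bamboos

variable {K : Type*} [Field K] {H : Type*} [Ring H] [Algebra K H] (𝒜 : ℕ → Submodule K H) {n : ℕ}

/-- The homogeneous generators of the Križ algebra. -/
def homGens : Set (Model 𝒜 n) :=
  {z | (∃ i d, ∃ x ∈ 𝒜 d, z = cls 𝒜 i x) ∨ ∃ i j, z = G 𝒜 i j}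

theorem cls_mem_homGens (i : Fin n) {d : ℕ} {x : H} (hx : x ∈ 𝒜 d) : cls 𝒜 i x ∈ homGens 𝒜 :=
  Or.inl ⟨i, d, x, hx, rfl⟩

theorem G_mem_homGens (i j : Fin n) : G 𝒜 i j ∈ homGens 𝒜 := Or.inr ⟨i, j, rfl⟩

theorem signEq_comm_of_mem_homGens
    (hcomm : ∀ (d e : ℕ) (x y : H), x ∈ 𝒜 d → y ∈ 𝒜 e → x * y = (-1 : K) ^ (d * e) • (y * x))
    {a b : Model 𝒜 n} (ha : a ∈ homGens 𝒜) (hb : b ∈ homGens 𝒜) : SignEq (a * b) (b * a) := by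
  rcases ha with ⟨i, d, x, hx, rfl⟩ | ⟨i, j, rfl⟩ <;>
    rcases hb with ⟨k, e, y, hy, rfl⟩ | ⟨k, l, rfl⟩
  · by_cases hik : i = k
    · subst hik
      refine SignEq.of_smul (K := K) (k := d * e) ?_
      rw [← cls_mul, hcomm d e x y hx hy, cls_smul, cls_mul]
    · exact SignEq.of_smul (cls_comm 𝒜 hik hx hy)
  · exact (SignEq.of_smul (G_cls 𝒜 k l i hx)).symm
  · exact SignEq.of_smul (G_cls 𝒜 i j k hy)
  · exact SignEq.of_zsmul (k := 1) (by rw [pow_one]; exact G_mul_G_comm 𝒜 i j k l)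

theorem path_mul_cls_comm (w : List (Fin n)) (i : Fin n) {d : ℕ} {x : H} (hx : x ∈ 𝒜 d) :
    path 𝒜 w * cls 𝒜 i x = (-1 : K) ^ (d * (w.length - 1)) • (cls 𝒜 i x * path 𝒜 w) := by
  induction w with
  | nil => simp
  | cons a w ih =>
    cases w with
    | nil => simp
    | cons b l =>
      rw [path_cons_cons, mul_assoc, ih, mul_smul_comm, ← mul_assoc, G_cls 𝒜 a b i hx,
        smul_mul_assoc, smul_smul, mul_assoc, ← pow_add]
      congr 2

theorem path_mul_cls_eq {w : List (Fin n)} {i j : Fin n} (hi : i ∈ w) (hj : j ∈ w) {d : ℕ} {x : H}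
    (hx : x ∈ 𝒜 d) : path 𝒜 w * cls 𝒜 i x = path 𝒜 w * cls 𝒜 j x := by
  induction w generalizing i j with
  | nil => simp at hi
  | cons a w ih =>
    cases w with
    | nil =>
      simp only [List.mem_singleton] at hi hj
      rw [hi, hj]
    | cons b l =>
      have key : ∀ k ∈ a :: b :: l, path 𝒜 (a :: b :: l) * cls 𝒜 k x =
          path 𝒜 (a :: b :: l) * cls 𝒜 b x := by
        intro k hk
        rcases List.mem_cons.mp hk with rfl | hk
        · rw [path_mul_cls_comm 𝒜 _ _ hx, path_mul_cls_comm 𝒜 _ _ hx, path_cons_cons, ← mul_assoc,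
            ← mul_assoc, cls_mul_G]
        · rw [path_cons_cons, mul_assoc, ih (j := b) hk (by simp), mul_assoc]
      rw [key i hi, key j hj]

/-- The monomial of a word (a bamboo) `i_1 ⋯ i_r` with mark `x`, which is
`G_{i_1 i_2} ⋯ G_{i_{r-1} i_r} p_{i_r}^*(x)`. -/
def bamboo (x : H) : List (Fin n) → Model 𝒜 n
  | [] => 1
  | [i] => cls 𝒜 i x
  | i :: j :: l => G 𝒜 i j * bamboo x (j :: l)

theorem bamboo_append_singleton (x : H) (u : List (Fin n)) (z : Fin n) :
    bamboo 𝒜 x (u ++ [z]) = path 𝒜 (u ++ [z]) * cls 𝒜 z x := by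
  induction u with
  | nil => simp [bamboo]
  | cons a u ih =>
    cases u with
    | nil => simp [bamboo, path_cons_cons]
    | cons b u =>
      simp only [List.cons_append] at ih ⊢
      rw [bamboo, ih, path_cons_cons, mul_assoc]

theorem bamboo_eq_path_mul_cls {w : List (Fin n)} {i : Fin n} (hi : i ∈ w) {d : ℕ} {x : H}
    (hx : x ∈ 𝒜 d) : bamboo 𝒜 x w = path 𝒜 w * cls 𝒜 i x := by
  rcases List.eq_nil_or_concat w with rfl | ⟨u, z, rfl⟩
  · simp at hi
  · rw [List.concat_eq_append] at *
    rw [bamboo_append_singleton]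
    exact path_mul_cls_eq 𝒜 (by simp) hi hx

/-- The relation which moves a letter of a bamboo to the end. -/
theorem bamboo_middle (u v : List (Fin n)) (z : Fin n) (hnd : (u ++ z :: v).Nodup) {d : ℕ} {x : H}
    (hx : x ∈ 𝒜 d) :
    bamboo 𝒜 x (u ++ z :: v) =
      (-1 : ℤ) ^ (v.length * (v.length - 1) / 2) • shSum (bamboo 𝒜 x) u.reverse v [z] := by
  rw [bamboo_eq_path_mul_cls 𝒜 (i := z) (by simp) hx, path_middle 𝒜 u v z hnd, smul_mul_assoc]
  congr 1
  have h := map_shSum (AddMonoidHom.mulRight (cls 𝒜 z x)) (path 𝒜) u.reverse v [z]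
  refine h.trans (shSum_congr _ _ _ _ _ fun s _ => ?_)
  exact (bamboo_append_singleton 𝒜 x s z).symm

theorem permHom_path (σ : Equiv.Perm (Fin n)) (w : List (Fin n)) :
    permHom 𝒜 σ (path 𝒜 w) = path 𝒜 (w.map σ) := by
  induction w with
  | nil => simp
  | cons a w ih =>
    cases w with
    | nil => simp
    | cons b l =>
      simp only [List.map_cons] at ih ⊢
      rw [path_cons_cons, map_mul, ih, permHom_G, path_cons_cons]

theorem permHom_bamboo (σ : Equiv.Perm (Fin n)) (x : H) (w : List (Fin n)) :
    permHom 𝒜 σ (bamboo 𝒜 x w) = bamboo 𝒜 x (w.map σ) := by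
  rcases List.eq_nil_or_concat w with rfl | ⟨u, z, rfl⟩
  · simp [bamboo]
  · rw [List.concat_eq_append, bamboo_append_singleton, map_mul, permHom_path, permHom_cls,
      List.map_append, List.map_singleton, bamboo_append_singleton]

theorem G_mul_bamboo (i j : Fin n) {w : List (Fin n)} (hw : w ≠ []) {e : ℕ} {y : H}
    (hy : y ∈ 𝒜 e) : G 𝒜 i j * bamboo 𝒜 y w =
      (-1 : K) ^ (e + (w.length - 1)) • (bamboo 𝒜 y w * G 𝒜 i j) := by
  induction w with
  | nil => exact absurd rfl hw
  | cons a w ih =>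
    cases w with
    | nil => simpa [bamboo] using G_cls 𝒜 i j a hy
    | cons b l =>
      have h : G 𝒜 i j * G 𝒜 a b = (-1 : K) • (G 𝒜 a b * G 𝒜 i j) := by
        rw [G_anticomm]; exact (neg_one_smul K _).symm
      rw [bamboo, ← mul_assoc, h, smul_mul_assoc, mul_assoc, ih (by simp), mul_smul_comm, smul_smul,
        mul_assoc, ← pow_succ']
      congr 2

theorem cls_mul_bamboo (i : Fin n) {w : List (Fin n)} (hw : w ≠ []) (hi : i ∉ w) {d e : ℕ} {x y : H}
    (hx : x ∈ 𝒜 d) (hy : y ∈ 𝒜 e) : cls 𝒜 i x * bamboo 𝒜 y w =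
      (-1 : K) ^ (d * (e + (w.length - 1))) • (bamboo 𝒜 y w * cls 𝒜 i x) := by
  induction w with
  | nil => exact absurd rfl hw
  | cons a w ih =>
    rw [List.mem_cons, not_or] at hi
    cases w with
    | nil => simpa [bamboo] using cls_comm 𝒜 hi.1 hx hy
    | cons b l =>
      have e2 : ((-1 : K) ^ d) * (-1) ^ d = 1 := by
        rw [← pow_add, Even.neg_one_pow ⟨_, rfl⟩]
      have h : cls 𝒜 i x * G 𝒜 a b = (-1 : K) ^ d • (G 𝒜 a b * cls 𝒜 i x) := by
        rw [G_cls 𝒜 a b i hx, smul_smul, e2, one_smul]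
      rw [bamboo, ← mul_assoc, h, smul_mul_assoc, mul_assoc, ih (by simp) hi.2, mul_smul_comm,
        smul_smul, mul_assoc, ← pow_add]
      congr 2
      simp only [List.length_cons, Nat.add_sub_cancel]
      ring

/-- Bamboos on disjoint sets of vertices supercommute. -/
theorem bamboo_mul_bamboo {w w' : List (Fin n)} (hw : w ≠ []) (hw' : w' ≠ [])
    (hdisj : ∀ i ∈ w, i ∉ w') {d e : ℕ} {x y : H} (hx : x ∈ 𝒜 d) (hy : y ∈ 𝒜 e) :
    bamboo 𝒜 x w * bamboo 𝒜 y w' =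
      (-1 : K) ^ ((d + (w.length - 1)) * (e + (w'.length - 1))) •
        (bamboo 𝒜 y w' * bamboo 𝒜 x w) := by
  induction w with
  | nil => exact absurd rfl hw
  | cons a w ih =>
    cases w with
    | nil => simpa [bamboo] using cls_mul_bamboo 𝒜 a hw' (hdisj a (by simp)) hx hy
    | cons b l =>
      rw [bamboo, mul_assoc, ih (by simp) (fun i hi => hdisj i (by simp_all)), mul_smul_comm,
        ← mul_assoc, G_mul_bamboo 𝒜 a b hw' hy, smul_mul_assoc, smul_smul, mul_assoc, ← pow_add]
      congr 2
      simp only [List.length_cons, Nat.add_sub_cancel]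
      ring

/-- The monomial of a list of marked words. -/
def mono {ι : Type*} (x : ι → H) (W : List (List (Fin n) × ι)) : Model 𝒜 n :=
  (W.map fun p => bamboo 𝒜 (x p.2) p.1).prod

theorem permHom_mono {ι : Type*} (x : ι → H) (σ : Equiv.Perm (Fin n))
    (W : List (List (Fin n) × ι)) :
    permHom 𝒜 σ (mono 𝒜 x W) = mono 𝒜 x (W.map fun p => (p.1.map σ, p.2)) := by
  rw [mono, map_list_prod, mono, List.map_map, List.map_map]
  congr 1
  exact List.map_congr_left fun p _ => permHom_bamboo 𝒜 σ _ _

/-- The edges of the path given by a word. -/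
def pathEdges : List (Fin n) → List (Fin n × Fin n)
  | [] => []
  | [_] => []
  | i :: j :: l => (i, j) :: pathEdges (j :: l)

theorem path_eq_prod (w : List (Fin n)) :
    path 𝒜 w = ((pathEdges w).map fun p => G 𝒜 p.1 p.2).prod := by
  induction w with
  | nil => rfl
  | cons a w ih =>
    cases w with
    | nil => rfl
    | cons b l => rw [path_cons_cons, ih, pathEdges, List.map_cons, List.prod_cons]

theorem length_pathEdges (w : List (Fin n)) : (pathEdges w).length = w.length - 1 := by
  induction w with
  | nil => rfl
  | cons a w ih =>
    cases w with
    | nil => rfl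
    | cons b l => simp [pathEdges, ih]

/-- For a choice of a vertex on each word, the marks may be collected in front. -/
theorem signEq_mono
    (hcomm : ∀ (d e : ℕ) (x y : H), x ∈ 𝒜 d → y ∈ 𝒜 e → x * y = (-1 : K) ^ (d * e) • (y * x))
    {ι : Type*} {deg : ι → ℕ} {x : ι → H} (hx : ∀ h, x h ∈ 𝒜 (deg h))
    (c : List (Fin n × List (Fin n) × ι)) (hc : ∀ p ∈ c, p.1 ∈ p.2.1) :
    SignEq ((c.map fun p => cls 𝒜 p.1 (x p.2.2)).prod *
      ((c.map fun p => p.2.1).map (path 𝒜)).prod) (mono 𝒜 x (c.map fun p => p.2)) := by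
  have hM : mono 𝒜 x (c.map fun p => p.2) = (c.flatMap fun p =>
      ((pathEdges p.2.1).map fun q => G 𝒜 q.1 q.2) ++ [cls 𝒜 p.1 (x p.2.2)]).prod := by
    rw [mono, List.map_map, List.flatMap, List.prod_flatten, List.map_map]
    congr 1
    refine List.map_congr_left fun p hp => ?_
    simp only [Function.comp_apply, List.prod_append, List.prod_singleton]
    rw [← path_eq_prod, bamboo_eq_path_mul_cls 𝒜 (hc p hp) (hx p.2.2)]
  have hL : (c.map fun p => cls 𝒜 p.1 (x p.2.2)).prod *
      ((c.map fun p => p.2.1).map (path 𝒜)).prod =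
      ((c.flatMap fun p => [cls 𝒜 p.1 (x p.2.2)]) ++ c.flatMap fun p =>
        ((pathEdges p.2.1).map fun q => G 𝒜 q.1 q.2)).prod := by
    rw [List.prod_append, List.flatMap, List.flatMap, List.prod_flatten, List.prod_flatten,
      List.map_map, List.map_map, List.map_map]
    congr 2
    · exact List.map_congr_left fun p _ => by simp
    · exact List.map_congr_left fun p _ => by simp [path_eq_prod]
  rw [hM, hL]
  apply SignEq.list_prod_perm
  · refine List.perm_append_comm.trans ?_
    clear hM hL hc
    induction c with
    | nil => simp
    | cons p c ih =>
      simp only [List.flatMap_cons, List.append_assoc]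
      refine List.Perm.append_left _ ?_
      refine List.perm_append_comm.trans ?_
      rw [List.append_assoc]
      exact List.Perm.append_left _ (List.perm_append_comm.trans ih)
  · have : ∀ a ∈ ((c.flatMap fun p => [cls 𝒜 p.1 (x p.2.2)]) ++ c.flatMap fun p =>
        ((pathEdges p.2.1).map fun q => G 𝒜 q.1 q.2)), a ∈ homGens 𝒜 := by
      intro a ha
      rcases List.mem_append.mp ha with ha | ha
      · obtain ⟨p, _, hp⟩ := List.mem_flatMap.mp ha
        rw [List.mem_singleton.mp hp]
        exact cls_mem_homGens 𝒜 _ (hx _)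
      · obtain ⟨p, _, hp⟩ := List.mem_flatMap.mp ha
        obtain ⟨q, _, rfl⟩ := List.mem_map.mp hp
        exact G_mem_homGens 𝒜 _ _
    exact fun a ha b hb => signEq_comm_of_mem_homGens 𝒜 hcomm (this a ha) (this b hb)

end Bamboos
end Kriz

namespace Kriz

/-! ### Products of edges are combinations of products of paths -/

section Forests

variable {K : Type*} [Field K] {H : Type*} [Ring H] [Algebra K H] (𝒜 : ℕ → Submodule K H) {n : ℕ}

theorem signEq_G_mul_G (i j k l : Fin n) : SignEq (G 𝒜 i j * G 𝒜 k l) (G 𝒜 k l * G 𝒜 i j) :=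
  SignEq.of_zsmul (k := 1) (by rw [pow_one]; exact G_mul_G_comm 𝒜 i j k l)

theorem signEq_prod_G_perm {e e' : List (Fin n × Fin n)} (h : e.Perm e') :
    SignEq (e.map fun p => G 𝒜 p.1 p.2).prod (e'.map fun p => G 𝒜 p.1 p.2).prod := by
  refine SignEq.list_prod_perm (h.map _) ?_
  intro a ha b hb
  obtain ⟨p, _, rfl⟩ := List.mem_map.mp ha
  obtain ⟨q, _, rfl⟩ := List.mem_map.mp hb
  exact signEq_G_mul_G 𝒜 _ _ _ _

theorem prod_path_eq (W : List (List (Fin n))) :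
    (W.map (path 𝒜)).prod = ((W.flatMap pathEdges).map fun p => G 𝒜 p.1 p.2).prod := by
  rw [List.flatMap, List.map_flatten, List.prod_flatten, List.map_map, List.map_map]
  congr 1
  exact List.map_congr_left fun w _ => path_eq_prod 𝒜 w

theorem signEq_prod_path_perm {W W' : List (List (Fin n))} (h : W.Perm W') :
    SignEq (W.map (path 𝒜)).prod (W'.map (path 𝒜)).prod := by
  rw [prod_path_eq, prod_path_eq]
  exact signEq_prod_G_perm 𝒜 (h.flatMap_right _)

theorem exists_perm_cons_of_mem {α : Type*} {a : α} {l : List α} (h : a ∈ l) :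
    ∃ l', l.Perm (a :: l') := by
  obtain ⟨s, t, rfl⟩ := List.append_of_mem h
  exact ⟨s ++ t, List.perm_middle⟩

/-- Lists of nonempty words which partition `{1, …, n}`. -/
def IsWordPartition (W : List (List (Fin n))) : Prop :=
  W.flatten.Perm (List.finRange n) ∧ [] ∉ W

theorem IsWordPartition.perm {W W' : List (List (Fin n))} (hW : IsWordPartition W) (h : W.Perm W') :
    IsWordPartition W' :=
  ⟨h.flatten.symm.trans hW.1, fun h' => hW.2 (h.mem_iff.mpr h')⟩

theorem IsWordPartition.nodup_flatten {W : List (List (Fin n))} (hW : IsWordPartition W) :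
    W.flatten.Nodup := hW.1.nodup_iff.mpr (List.nodup_finRange n)

theorem IsWordPartition.exists_mem {W : List (List (Fin n))} (hW : IsWordPartition W) (i : Fin n) :
    ∃ w ∈ W, i ∈ w :=
  List.mem_flatten.mp (hW.1.mem_iff.mpr (List.mem_finRange i))

theorem IsWordPartition.unique {W : List (List (Fin n))} (hW : IsWordPartition W) {i : Fin n}
    {w w' : List (Fin n)} (hw : w ∈ W) (hw' : w' ∈ W) (hi : i ∈ w) (hi' : i ∈ w') : w = w' := by
  by_contra hne
  have h := (List.nodup_flatten.mp hW.nodup_flatten).2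
  have : Std.Symm (List.Disjoint (α := Fin n)) := ⟨fun _ _ h => h.symm⟩
  exact h.forall hw hw' hne hi hi'

/-- A partition into words carries the connectivity of the graph with edges `e`. -/
def Carries (e : List (Fin n × Fin n)) (W : List (List (Fin n))) : Prop :=
  (∀ w ∈ W, ∀ i ∈ w, ∀ j ∈ w, (edgeGraph e).Reachable i j) ∧ ∀ p ∈ e, ∃ w ∈ W, p.1 ∈ w ∧ p.2 ∈ w

theorem Carries.perm {e : List (Fin n × Fin n)} {W W' : List (List (Fin n))} (hW : Carries e W)
    (h : W.Perm W') : Carries e W' := by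
  refine ⟨fun w hw => hW.1 w (h.mem_iff.mpr hw), fun p hp => ?_⟩
  obtain ⟨w, hw, h'⟩ := hW.2 p hp
  exact ⟨w, h.mem_iff.mp hw, h'⟩

theorem edgeGraph_mono_cons (p : Fin n × Fin n) (e : List (Fin n × Fin n)) :
    edgeGraph e ≤ edgeGraph (p :: e) := by
  intro a b h
  rw [edgeGraph_adj] at h ⊢
  exact ⟨by rw [List.map_cons]; exact List.mem_cons_of_mem _ h.1, h.2⟩

theorem reachable_edgeGraph_cons (p : Fin n × Fin n) (e : List (Fin n × Fin n)) :
    (edgeGraph (p :: e)).Reachable p.1 p.2 := by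
  by_cases h : p.1 = p.2
  · rw [h]
  · exact SimpleGraph.Adj.reachable ((edgeGraph_adj _ _ _).mpr ⟨by simp, h⟩)

theorem Carries.reachable_iff {e : List (Fin n × Fin n)} {W : List (List (Fin n))}
    (hW : IsWordPartition W) (hc : Carries e W) (i j : Fin n) :
    (edgeGraph e).Reachable i j ↔ ∃ w ∈ W, i ∈ w ∧ j ∈ w := by
  constructor
  · rintro ⟨p⟩
    induction p with
    | nil => 
      obtain ⟨w, hw, hi⟩ := hW.exists_mem _
      exact ⟨w, hw, hi, hi⟩
    | cons hadj _ ih =>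
      obtain ⟨w, hw, hi, hj⟩ := ih
      obtain ⟨hmem, _⟩ := (edgeGraph_adj _ _ _).mp hadj
      obtain ⟨q, hq, hq'⟩ := List.mem_map.mp hmem
      obtain ⟨w', hw', h1, h2⟩ := hc.2 q hq
      rcases Sym2.eq_iff.mp hq' with ⟨rfl, rfl⟩ | ⟨rfl, rfl⟩
      · rw [hW.unique hw' hw h2 hi] at h1
        exact ⟨w, hw, h1, hj⟩
      · rw [hW.unique hw' hw h1 hi] at h2
        exact ⟨w, hw, h2, hj⟩
  · rintro ⟨w, hw, hi, hj⟩
    exact hc.1 w hw i hi j hj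

/-- The span of the products of the paths of `W`, for all partitions into words `W` carrying the
connectivity of `e`. If the graph contains a cycle, there is no such `W` with `n - |e|` words. -/
def pathSpan (e : List (Fin n × Fin n)) : Submodule K (Model 𝒜 n) :=
  Submodule.span K {z | ∃ W : List (List (Fin n)), IsWordPartition W ∧ W.length + e.length = n ∧
    Carries e W ∧ z = (W.map (path 𝒜)).prod}

theorem path_mul_prod_mem_pathSpan {e : List (Fin n × Fin n)} {i j : Fin n}
    {w₁ w₂ : List (Fin n)} {W : List (List (Fin n))} (hW : IsWordPartition (w₁ :: w₂ :: W))
    (hlen : (w₁ :: w₂ :: W).length + e.length = n) (hc : Carries e (w₁ :: w₂ :: W))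
    (hi : i ∈ w₁) (hj : j ∈ w₂) {s t : List (Fin n)} (hs : (s ++ [i]).Perm w₁)
    (ht : (j :: t).Perm w₂) :
    path 𝒜 (s ++ i :: j :: t) * (W.map (path 𝒜)).prod ∈ pathSpan 𝒜 ((i, j) :: e) := by
  have hp : (s ++ i :: j :: t).Perm (w₁ ++ w₂) := by
    have := hs.append ht
    rwa [List.append_assoc, List.singleton_append] at this
  have hmem : ∀ x, x ∈ s ++ i :: j :: t ↔ x ∈ w₁ ∨ x ∈ w₂ := fun x => by
    rw [hp.mem_iff, List.mem_append]
  refine Submodule.subset_span ⟨(s ++ i :: j :: t) :: W, ⟨?_, ?_⟩, ?_, ⟨?_, ?_⟩, by simp⟩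
  · refine List.Perm.trans ?_ hW.1
    simp only [List.flatten_cons]
    rw [← List.append_assoc]
    exact hp.append_right _
  · intro h
    rcases List.mem_cons.mp h with h | h
    · simp at h
    · exact hW.2 (by simp [h])
  · simp only [List.length_cons] at hlen ⊢
    omega
  · have hr : (edgeGraph ((i, j) :: e)).Reachable i j := reachable_edgeGraph_cons (i, j) e
    have hm : ∀ {a b}, (edgeGraph e).Reachable a b → (edgeGraph ((i, j) :: e)).Reachable a b :=
      fun h => h.mono (edgeGraph_mono_cons _ _)
    intro w hw a ha b hb
    rcases List.mem_cons.mp hw with rfl | hw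
    · have key : ∀ x ∈ s ++ i :: j :: t, (edgeGraph ((i, j) :: e)).Reachable x i := by
        intro x hx
        rcases (hmem x).mp hx with hx | hx
        · exact hm (hc.1 w₁ (by simp) x hx i hi)
        · exact (hm (hc.1 w₂ (by simp) x hx j hj)).trans hr.symm
      exact (key a ha).trans (key b hb).symm
    · exact hm (hc.1 w (by simp [hw]) a ha b hb)
  · intro p hp
    rcases List.mem_cons.mp hp with rfl | hp
    · exact ⟨_, List.mem_cons_self, by simp⟩
    · obtain ⟨w, hw, h1, h2⟩ := hc.2 p hp
      rcases List.mem_cons.mp hw with rfl | hw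
      · exact ⟨_, List.mem_cons_self, (hmem _).mpr (Or.inl h1), (hmem _).mpr (Or.inl h2)⟩
      rcases List.mem_cons.mp hw with rfl | hw
      · exact ⟨_, List.mem_cons_self, (hmem _).mpr (Or.inr h1), (hmem _).mpr (Or.inr h2)⟩
      · exact ⟨w, List.mem_cons_of_mem _ hw, h1, h2⟩

/-- Each product of edges is a combination of products of paths: a new edge inside a word gives `0`,
and an edge `i j` between different words joins them, once `i` is moved to the end of its word and
`j` to the beginning of its word. -/
theorem prod_G_mem_pathSpan (e : List (Fin n × Fin n)) :
    (e.map fun p => G 𝒜 p.1 p.2).prod ∈ pathSpan 𝒜 e := by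
  induction e with
  | nil =>
    refine Submodule.subset_span ⟨(List.finRange n).map fun i => [i], ⟨?_, by simp⟩, by simp,
      ⟨?_, by simp⟩, ?_⟩
    · rw [← List.flatMap_def]
      simp
    · intro w hw i hi j hj
      obtain ⟨k, _, rfl⟩ := List.mem_map.mp hw
      rw [List.mem_singleton] at hi hj
      rw [hi, hj]
    · rw [List.map_map]
      symm
      apply List.prod_eq_one
      intro x hx
      obtain ⟨k, _, rfl⟩ := List.mem_map.mp hx
      rfl
  | cons p e ih =>
    obtain ⟨i, j⟩ := p
    rw [List.map_cons, List.prod_cons]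
    have hmap : pathSpan 𝒜 e ≤
        (pathSpan 𝒜 ((i, j) :: e)).comap (LinearMap.mulLeft K (G 𝒜 i j)) := by
      rw [pathSpan, Submodule.span_le]
      rintro _ ⟨W, hW, hlen, hc, rfl⟩
      change G 𝒜 i j * _ ∈ pathSpan 𝒜 ((i, j) :: e)
      obtain ⟨w₁, hw₁, hi⟩ := hW.exists_mem i
      obtain ⟨w₂, hw₂, hj⟩ := hW.exists_mem j
      by_cases hww : w₁ = w₂
      · subst hww
        obtain ⟨W', hp⟩ := exists_perm_cons_of_mem hw₁
        refine ((SignEq.refl _).mul (signEq_prod_path_perm 𝒜 hp)).mem ?_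
        rw [List.map_cons, List.prod_cons, ← mul_assoc, G_mul_path_eq_zero 𝒜 w₁ hi hj, zero_mul]
        exact Submodule.zero_mem _
      · obtain ⟨W₁, hp₁⟩ := exists_perm_cons_of_mem hw₁
        have hw₂' : w₂ ∈ W₁ := by
          rcases List.mem_cons.mp (hp₁.mem_iff.mp hw₂) with h | h
          · exact absurd h.symm hww
          · exact h
        obtain ⟨W₂, hp₂⟩ := exists_perm_cons_of_mem hw₂'
        have hp := hp₁.trans (hp₂.cons w₁)
        refine ((SignEq.refl _).mul (signEq_prod_path_perm 𝒜 hp)).mem ?_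
        have hW' := hW.perm hp
        have hnd := List.nodup_flatten.mp hW'.nodup_flatten
        rw [List.map_cons, List.prod_cons, List.map_cons, List.prod_cons]
        -- bilinearity reduces to words ending in `i` and beginning with `j`
        have h₁ := path_mem_span_getLast 𝒜 (hnd.1 w₁ (by simp)) hi
        have h₂ := path_mem_span_head 𝒜 (hnd.1 w₂ (by simp)) hj
        generalize path 𝒜 w₁ = y₁ at h₁ ⊢
        generalize path 𝒜 w₂ = y₂ at h₂ ⊢
        induction h₁ using Submodule.span_induction with
        | zero => rw [zero_mul, mul_zero]; exact Submodule.zero_mem _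
        | add x y _ _ hx hy => rw [add_mul, mul_add]; exact Submodule.add_mem _ hx hy
        | smul a x _ hx => rw [smul_mul_assoc, mul_smul_comm]; exact Submodule.smul_mem _ _ hx
        | mem x hx =>
          obtain ⟨s, hs, rfl⟩ := hx
          induction h₂ using Submodule.span_induction with
          | zero => rw [zero_mul, mul_zero, mul_zero]; exact Submodule.zero_mem _
          | add x y _ _ hx hy =>
            rw [add_mul, mul_add, mul_add]; exact Submodule.add_mem _ hx hy
          | smul a x _ hx =>
            rw [smul_mul_assoc, mul_smul_comm, mul_smul_comm]; exact Submodule.smul_mem _ _ hx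
          | mem x hx =>
            obtain ⟨t, ht, rfl⟩ := hx
            have e1 : G 𝒜 i j * (path 𝒜 (s ++ [i]) * (path 𝒜 (j :: t) * (W₂.map (path 𝒜)).prod)) =
                (-1 : ℤ) ^ ((s ++ [i]).length - 1) •
                  (path 𝒜 (s ++ i :: j :: t) * (W₂.map (path 𝒜)).prod) := by
              rw [← mul_assoc, G_mul_path, smul_mul_assoc, path_append 𝒜 s i (j :: t),
                path_cons_cons]
              simp only [mul_assoc]
            rw [e1]
            refine zsmul_mem (path_mul_prod_mem_pathSpan 𝒜 hW' ?_ (hc.perm hp) hi hj hs ht) _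
            rw [← hp.length_eq]
            exact hlen
    exact hmap ih

end Forests
end Kriz

namespace Kriz

/-! ### The blocks of a type -/

namespace BambooType

variable {n : ℕ} {ι : Type*} [LinearOrder ι] (τ : BambooType n ι)

theorem partialSum_succ {i : ℕ} (h : i < τ.parts.length) :
    τ.partialSum (i + 1) = τ.partialSum i + τ.parts[i].1 := by
  rw [partialSum, partialSum, List.take_succ_eq_append_getElem h, List.map_append, List.sum_append]
  simp

theorem partialSum_mono {i j : ℕ} (h : i ≤ j) : τ.partialSum i ≤ τ.partialSum j := by
  rw [partialSum, partialSum, List.map_take, List.map_take]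
  exact List.monotone_sum_take _ h

theorem partialSum_length : τ.partialSum τ.parts.length = n := by
  rw [partialSum, List.take_length, τ.sum_eq]

theorem mem_block {i : ℕ} {a : Fin n} :
    a ∈ τ.block i ↔ τ.partialSum i ≤ (a : ℕ) ∧ (a : ℕ) < τ.partialSum (i + 1) := by
  simp [block]

theorem block_pairwise (i : ℕ) : (τ.block i).Pairwise (· < ·) :=
  (List.pairwise_lt_finRange n).filter _

theorem nodup_block (i : ℕ) : (τ.block i).Nodup := (List.nodup_finRange n).filter _

theorem length_block {i : ℕ} (h : i < τ.parts.length) : (τ.block i).length = τ.parts[i].1 := by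
  have h1 : ((τ.block i).map Fin.val).toFinset =
      Finset.Ico (τ.partialSum i) (τ.partialSum (i + 1)) := by
    ext x
    simp only [List.mem_toFinset, List.mem_map, mem_block, Finset.mem_Ico]
    constructor
    · rintro ⟨a, ha, rfl⟩
      exact ha
    · intro hx
      have : τ.partialSum (i + 1) ≤ n := (τ.partialSum_mono h).trans_eq τ.partialSum_length
      exact ⟨⟨x, hx.2.trans_le this⟩, hx, rfl⟩
  have h2 := congrArg Finset.card h1
  rw [List.toFinset_card_of_nodup ((τ.nodup_block i).map Fin.val_injective), List.length_map,
    Nat.card_Ico, τ.partialSum_succ h] at h2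
  omega

theorem block_ne_nil {i : ℕ} (h : i < τ.parts.length) : τ.block i ≠ [] := by
  intro h0
  have h1 := τ.length_block h
  have h2 := τ.pos _ (List.getElem_mem h)
  rw [h0, List.length_nil] at h1
  omega

theorem block_unique {i j : ℕ} {a : Fin n} (hi : a ∈ τ.block i) (hj : a ∈ τ.block j) : i = j := by
  rw [mem_block] at hi hj
  rcases lt_trichotomy i j with h | h | h
  · have := τ.partialSum_mono (Nat.succ_le_of_lt h)
    simp only [Nat.succ_eq_add_one] at this
    omega
  · exact h
  · have := τ.partialSum_mono (Nat.succ_le_of_lt h)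
    simp only [Nat.succ_eq_add_one] at this
    omega

theorem exists_mem_block (a : Fin n) : ∃ k : Fin τ.parts.length, a ∈ τ.block k := by
  have key : ∀ i ≤ τ.parts.length, (a : ℕ) < τ.partialSum i → ∃ k < i, a ∈ τ.block k := by
    intro i
    induction i with
    | zero => intro _ h; simp [partialSum] at h
    | succ i ih =>
      intro hi h
      by_cases h' : (a : ℕ) < τ.partialSum i
      · obtain ⟨k, hk, hm⟩ := ih (Nat.le_of_succ_le hi) h'
        exact ⟨k, hk.trans i.lt_succ_self, hm⟩
      · exact ⟨i, i.lt_succ_self, τ.mem_block.mpr ⟨not_lt.mp h', h⟩⟩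
  obtain ⟨k, hk, hm⟩ := key _ le_rfl (by rw [τ.partialSum_length]; exact a.2)
  exact ⟨⟨k, hk⟩, hm⟩

/-- The `k`-th part `(λ_k, h_k)`. -/
def part (k : Fin τ.parts.length) : ℕ × ι := τ.parts[k]

/-- The index of the block of a point. -/
noncomputable def blockIdx (a : Fin n) : Fin τ.parts.length := (τ.exists_mem_block a).choose

theorem mem_block_blockIdx (a : Fin n) : a ∈ τ.block (τ.blockIdx a) :=
  (τ.exists_mem_block a).choose_spec

theorem mem_block_iff {a : Fin n} {k : Fin τ.parts.length} : a ∈ τ.block k ↔ τ.blockIdx a = k :=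
  ⟨fun h => Fin.ext (τ.block_unique (τ.mem_block_blockIdx a) h),
    fun h => h ▸ τ.mem_block_blockIdx a⟩

theorem perm_ext_blocks {σ σ' : Equiv.Perm (Fin n)}
    (h : ∀ k : Fin τ.parts.length, (τ.block k).map σ = (τ.block k).map σ') : σ = σ' :=
  Equiv.ext fun a => List.map_inj_left.mp (h _) a (τ.mem_block_blockIdx a)

theorem flatten_blocks :
    (List.ofFn fun k : Fin τ.parts.length => τ.block k).flatten = List.finRange n := by
  have hs : (List.ofFn fun k : Fin τ.parts.length => τ.block k).flatten.Pairwise (· < ·) := by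
    rw [List.pairwise_flatten]
    constructor
    · intro l hl
      obtain ⟨k, rfl⟩ := List.mem_ofFn.mp hl
      exact τ.block_pairwise k
    · rw [List.pairwise_ofFn]
      intro i j hij x hx y hy
      rw [mem_block] at hx hy
      have := τ.partialSum_mono (i := i + 1) (j := j) hij
      exact Fin.lt_def.mpr (by omega)
  refine List.Perm.eq_of_pairwise (le := (· < ·)) (fun a b _ _ h h' => absurd h' h.asymm) hs
    (List.pairwise_lt_finRange n) ?_
  rw [List.perm_ext_iff_of_nodup (hs.imp fun h => h.ne) (List.nodup_finRange n)]
  intro a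
  refine ⟨fun _ => List.mem_finRange a, fun _ => ?_⟩
  rw [List.mem_flatten]
  exact ⟨_, List.mem_ofFn.mpr ⟨τ.blockIdx a, rfl⟩, τ.mem_block_blockIdx a⟩

/-- The marked words of a type, with letters permuted by `σ`. -/
def words (σ : Equiv.Perm (Fin n)) : List (List (Fin n) × ι) :=
  List.ofFn fun k : Fin τ.parts.length => ((τ.block k).map σ, (τ.part k).2)

theorem map_words (σ σ' : Equiv.Perm (Fin n)) :
    (τ.words σ').map (fun p => (p.1.map σ, p.2)) = τ.words (σ * σ') := by
  simp [words, List.map_ofFn, Function.comp_def]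

theorem isWordPartition_words (σ : Equiv.Perm (Fin n)) :
    IsWordPartition ((τ.words σ).map Prod.fst) := by
  have h : (τ.words σ).map Prod.fst =
      (List.ofFn fun k : Fin τ.parts.length => τ.block k).map (List.map σ) := by
    simp [words, List.map_ofFn, Function.comp_def]
  rw [h]
  constructor
  · rw [← List.map_flatten, flatten_blocks]
    rw [List.perm_ext_iff_of_nodup ((List.nodup_finRange n).map σ.injective)
      (List.nodup_finRange n)]
    intro a
    simp only [List.mem_map, List.mem_finRange, true_and, iff_true]
    exact σ.surjective a
  · simp only [List.mem_map, List.mem_ofFn, List.map_eq_nil_iff]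
    rintro ⟨_, ⟨k, rfl⟩, h⟩
    exact τ.block_ne_nil k.2 h

theorem map_length_words (σ : Equiv.Perm (Fin n)) :
    (τ.words σ).map (fun p => (p.1.length, p.2)) = τ.parts := by
  simp only [words, List.map_ofFn, Function.comp_def, List.length_map]
  apply List.ext_getElem
  · simp
  · intro i h1 h2
    simp [τ.length_block h2, part]

theorem exists_words_eq {W : List (List (Fin n) × ι)} (hW : IsWordPartition (W.map Prod.fst))
    (h : W.map (fun p => (p.1.length, p.2)) = τ.parts) : ∃ σ, τ.words σ = W := by
  set l := (W.map Prod.fst).flatten with hl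
  have hlen : l.length = n := by rw [hW.1.length_eq, List.length_finRange]
  have hinj : Function.Injective fun i : Fin n => l[i] := by
    intro i j hij
    exact Fin.ext ((hW.nodup_flatten.getElem_inj_iff).mp hij)
  set σ := Equiv.ofBijective _ (Finite.injective_iff_bijective.mp hinj)
  have hσ : (List.finRange n).map σ = l := by
    apply List.ext_getElem
    · simp [hlen]
    · intro i h1 h2
      simp [σ]
  refine ⟨σ, ?_⟩
  have h1 : (τ.words σ).map Prod.fst = W.map Prod.fst := by
    rw [List.eq_iff_flatten_eq]
    constructor
    · rw [← hl, ← hσ, ← τ.flatten_blocks, List.map_flatten]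
      simp [words, List.map_ofFn, Function.comp_def]
    · have := τ.map_length_words σ
      rw [← h] at this
      have := congrArg (List.map Prod.fst) this
      simpa [List.map_map, Function.comp_def] using this
  have h2 : (τ.words σ).map Prod.snd = W.map Prod.snd := by
    have := τ.map_length_words σ
    rw [← h] at this
    have := congrArg (List.map Prod.snd) this
    simpa [List.map_map, Function.comp_def] using this
  rw [← List.zip_unzip (τ.words σ), ← List.zip_unzip W, List.unzip_eq_map,
    List.unzip_eq_map, h1, h2]

/-! ### Block cycles -/

theorem map_blockCycle_pow_self (i j : ℕ) :
    (τ.block i).map (τ.blockCycle i ^ j : Equiv.Perm (Fin n)) = (τ.block i).rotate j := by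
  apply List.ext_getElem
  · simp
  · intro a h1 h2
    rw [List.getElem_map, List.getElem_rotate]
    exact List.formPerm_pow_apply_getElem _ (τ.nodup_block i) _ _ _

theorem blockCycle_pow_apply_of_notMem {i : ℕ} (j : ℕ) {a : Fin n} (h : a ∉ τ.block i) :
    (τ.blockCycle i ^ j : Equiv.Perm (Fin n)) a = a := by
  have h1 : τ.blockCycle i a = a := List.formPerm_apply_of_notMem h
  induction j with
  | zero => rfl
  | succ j ih => rw [pow_succ, Equiv.Perm.mul_apply, h1, ih]

theorem map_blockCycle_pow_of_ne {i k : ℕ} (h : i ≠ k) (j : ℕ) :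
    (τ.block k).map (τ.blockCycle i ^ j : Equiv.Perm (Fin n)) = τ.block k := by
  conv_rhs => rw [← List.map_id (τ.block k)]
  refine List.map_congr_left fun a ha => ?_
  exact τ.blockCycle_pow_apply_of_notMem j fun h' => h (τ.block_unique h' ha)

theorem sign_formPerm {α : Type*} [DecidableEq α] [Fintype α] (l : List α) (hl : l.Nodup) :
    Equiv.Perm.sign l.formPerm = (-1) ^ (l.length - 1) := by
  induction l with
  | nil => simp
  | cons a l ih =>
    cases l with
    | nil => simp
    | cons b l =>
      rw [List.nodup_cons] at hl
      have hab : a ≠ b := fun h => hl.1 (by simp [h])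
      rw [List.formPerm_cons_cons, map_mul, ih hl.2, Equiv.Perm.sign_swap hab]
      simp [pow_succ']

/-- The product of powers of the block cycles. -/
def cyclePow (j : Fin τ.parts.length → ℕ) : Equiv.Perm (Fin n) :=
  ((List.finRange τ.parts.length).map fun k : Fin τ.parts.length => τ.blockCycle k ^ j k).prod

theorem map_cyclePow (j : Fin τ.parts.length → ℕ) (k : Fin τ.parts.length) :
    (τ.block k).map (τ.cyclePow j) = (τ.block k).rotate (j k) := by
  have key : ∀ l : List (Fin τ.parts.length), l.Nodup →
      (τ.block k).map (l.map fun k : Fin τ.parts.length => τ.blockCycle k ^ j k).prod =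
        if k ∈ l then (τ.block k).rotate (j k) else τ.block k := by
    intro l
    induction l with
    | nil => intro _; simp
    | cons i l ih =>
      intro hl
      rw [List.nodup_cons] at hl
      rw [List.map_cons, List.prod_cons, Equiv.Perm.coe_mul, ← List.map_map, ih hl.2]
      by_cases hik : k = i
      · subst hik
        rw [if_neg hl.1, if_pos (by simp), map_blockCycle_pow_self]
      · have hne : (i : ℕ) ≠ (k : ℕ) := fun h => hik (Fin.ext h).symm
        by_cases hk : k ∈ l
        · rw [if_pos hk, if_pos (by simp [hk]), List.map_rotate, map_blockCycle_pow_of_ne _ hne]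
        · rw [if_neg hk, if_neg (by simp [hk, hik]), map_blockCycle_pow_of_ne _ hne]
  rw [cyclePow, key _ (List.nodup_finRange _), if_pos (List.mem_finRange k)]

theorem cyclePow_mem (j : Fin τ.parts.length → ℕ) : τ.cyclePow j ∈ τ.C := by
  refine Subgroup.list_prod_mem _ fun g hg => ?_
  obtain ⟨k, _, rfl⟩ := List.mem_map.mp hg
  have h : τ.blockCycle k ∈ τ.C := Subgroup.subset_closure ⟨k, k.2, rfl⟩
  exact τ.C.pow_mem h _

theorem mem_C_of_forall_rotate {σ : Equiv.Perm (Fin n)}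
    (h : ∀ k : Fin τ.parts.length, ∃ j, (τ.block k).map σ = (τ.block k).rotate j) : σ ∈ τ.C := by
  choose j hj using h
  have : σ = τ.cyclePow j := τ.perm_ext_blocks fun k => by rw [hj, map_cyclePow]
  rw [this]
  exact τ.cyclePow_mem j

/-- The elements of `C` preserve each block. -/
theorem mem_block_of_mem_C {σ : Equiv.Perm (Fin n)} (hσ : σ ∈ τ.C) (k : ℕ) (a : Fin n) :
    σ a ∈ τ.block k ↔ a ∈ τ.block k := by
  induction hσ using Subgroup.closure_induction generalizing a with
  | one => rfl
  | mul x y _ _ hx hy => rw [Equiv.Perm.mul_apply, hx, hy]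
  | inv x _ hx => rw [← hx, ← Equiv.Perm.mul_apply, mul_inv_cancel, Equiv.Perm.one_apply]
  | mem x hx =>
    obtain ⟨i, hi, rfl⟩ := hx
    by_cases hm : a ∈ τ.block i
    · have hm' : τ.blockCycle i a ∈ τ.block i := List.formPerm_apply_mem_of_mem hm
      exact ⟨fun h => by rwa [τ.block_unique h hm'], fun h => by rwa [τ.block_unique h hm]⟩
    · rw [← pow_one (τ.blockCycle i), τ.blockCycle_pow_apply_of_notMem 1 hm]

/-! ### Block transpositions -/

theorem swap_zip_prod {α : Type*} [DecidableEq α] (l l' : List α) (hlen : l.length = l'.length)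
    (hnd : (l ++ l').Nodup) :
    l.map (((l.zip l').map fun p => Equiv.swap p.1 p.2).prod) = l' ∧
      l'.map (((l.zip l').map fun p => Equiv.swap p.1 p.2).prod) = l ∧
      ∀ a ∉ l ++ l', ((l.zip l').map fun p => Equiv.swap p.1 p.2).prod a = a := by
  induction l generalizing l' with
  | nil =>
    cases l' with
    | nil => simp
    | cons b l' => simp at hlen
  | cons a l ih =>
    cases l' with
    | nil => simp at hlen
    | cons b l' =>
      have hp : (a :: l ++ b :: l').Perm (a :: b :: (l ++ l')) := by
        rw [List.cons_append]
        exact List.perm_middle.cons a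
      rw [hp.nodup_iff, List.nodup_cons, List.nodup_cons, List.mem_cons, not_or] at hnd
      obtain ⟨⟨hab, ha⟩, hb, hnd⟩ := hnd
      obtain ⟨h1, h2, h3⟩ := ih l' (by simpa using hlen) hnd
      set v := ((l.zip l').map fun p => Equiv.swap p.1 p.2).prod with hv
      have hprod : (((a :: l).zip (b :: l')).map fun p => Equiv.swap p.1 p.2).prod =
          Equiv.swap a b * v := by simp [hv]
      have hfix : ∀ m : List α, a ∉ m → b ∉ m → m.map (Equiv.swap a b) = m := by
        intro m hm hm'
        conv_rhs => rw [← List.map_id m]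
        refine List.map_congr_left fun x hx => Equiv.swap_apply_of_ne_of_ne ?_ ?_
        · rintro rfl; exact hm hx
        · rintro rfl; exact hm' hx
      rw [List.mem_append, not_or] at ha hb
      rw [hprod, Equiv.Perm.coe_mul]
      refine ⟨?_, ?_, ?_⟩
      · rw [List.map_cons, Function.comp_apply, h3 a (by simp [ha]), Equiv.swap_apply_left,
          ← List.map_map, h1, hfix _ ha.2 hb.2]
      · rw [List.map_cons, Function.comp_apply, h3 b (by simp [hb]), Equiv.swap_apply_right,
          ← List.map_map, h2, hfix _ ha.1 hb.1]
      · intro x hx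
        rw [hp.mem_iff, List.mem_cons, List.mem_cons, not_or, not_or] at hx
        rw [Function.comp_apply, h3 x hx.2.2, Equiv.swap_apply_of_ne_of_ne hx.1 hx.2.1]

/-- The transposition `v_i` exchanges the blocks `i` and `i + 1`, preserving the order inside
the blocks. -/
theorem map_blockSwap {i : ℕ} (hi : i + 1 < τ.parts.length) (h : τ.parts[i] = τ.parts[i + 1])
    (k : Fin τ.parts.length) : (τ.block k).map (τ.blockSwap i) =
      τ.block (Equiv.swap (⟨i, by omega⟩ : Fin τ.parts.length) ⟨i + 1, hi⟩ k) := by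
  have hlen : (τ.block i).length = (τ.block (i + 1)).length := by
    rw [τ.length_block (by omega), τ.length_block hi, h]
  have hnd : (τ.block i ++ τ.block (i + 1)).Nodup := by
    rw [List.nodup_append']
    refine ⟨τ.nodup_block _, τ.nodup_block _, fun a ha ha' => ?_⟩
    have := τ.block_unique ha ha'
    omega
  obtain ⟨h1, h2, h3⟩ := swap_zip_prod _ _ hlen hnd
  by_cases hk : k = ⟨i, by omega⟩
  · subst hk
    rw [Equiv.swap_apply_left]
    exact h1
  by_cases hk' : k = ⟨i + 1, hi⟩
  · subst hk'
    rw [Equiv.swap_apply_right]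
    exact h2
  · rw [Equiv.swap_apply_of_ne_of_ne hk hk']
    conv_rhs => rw [← List.map_id (τ.block k)]
    refine List.map_congr_left fun a ha => h3 a ?_
    rw [List.mem_append, not_or]
    exact ⟨fun h' => hk (Fin.ext (τ.block_unique ha h')),
      fun h' => hk' (Fin.ext (τ.block_unique ha h'))⟩

/-- The permutation `σ` maps the block `k` onto the block `β k`, preserving the order. -/
def MovesBlocks (σ : Equiv.Perm (Fin n)) (β : Equiv.Perm (Fin τ.parts.length)) : Prop :=
  ∀ k : Fin τ.parts.length, (τ.block k).map σ = τ.block (β k)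

variable {τ} in
theorem MovesBlocks.mul {σ σ' : Equiv.Perm (Fin n)} {β β' : Equiv.Perm (Fin τ.parts.length)}
    (h : τ.MovesBlocks σ β) (h' : τ.MovesBlocks σ' β') : τ.MovesBlocks (σ * σ') (β * β') := by
  intro k
  rw [Equiv.Perm.coe_mul, ← List.map_map, h', h, Equiv.Perm.mul_apply]

variable {τ} in
theorem MovesBlocks.inv {σ : Equiv.Perm (Fin n)} {β : Equiv.Perm (Fin τ.parts.length)}
    (h : τ.MovesBlocks σ β) : τ.MovesBlocks σ⁻¹ β⁻¹ := by
  intro k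
  have := h (β⁻¹ k)
  rw [← Equiv.Perm.mul_apply, mul_inv_cancel, Equiv.Perm.one_apply] at this
  rw [← this, List.map_map]
  conv_rhs => rw [← List.map_id (τ.block _)]
  exact List.map_congr_left fun a _ => by simp

theorem movesBlocks_one : τ.MovesBlocks 1 1 := fun k => by simp

/-- The elements of `N` permute the blocks, preserving the parts. -/
theorem exists_movesBlocks_of_mem_N {σ : Equiv.Perm (Fin n)} (hσ : σ ∈ τ.N) :
    ∃ β : Equiv.Perm (Fin τ.parts.length), τ.MovesBlocks σ β ∧
      ∀ k, τ.part (β k) = τ.part k := by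
  induction hσ using Subgroup.closure_induction with
  | one => exact ⟨1, τ.movesBlocks_one, fun _ => rfl⟩
  | mul x y _ _ hx hy =>
    obtain ⟨β, h1, h2⟩ := hx
    obtain ⟨β', h1', h2'⟩ := hy
    exact ⟨β * β', h1.mul h1', fun k => by rw [Equiv.Perm.mul_apply, h2, h2']⟩
  | inv x _ hx =>
    obtain ⟨β, h1, h2⟩ := hx
    refine ⟨β⁻¹, h1.inv, fun k => ?_⟩
    have := h2 (β⁻¹ k)
    rw [← Equiv.Perm.mul_apply, mul_inv_cancel, Equiv.Perm.one_apply] at this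
    exact this.symm
  | mem x hx =>
    obtain ⟨i, hi, h, rfl⟩ := hx
    refine ⟨_, τ.map_blockSwap hi h, fun k => ?_⟩
    by_cases hk : k = ⟨i, by omega⟩
    · subst hk
      rw [Equiv.swap_apply_left]
      exact h.symm
    by_cases hk' : k = ⟨i + 1, hi⟩
    · subst hk'
      rw [Equiv.swap_apply_right]
      exact h
    · rw [Equiv.swap_apply_of_ne_of_ne hk hk']

/-- Blocks with equal parts can be exchanged by an element of `N`: equal parts are consecutive. -/
theorem exists_mem_N_swap {k l : Fin τ.parts.length} (hkl : k < l) (h : τ.part k = τ.part l) :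
    ∃ ν ∈ τ.N, τ.MovesBlocks ν (Equiv.swap k l) := by
  obtain ⟨l, hl⟩ := l
  induction l with
  | zero => exact absurd hkl (Nat.not_lt_zero _)
  | succ l ih =>
    have hkl' : (k : ℕ) < l + 1 := hkl
    have hs := List.pairwise_iff_getElem.mp τ.sorted
    have hk : τ.parts[l] = τ.parts[l + 1] := by
      rcases Nat.eq_or_lt_of_le (Nat.le_of_lt_succ hkl') with h' | h'
      · have h1 : τ.part k = τ.parts[l + 1] := h
        rw [← h1]
        have h2 : k = ⟨l, by omega⟩ := Fin.ext h'
        rw [h2]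
        rfl
      · have h1 := hs k l k.2 (by omega) h'
        have h2 := hs l (l + 1) (by omega) hl l.lt_succ_self
        have h3 : τ.parts[(k : ℕ)] = τ.parts[l + 1] := h
        rw [h3] at h1
        have h4 : τ.parts[l].1 = τ.parts[l + 1].1 := by omega
        refine Prod.ext h4 (le_antisymm ?_ ?_)
        · rcases h1 with h1 | h1
          · omega
          · exact h1.2
        · rcases h2 with h2 | h2
          · omega
          · exact h2.2
    have hN : τ.blockSwap l ∈ τ.N := Subgroup.subset_closure ⟨l, hl, hk, rfl⟩
    have hm : τ.MovesBlocks (τ.blockSwap l) (Equiv.swap ⟨l, by omega⟩ ⟨l + 1, hl⟩) :=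
      τ.map_blockSwap hl hk
    rcases Nat.eq_or_lt_of_le (Nat.le_of_lt_succ hkl') with h' | h'
    · refine ⟨_, hN, ?_⟩
      have : k = ⟨l, by omega⟩ := Fin.ext h'
      rw [this]
      exact hm
    · obtain ⟨ν, hν, hν'⟩ := ih (by omega) h' (h.trans hk.symm)
      refine ⟨_, mul_mem (mul_mem hN hν) hN, ?_⟩
      have e := (hm.mul hν').mul hm
      have hne : k ≠ ⟨l + 1, hl⟩ := by
        rintro rfl
        simp at hkl'
      have hne' : (⟨l, by omega⟩ : Fin τ.parts.length) ≠ k := fun h0 => by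
        rw [← h0] at h'
        simp at h'
      have hs : Equiv.swap (⟨l, by omega⟩ : Fin τ.parts.length) ⟨l + 1, hl⟩ *
          Equiv.swap k ⟨l, by omega⟩ * Equiv.swap ⟨l, by omega⟩ ⟨l + 1, hl⟩ =
          Equiv.swap k ⟨l + 1, hl⟩ := by
        rw [Equiv.swap_mul_swap_mul_swap hne'.symm hne, Equiv.swap_comm]
      rwa [hs] at e

/-- Each permutation of the blocks which preserves the parts is induced by an element of `N`. -/
theorem exists_mem_N_of_perm (β : Equiv.Perm (Fin τ.parts.length))
    (h : ∀ k, τ.part (β k) = τ.part k) : ∃ ν ∈ τ.N, τ.MovesBlocks ν β := by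
  induction hc : β.support.card using Nat.strong_induction_on generalizing β with
  | _ c ih =>
    by_cases h1 : β = 1
    · rw [h1]
      exact ⟨1, one_mem _, τ.movesBlocks_one⟩
    · obtain ⟨k, hk⟩ : ∃ k, β k ≠ k := by
        by_contra! h'
        exact h1 (Equiv.ext h')
      have hlt := Equiv.Perm.card_support_swap_mul hk
      have hsw : ∃ ν ∈ τ.N, τ.MovesBlocks ν (Equiv.swap k (β k)) := by
        rcases lt_or_gt_of_ne hk with h' | h'
        · rw [Equiv.swap_comm]
          exact τ.exists_mem_N_swap h' (h k)
        · exact τ.exists_mem_N_swap h' (h k).symm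
      have hpres : ∀ j, τ.part ((Equiv.swap k (β k) * β) j) = τ.part j := by
        intro j
        rw [← h j, Equiv.Perm.mul_apply]
        by_cases h2 : β j = k
        · rw [h2, Equiv.swap_apply_left, h k]
        by_cases h3 : β j = β k
        · rw [h3, Equiv.swap_apply_right, h k]
        · rw [Equiv.swap_apply_of_ne_of_ne h2 h3]
      obtain ⟨ν, hν, hν'⟩ := ih _ (hc ▸ hlt) _ hpres rfl
      obtain ⟨μ, hμ, hμ'⟩ := hsw
      refine ⟨μ * ν, mul_mem hμ hν, ?_⟩
      have := hμ'.mul hν'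
      rwa [← mul_assoc, Equiv.swap_mul_self, one_mul] at this

/-! ### The semidirect product -/

theorem conj_blockCycle {σ : Equiv.Perm (Fin n)} {β : Equiv.Perm (Fin τ.parts.length)}
    (h : τ.MovesBlocks σ β) (k : Fin τ.parts.length) :
    σ * τ.blockCycle k * σ⁻¹ = τ.blockCycle (β k) := by
  rw [mul_inv_eq_iff_eq_mul]
  refine τ.perm_ext_blocks fun l => ?_
  rw [Equiv.Perm.coe_mul, Equiv.Perm.coe_mul, ← List.map_map, ← List.map_map, h l]
  have h1 := fun i => τ.map_blockCycle_pow_self i 1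
  have h2 := fun i l (hne : i ≠ l) => τ.map_blockCycle_pow_of_ne (i := i) (k := l) hne 1
  simp only [pow_one] at h1 h2
  by_cases hkl : k = l
  · subst hkl
    rw [h1, h1, List.map_rotate, h]
  · rw [h2 _ _ (fun h' => hkl (Fin.ext h')), h2 _ _ (fun h' => hkl (β.injective (Fin.ext h'))), h]

theorem C_inf_N : τ.C ⊓ τ.N = ⊥ := by
  rw [eq_bot_iff]
  rintro σ ⟨hC, hN⟩
  obtain ⟨β, hβ, _⟩ := τ.exists_movesBlocks_of_mem_N hN
  rw [Subgroup.mem_bot]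
  refine τ.perm_ext_blocks fun k => ?_
  rw [hβ k]
  have : β k = k := by
    obtain ⟨a, ha⟩ := List.exists_mem_of_ne_nil _ (τ.block_ne_nil k.2)
    have h1 : σ a ∈ τ.block (β k) := by rw [← hβ k]; exact List.mem_map_of_mem ha
    exact Fin.ext (τ.block_unique h1 ((τ.mem_block_of_mem_C hC k a).mpr ha))
  rw [this]
  simp

theorem conj_mem_C {ν c : Equiv.Perm (Fin n)} (hν : ν ∈ τ.N) (hc : c ∈ τ.C) :
    ν * c * ν⁻¹ ∈ τ.C := by
  obtain ⟨β, hβ, _⟩ := τ.exists_movesBlocks_of_mem_N hν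
  have : τ.C ≤ τ.C.comap (MulAut.conj ν).toMonoidHom := by
    conv_lhs => rw [C]
    rw [Subgroup.closure_le]
    rintro _ ⟨k, hk, rfl⟩
    change ν * τ.blockCycle k * ν⁻¹ ∈ τ.C
    rw [τ.conj_blockCycle hβ ⟨k, hk⟩]
    exact Subgroup.subset_closure ⟨_, (β ⟨k, hk⟩).2, rfl⟩
  exact this hc

theorem N_le_normalizer_C : τ.N ≤ Subgroup.normalizer τ.C := by
  intro ν hν
  rw [Subgroup.mem_normalizer_iff]
  intro c
  refine ⟨τ.conj_mem_C hν, fun h => ?_⟩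
  have := τ.conj_mem_C (inv_mem hν) h
  simpa [mul_assoc] using this

end BambooType
end Kriz

namespace Kriz

/-! ### Forests made of paths -/

section PathForests

variable {n : ℕ}

theorem mem_of_mem_pathEdges {w : List (Fin n)} {p : Fin n × Fin n} (h : p ∈ pathEdges w) :
    p.1 ∈ w ∧ p.2 ∈ w := by
  induction w with
  | nil => simp [pathEdges] at h
  | cons a w ih =>
    cases w with
    | nil => simp [pathEdges] at h
    | cons b l =>
      rw [pathEdges, List.mem_cons] at h
      rcases h with rfl | h
      · simp
      · exact ⟨List.mem_cons_of_mem _ (ih h).1, List.mem_cons_of_mem _ (ih h).2⟩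

/-- Each edge begins in a vertex which does not lie on the later edges, and is not a loop. -/
def IsPruned (e : List (Fin n × Fin n)) : Prop :=
  e.Pairwise (fun p q => p.1 ≠ q.1 ∧ p.1 ≠ q.2) ∧ ∀ p ∈ e, p.1 ≠ p.2

theorem isPruned_pathEdges {w : List (Fin n)} (hw : w.Nodup) : IsPruned (pathEdges w) := by
  induction w with
  | nil => exact ⟨List.Pairwise.nil, by simp [pathEdges]⟩
  | cons a w ih =>
    cases w with
    | nil => exact ⟨List.Pairwise.nil, by simp [pathEdges]⟩
    | cons b l =>
      rw [List.nodup_cons] at hw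
      obtain ⟨h1, h2⟩ := ih hw.2
      refine ⟨List.Pairwise.cons (fun q hq => ?_) h1, ?_⟩
      · obtain ⟨h3, h4⟩ := mem_of_mem_pathEdges hq
        exact ⟨fun h => hw.1 (by rwa [← h] at h3), fun h => hw.1 (by rwa [← h] at h4)⟩
      · intro p hp
        rcases List.mem_cons.mp hp with rfl | hp
        · exact fun h => hw.1 (by simp only at h; simp [h])
        · exact h2 p hp

theorem isPruned_flatMap_pathEdges {W : List (List (Fin n))} (hW : W.flatten.Nodup) :
    IsPruned (W.flatMap pathEdges) := by
  obtain ⟨h1, h2⟩ := List.nodup_flatten.mp hW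
  refine ⟨?_, ?_⟩
  · rw [List.pairwise_flatMap]
    refine ⟨fun w hw => (isPruned_pathEdges (h1 w hw)).1, h2.imp fun {w w'} hd p hp q hq => ?_⟩
    obtain ⟨h3, _⟩ := mem_of_mem_pathEdges hp
    obtain ⟨h4, h5⟩ := mem_of_mem_pathEdges hq
    exact ⟨fun h => hd h3 (h ▸ h4), fun h => hd h3 (h ▸ h5)⟩
  · intro p hp
    obtain ⟨w, hw, hp⟩ := List.mem_flatMap.mp hp
    exact (isPruned_pathEdges (h1 w hw)).2 p hp

theorem IsPruned.nodup {e : List (Fin n × Fin n)} (he : IsPruned e) :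
    (e.map fun p => s(p.1, p.2)).Nodup := by
  refine List.Pairwise.map _ (fun p q h heq => ?_) he.1
  rcases Sym2.eq_iff.mp heq with h' | h'
  · exact h.1 h'.1
  · exact h.2 h'.1

theorem IsPruned.isAcyclic {e : List (Fin n × Fin n)} (he : IsPruned e) :
    (edgeGraph e).IsAcyclic := by
  induction e with
  | nil =>
    have : edgeGraph ([] : List (Fin n × Fin n)) = ⊥ := by
      ext a b
      simp [edgeGraph_adj]
    rw [this]
    exact SimpleGraph.isAcyclic_bot
  | cons p e ih =>
    obtain ⟨h1, h2⟩ := he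
    rw [List.pairwise_cons] at h1
    have ha := ih ⟨h1.2, fun q hq => h2 q (List.mem_cons_of_mem _ hq)⟩
    have hg : edgeGraph (p :: e) = edgeGraph e ⊔ SimpleGraph.edge p.1 p.2 := by
      ext a b
      rw [SimpleGraph.sup_adj, edgeGraph_adj, edgeGraph_adj, SimpleGraph.edge_adj, List.map_cons,
        List.mem_cons, Sym2.eq_iff]
      tauto
    rw [hg]
    refine ha.sup_edge_of_not_reachable ?_
    rintro ⟨w⟩
    have h0 : p.1 ≠ p.2 := h2 p (by simp)
    generalize p.2 = b at w h0
    cases w with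
    | nil => exact h0 rfl
    | cons hadj _ =>
      obtain ⟨q, hq, hq'⟩ := List.mem_map.mp ((edgeGraph_adj _ _ _).mp hadj).1
      rcases Sym2.eq_iff.mp hq' with h' | h'
      · exact (h1.1 q hq).1 h'.1.symm
      · exact (h1.1 q hq).2 h'.2.symm

theorem reachable_pathEdges {e : List (Fin n × Fin n)} {w : List (Fin n)}
    (hw : ∀ p ∈ pathEdges w, p ∈ e) : ∀ i ∈ w, ∀ j ∈ w, (edgeGraph e).Reachable i j := by
  induction w with
  | nil => simp
  | cons a w ih =>
    cases w with
    | nil =>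
      intro i hi j hj
      rw [List.mem_singleton] at hi hj
      rw [hi, hj]
    | cons b l =>
      have h1 := ih fun p hp => hw p (by rw [pathEdges]; exact List.mem_cons_of_mem _ hp)
      have hab : (edgeGraph e).Reachable a b := by
        by_cases h : a = b
        · rw [h]
        · refine SimpleGraph.Adj.reachable ((edgeGraph_adj _ _ _).mpr ⟨?_, h⟩)
          exact List.mem_map.mpr ⟨(a, b), hw _ (by simp [pathEdges]), rfl⟩
      have key : ∀ i ∈ a :: b :: l, (edgeGraph e).Reachable i b := by
        intro i hi
        rcases List.mem_cons.mp hi with rfl | hi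
        · exact hab
        · exact h1 i hi b (by simp)
      exact fun i hi j hj => (key i hi).trans (key j hj).symm

theorem carries_flatMap_pathEdges (W : List (List (Fin n))) : Carries (W.flatMap pathEdges) W := by
  refine ⟨fun w hw => reachable_pathEdges fun p hp => List.mem_flatMap.mpr ⟨w, hw, hp⟩, ?_⟩
  intro p hp
  obtain ⟨w, hw, hp⟩ := List.mem_flatMap.mp hp
  exact ⟨w, hw, mem_of_mem_pathEdges hp⟩

theorem IsWordPartition.ncard_supp {e : List (Fin n × Fin n)} {W : List (List (Fin n))}
    (hW : IsWordPartition W) (hc : Carries e W) {w : List (Fin n)} (hw : w ∈ W) {i : Fin n}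
    (hi : i ∈ w) : ((edgeGraph e).connectedComponentMk i).supp.ncard = w.length := by
  have : ((edgeGraph e).connectedComponentMk i).supp = (w.toFinset : Set (Fin n)) := by
    ext j
    rw [SimpleGraph.ConnectedComponent.mem_supp_iff, SimpleGraph.ConnectedComponent.eq,
      hc.reachable_iff hW, List.coe_toFinset]
    constructor
    · rintro ⟨w', hw', hj, hi'⟩
      rw [hW.unique hw hw' hi hi']
      exact hj
    · intro hj
      exact ⟨w, hw, hj, hi⟩
  rw [this, Set.ncard_coe_finset,
    List.toFinset_card_of_nodup ((List.nodup_flatten.mp hW.nodup_flatten).1 w hw)]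

/-- The marked forest whose components are the paths of the words `W`. -/
theorem isMarkedForest_paths {ι : Type*} [LinearOrder ι] {τ : BambooType n ι}
    {c : List (Fin n × List (Fin n) × ι)} (hc : ∀ p ∈ c, p.1 ∈ p.2.1)
    (hW : IsWordPartition (c.map fun p => p.2.1))
    (hτ : (c.map fun p => (p.2.1.length, p.2.2)).Perm τ.parts) :
    IsMarkedForest τ (c.map fun p => (p.1, p.2.2)) ((c.map fun p => p.2.1).flatMap pathEdges) := by
  have hp := isPruned_flatMap_pathEdges hW.nodup_flatten
  have hcar := carries_flatMap_pathEdges (c.map fun p => p.2.1)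
  refine ⟨hp.2, hp.nodup, hp.isAcyclic, ?_, ?_, ?_⟩
  · rw [List.map_map]
    have hd : (c.map fun p => p.2.1).Pairwise List.Disjoint :=
      (List.nodup_flatten.mp hW.nodup_flatten).2
    rw [List.pairwise_map] at hd
    rw [List.Nodup, List.pairwise_map]
    refine hd.imp_of_mem fun {p q} hpm hqm hpq heq => ?_
    obtain ⟨w, hw, h1, h2⟩ := (hcar.reachable_iff hW _ _).mp
      (SimpleGraph.ConnectedComponent.eq.mp heq)
    have e2 := hW.unique hw (List.mem_map_of_mem hqm) h2 (hc q hqm)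
    rw [e2] at h1
    exact hpq (hc p hpm) h1
  · intro C
    induction C using SimpleGraph.ConnectedComponent.ind with
    | _ v =>
      obtain ⟨w, hw, hv⟩ := hW.exists_mem v
      obtain ⟨p, hpm, rfl⟩ := List.mem_map.mp hw
      rw [List.map_map, List.mem_map]
      exact ⟨p, hpm, SimpleGraph.ConnectedComponent.eq.mpr
        ((hcar.reachable_iff hW _ _).mpr ⟨_, hw, hc p hpm, hv⟩)⟩
  · refine List.Perm.trans (List.Perm.of_eq ?_) hτ
    rw [List.map_map]
    refine List.map_congr_left fun p hpm => ?_
    rw [Function.comp_apply, hW.ncard_supp hcar (List.mem_map_of_mem hpm) (hc p hpm)]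

end PathForests

/-! ### The type of a list of marked words -/

namespace BambooType

variable {n : ℕ} {ι : Type*} [LinearOrder ι]

theorem eq_of_perm {τ τ' : BambooType n ι} (h : τ.parts.Perm τ'.parts) : τ = τ' := by
  have : τ.parts = τ'.parts := by
    refine List.Perm.eq_of_pairwise (fun a b _ _ h1 h2 => ?_) τ.sorted τ'.sorted h
    have h3 : a.1 = b.1 := by omega
    refine Prod.ext h3 (le_antisymm ?_ ?_)
    · rcases h2 with h2 | h2
      · omega
      · exact h2.2
    · rcases h1 with h1 | h1
      · omega
      · exact h1.2
  cases τ; cases τ'; simp_all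

theorem exists_words_perm {W : List (List (Fin n) × ι)} (hW : IsWordPartition (W.map Prod.fst)) :
    ∃ (τ : BambooType n ι) (σ : Equiv.Perm (Fin n)), (τ.words σ).Perm W := by
  classical
  let r : ℕ × ι → ℕ × ι → Prop := fun a b => b.1 < a.1 ∨ (b.1 = a.1 ∧ b.2 ≤ a.2)
  let f : List (Fin n) × ι → ℕ × ι := fun p => (p.1.length, p.2)
  let R : List (Fin n) × ι → List (Fin n) × ι → Prop := fun p q => r (f p) (f q)
  have htot : ∀ a b, R a b ∨ R b a := by
    intro a b
    simp only [R, r]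
    rcases lt_trichotomy (f a).1 (f b).1 with h | h | h
    · exact Or.inr (Or.inl h)
    · rcases le_total (f a).2 (f b).2 with h' | h'
      · exact Or.inr (Or.inr ⟨h, h'⟩)
      · exact Or.inl (Or.inr ⟨h.symm, h'⟩)
    · exact Or.inl (Or.inl h)
  have htr : ∀ a b c, R a b → R b c → R a c := by
    intro a b c h1 h2
    simp only [R, r] at h1 h2 ⊢
    rcases h1 with h1 | ⟨h1, h1'⟩ <;> rcases h2 with h2 | ⟨h2, h2'⟩
    · exact Or.inl (h2.trans h1)
    · exact Or.inl (h2 ▸ h1)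
    · exact Or.inl (h1 ▸ h2)
    · exact Or.inr ⟨h2.trans h1, h2'.trans h1'⟩
  have : Std.Total R := ⟨htot⟩
  have : IsTrans _ R := ⟨htr⟩
  set W' := W.insertionSort R with hW'
  have hperm : W'.Perm W := List.perm_insertionSort R W
  have hpart : IsWordPartition (W'.map Prod.fst) := hW.perm (hperm.symm.map _)
  let τ : BambooType n ι :=
    { parts := W'.map f
      pos := by
        intro p hp
        obtain ⟨q, hq, rfl⟩ := List.mem_map.mp hp
        have : q.1 ≠ [] := fun h => hpart.2 (h ▸ List.mem_map_of_mem hq)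
        exact List.length_pos_iff.mpr this
      sum_eq := by
        have h1 := hpart.1.length_eq
        rw [List.length_flatten, List.length_finRange, List.map_map] at h1
        rw [List.map_map]
        exact h1
      sorted := by
        rw [List.pairwise_map]
        exact List.pairwise_insertionSort R W }
  obtain ⟨σ, hσ⟩ := τ.exists_words_eq hpart rfl
  exact ⟨τ, σ, hσ ▸ hperm⟩

theorem parts_perm_of_words_perm {τ : BambooType n ι} {σ : Equiv.Perm (Fin n)}
    {W : List (List (Fin n) × ι)} (h : (τ.words σ).Perm W) :
    τ.parts.Perm (W.map fun p => (p.1.length, p.2)) := by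
  have := h.map fun p => (p.1.length, p.2)
  rwa [τ.map_length_words] at this

theorem lengthDeg_add_length (τ : BambooType n ι) : τ.lengthDeg + τ.parts.length = n := by
  have h : ∀ l : List (ℕ × ι), (∀ p ∈ l, 1 ≤ p.1) →
      (l.map fun p => p.1 - 1).sum + l.length = (l.map Prod.fst).sum := by
    intro l
    induction l with
    | nil => simp
    | cons a l ih =>
      intro hl
      have h1 := hl a (by simp)
      have h2 := ih fun p hp => hl p (by simp [hp])
      simp only [List.map_cons, List.sum_cons, List.length_cons]
      omega
  rw [lengthDeg, h _ τ.pos, τ.sum_eq]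

end BambooType

/-! ### The monomials of the words of a type span -/

section Spans

variable {K : Type*} [Field K] {H : Type*} [Ring H] [Algebra K H] (𝒜 : ℕ → Submodule K H) {n : ℕ}

theorem signEq_prod_comm_of_homGens
    (hcomm : ∀ (d e : ℕ) (x y : H), x ∈ 𝒜 d → y ∈ 𝒜 e → x * y = (-1 : K) ^ (d * e) • (y * x))
    {l l' : List (Model 𝒜 n)} (hl : ∀ a ∈ l, a ∈ homGens 𝒜) (hl' : ∀ a ∈ l', a ∈ homGens 𝒜) :
    SignEq (l.prod * l'.prod) (l'.prod * l.prod) := by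
  rw [← List.prod_append, ← List.prod_append]
  have h : ∀ a ∈ l ++ l', a ∈ homGens 𝒜 := by
    intro a ha
    rcases List.mem_append.mp ha with h | h
    · exact hl a h
    · exact hl' a h
  exact SignEq.list_prod_perm List.perm_append_comm
    fun a ha b hb => signEq_comm_of_mem_homGens 𝒜 hcomm (h a ha) (h b hb)

theorem exists_homGens_bamboo {d : ℕ} {x : H} (hx : x ∈ 𝒜 d) (w : List (Fin n)) :
    ∃ l : List (Model 𝒜 n), (∀ a ∈ l, a ∈ homGens 𝒜) ∧ bamboo 𝒜 x w = l.prod := by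
  induction w with
  | nil => exact ⟨[], by simp, rfl⟩
  | cons a w ih =>
    cases w with
    | nil => exact ⟨[cls 𝒜 a x], by simpa using cls_mem_homGens 𝒜 a hx, by simp [bamboo]⟩
    | cons b w =>
      obtain ⟨l, hl, hb⟩ := ih
      refine ⟨G 𝒜 a b :: l, ?_, by rw [bamboo, hb, List.prod_cons]⟩
      intro c hc
      rcases List.mem_cons.mp hc with rfl | hc
      · exact G_mem_homGens 𝒜 _ _
      · exact hl c hc

theorem signEq_mono_perm
    (hcomm : ∀ (d e : ℕ) (x y : H), x ∈ 𝒜 d → y ∈ 𝒜 e → x * y = (-1 : K) ^ (d * e) • (y * x))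
    {ι : Type*} {x : ι → H} {W W' : List (List (Fin n) × ι)}
    (hx : ∀ p ∈ W, ∃ d, x p.2 ∈ 𝒜 d) (h : W.Perm W') :
    SignEq (mono 𝒜 x W) (mono 𝒜 x W') := by
  refine SignEq.list_prod_perm (h.map _) ?_
  intro a ha b hb
  obtain ⟨p, hp, rfl⟩ := List.mem_map.mp ha
  obtain ⟨q, hq, rfl⟩ := List.mem_map.mp hb
  obtain ⟨d, hd⟩ := hx p hp
  obtain ⟨e, he⟩ := hx q hq
  obtain ⟨l, hl, h1⟩ := exists_homGens_bamboo 𝒜 hd p.1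
  obtain ⟨l', hl', h2⟩ := exists_homGens_bamboo 𝒜 he q.1
  rw [h1, h2]
  exact signEq_prod_comm_of_homGens 𝒜 hcomm hl hl'

variable {ι : Type*} [LinearOrder ι]

/-- The monomial of the blocks of a type, with letters permuted by `σ`. -/
def typeVec (x : ι → H) (τ : BambooType n ι) (σ : Equiv.Perm (Fin n)) : Model 𝒜 n :=
  mono 𝒜 x (τ.words σ)

theorem rep_typeVec (x : ι → H) (τ : BambooType n ι) (σ σ' : Equiv.Perm (Fin n)) :
    rep 𝒜 n σ (typeVec 𝒜 x τ σ') = typeVec 𝒜 x τ (σ * σ') := by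
  rw [rep_apply, typeVec, permHom_mono, τ.map_words, typeVec]

theorem exists_signEq_typeVec
    (hcomm : ∀ (d e : ℕ) (x y : H), x ∈ 𝒜 d → y ∈ 𝒜 e → x * y = (-1 : K) ^ (d * e) • (y * x))
    {deg : ι → ℕ} {x : ι → H} (hx : ∀ h, x h ∈ 𝒜 (deg h)) {W : List (List (Fin n) × ι)}
    (hW : IsWordPartition (W.map Prod.fst)) :
    ∃ (τ : BambooType n ι) (σ : Equiv.Perm (Fin n)),
      τ.parts.Perm (W.map fun p => (p.1.length, p.2)) ∧
        SignEq (mono 𝒜 x W) (typeVec 𝒜 x τ σ) := by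
  obtain ⟨τ, σ, h⟩ := BambooType.exists_words_perm hW
  exact ⟨τ, σ, BambooType.parts_perm_of_words_perm h,
    signEq_mono_perm 𝒜 hcomm (fun p _ => ⟨_, hx p.2⟩) h.symm⟩

theorem exists_marked_vertices {W : List (List (Fin n) × ι)} (hW : [] ∉ W.map Prod.fst) :
    ∃ c : List (Fin n × List (Fin n) × ι), (c.map fun p => p.2) = W ∧ ∀ p ∈ c, p.1 ∈ p.2.1 := by
  induction W with
  | nil => exact ⟨[], by simp⟩
  | cons p W ih =>
    rw [List.map_cons, List.mem_cons, not_or] at hW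
    obtain ⟨c, hc, hc'⟩ := ih hW.2
    obtain ⟨i, hi⟩ := List.exists_mem_of_ne_nil _ (Ne.symm hW.1)
    refine ⟨(i, p) :: c, by simp [hc], ?_⟩
    intro q hq
    rcases List.mem_cons.mp hq with rfl | hq
    · exact hi
    · exact hc' q hq

/-- Up to sign, the monomial of the words of a type is the monomial of a marked forest. -/
theorem typeVec_signEq_forest
    (hcomm : ∀ (d e : ℕ) (x y : H), x ∈ 𝒜 d → y ∈ 𝒜 e → x * y = (-1 : K) ^ (d * e) • (y * x))
    {deg : ι → ℕ} {x : ι → H} (hx : ∀ h, x h ∈ 𝒜 (deg h)) (τ : BambooType n ι)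
    (σ : Equiv.Perm (Fin n)) :
    ∃ (c : List (Fin n × ι)) (e : List (Fin n × Fin n)), IsMarkedForest τ c e ∧
      e.length = τ.lengthDeg ∧ (c.map fun p => deg p.2).sum = τ.markDeg deg ∧
      SignEq (typeVec 𝒜 x τ σ)
        ((c.map fun p => cls 𝒜 p.1 (x p.2)).prod * (e.map fun p => G 𝒜 p.1 p.2).prod) := by
  have hW := τ.isWordPartition_words σ
  obtain ⟨c, hcW, hc⟩ := exists_marked_vertices hW.2
  have hlen := τ.map_length_words σ
  rw [← hcW, List.map_map] at hW hlen
  refine ⟨_, _, isMarkedForest_paths hc hW (List.Perm.of_eq hlen), ?_, ?_, ?_⟩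
  · rw [List.length_flatMap, List.map_map, BambooType.lengthDeg, ← hlen, List.map_map]
    congr 1
    exact List.map_congr_left fun p _ => by simp [length_pathEdges]
  · rw [BambooType.markDeg, ← hlen, List.map_map, List.map_map]
    rfl
  · have h := (signEq_mono 𝒜 hcomm hx c hc).symm
    rw [hcW, prod_path_eq] at h
    rw [List.map_map]
    exact h

theorem span_typeSet
    (hcomm : ∀ (d e : ℕ) (x y : H), x ∈ 𝒜 d → y ∈ 𝒜 e → x * y = (-1 : K) ^ (d * e) • (y * x))
    {deg : ι → ℕ} {x : ι → H} (hx : ∀ h, x h ∈ 𝒜 (deg h)) (τ : BambooType n ι) :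
    Submodule.span K (typeSet 𝒜 x τ) = Submodule.span K (Set.range (typeVec 𝒜 x τ)) := by
  apply le_antisymm
  · rw [Submodule.span_le]
    rintro _ ⟨c, e, hf, rfl⟩
    set N := Submodule.span K (Set.range (typeVec 𝒜 x τ)) with hN
    set y := (c.map fun p => cls 𝒜 p.1 (x p.2)).prod with hy
    have hmap : pathSpan 𝒜 e ≤ N.comap (LinearMap.mulLeft K y) := by
      rw [pathSpan, Submodule.span_le]
      rintro _ ⟨W, hW, -, hcar, rfl⟩
      change y * _ ∈ N
      choose wd hwd hwd' using hW.exists_mem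
      -- each mark is attached to the word which contains its vertex
      let c' : List (Fin n × List (Fin n) × ι) := c.map fun p => (p.1, wd p.1, p.2)
      have hreach : ∀ i j, (edgeGraph e).Reachable i j ↔ wd i = wd j := by
        intro i j
        rw [hcar.reachable_iff hW]
        constructor
        · rintro ⟨w, hw, hi, hj⟩
          rw [hW.unique (hwd i) hw (hwd' i) hi, hW.unique (hwd j) hw (hwd' j) hj]
        · intro h
          exact ⟨wd i, hwd i, hwd' i, h ▸ hwd' j⟩
      have hWnd : W.Nodup := by
        refine (List.nodup_flatten.mp hW.nodup_flatten).2.imp_of_mem fun {w w'} hw _ hd heq => ?_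
        obtain ⟨i, hi⟩ := List.exists_mem_of_ne_nil w fun h => hW.2 (h ▸ hw)
        exact hd hi (heq ▸ hi)
      have hperm : (c'.map fun p => p.2.1).Perm W := by
        rw [List.perm_ext_iff_of_nodup _ hWnd]
        · intro w
          simp only [c', List.map_map, List.mem_map, Function.comp_apply]
          constructor
          · rintro ⟨p, _, rfl⟩
            exact hwd _
          · intro hw
            obtain ⟨i, hi⟩ := List.exists_mem_of_ne_nil w fun h => hW.2 (h ▸ hw)
            obtain ⟨p, hp, hp'⟩ := List.mem_map.mp
              (hf.marks_cover ((edgeGraph e).connectedComponentMk i))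
            refine ⟨p, hp, ?_⟩
            rw [(hreach _ _).mp (SimpleGraph.ConnectedComponent.eq.mp hp')]
            exact hW.unique (hwd i) hw (hwd' i) hi
        · have := hf.marks_nodup
          rw [List.Nodup, List.pairwise_map] at this
          simp only [c', List.map_map]
          rw [List.Nodup, List.pairwise_map]
          refine this.imp fun {p q} h h' => h ?_
          exact SimpleGraph.ConnectedComponent.eq.mpr ((hreach _ _).mpr h')
      have hc' : ∀ p ∈ c', p.1 ∈ p.2.1 := by
        intro p hp
        obtain ⟨q, _, rfl⟩ := List.mem_map.mp hp
        exact hwd' _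
      have hpart : IsWordPartition ((c'.map fun p => p.2).map Prod.fst) := by
        rw [List.map_map]
        exact hW.perm hperm.symm
      obtain ⟨τ', σ, hτ', hs⟩ := exists_signEq_typeVec 𝒜 hcomm hx hpart
      have hττ : τ' = τ := by
        refine BambooType.eq_of_perm (hτ'.trans (List.Perm.trans (List.Perm.of_eq ?_) hf.type_eq))
        simp only [c', List.map_map]
        refine List.map_congr_left fun p _ => ?_
        simp only [Function.comp_apply]
        rw [hW.ncard_supp hcar (hwd p.1) (hwd' p.1)]
      subst hττ
      have hyc : y = (c'.map fun p => cls 𝒜 p.1 (x p.2.2)).prod := by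
        rw [hy]
        simp only [c', List.map_map]
        rfl
      refine (((SignEq.refl y).mul (signEq_prod_path_perm 𝒜 hperm.symm)).trans ?_).mem
        (Submodule.subset_span ⟨σ, rfl⟩)
      rw [hyc]
      exact (signEq_mono 𝒜 hcomm hx c' hc').trans hs
    exact hmap (prod_G_mem_pathSpan 𝒜 e)
  · rw [Submodule.span_le]
    rintro _ ⟨σ, rfl⟩
    obtain ⟨c, e, hf, -, -, hs⟩ := typeVec_signEq_forest 𝒜 hcomm hx τ σ
    exact hs.mem (Submodule.subset_span ⟨c, e, hf, rfl⟩)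

end Spans
end Kriz

namespace Kriz

/-! ### Homogeneous marks are combinations of basis elements of the same degree -/

section Bigraded

variable {K : Type*} [Field K] {H : Type*} [Ring H] [Algebra K H] (𝒜 : ℕ → Submodule K H)
  [GradedAlgebra 𝒜] {n : ℕ} {ι : Type*} [Fintype ι] [LinearOrder ι] (b : Module.Basis ι K H)
  {deg : ι → ℕ}

theorem repr_eq_zero_of_mem (hdeg : ∀ i, b i ∈ 𝒜 (deg i)) {d : ℕ} {x : H} (hx : x ∈ 𝒜 d)
    {h : ι} (hd : deg h ≠ d) :
    b.repr x h = 0 := by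
  classical
  have h1 : GradedRing.proj 𝒜 d x = x := by
    rw [GradedRing.proj_apply, DirectSum.decompose_of_mem_same 𝒜 hx]
  have h2 : GradedRing.proj 𝒜 d x =
      ∑ i, if deg i = d then b.repr x i • b i else 0 := by
    conv_lhs => rw [← b.sum_repr x]
    rw [map_sum]
    refine Finset.sum_congr rfl fun i _ => ?_
    have hm : b.repr x i • b i ∈ 𝒜 (deg i) := Submodule.smul_mem _ _ (hdeg i)
    rw [GradedRing.proj_apply]
    split_ifs with hi
    · rw [← hi, DirectSum.decompose_of_mem_same 𝒜 hm]
    · rw [DirectSum.decompose_of_mem_ne 𝒜 hm hi]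
  rw [h1] at h2
  rw [h2, map_sum, Finsupp.finsetSum_apply]
  refine Finset.sum_eq_zero fun i _ => ?_
  split_ifs with hi
  · rw [map_smul, Module.Basis.repr_self, Finsupp.smul_apply, Finsupp.single_apply, if_neg,
      smul_zero]
    rintro rfl
    exact hd hi
  · simp

theorem bamboo_eq_sum {w : List (Fin n)} (hw : w ≠ []) (y : H) :
    bamboo 𝒜 y w = ∑ h, b.repr y h • bamboo 𝒜 (b h) w := by
  rcases List.eq_nil_or_concat w with rfl | ⟨u, z, rfl⟩
  · exact absurd rfl hw
  · rw [List.concat_eq_append, bamboo_append_singleton]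
    let f : H →ₗ[K] Model 𝒜 n :=
      { toFun := fun y => path 𝒜 (u ++ [z]) * cls 𝒜 z y
        map_add' := fun x y => by rw [cls_add, mul_add]
        map_smul' := fun a x => by rw [cls_smul, mul_smul_comm]; rfl }
    change f y = _
    conv_lhs => rw [← b.sum_repr y]
    rw [map_sum]
    refine Finset.sum_congr rfl fun h _ => ?_
    rw [map_smul, bamboo_append_singleton]
    rfl

/-- Monomials with homogeneous marks are combinations of monomials marked by basis elements. -/
theorem mono_mem_span_of_homogeneous (hdeg : ∀ i, b i ∈ 𝒜 (deg i))
    (W : List (List (Fin n) × ℕ × H))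
    (hW : [] ∉ W.map Prod.fst) (hh : ∀ p ∈ W, p.2.2 ∈ 𝒜 p.2.1) :
    mono 𝒜 (fun q : ℕ × H => q.2) W ∈ Submodule.span K {z | ∃ W' : List (List (Fin n) × ι),
      W'.map Prod.fst = W.map Prod.fst ∧
      (W'.map fun p => deg p.2).sum = (W.map fun p => p.2.1).sum ∧ z = mono 𝒜 b W'} := by
  induction W with
  | nil => exact Submodule.subset_span ⟨[], by simp [mono]⟩
  | cons p W ih =>
    rw [List.map_cons, List.mem_cons, not_or] at hW
    have ih' := ih hW.2 fun q hq => hh q (List.mem_cons_of_mem _ hq)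
    have hp := hh p (by simp)
    have e : mono 𝒜 (fun q : ℕ × H => q.2) (p :: W) =
        bamboo 𝒜 p.2.2 p.1 * mono 𝒜 (fun q : ℕ × H => q.2) W := by simp [mono]
    rw [e]
    generalize mono 𝒜 (fun q : ℕ × H => q.2) W = y at ih' ⊢
    rw [bamboo_eq_sum 𝒜 b (Ne.symm hW.1), Finset.sum_mul]
    refine Submodule.sum_mem _ fun h _ => ?_
    rw [smul_mul_assoc]
    by_cases hd : deg h = p.2.1
    · refine Submodule.smul_mem _ _ ?_
      induction ih' using Submodule.span_induction with
      | zero => rw [mul_zero]; exact Submodule.zero_mem _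
      | add x y _ _ hx hy => rw [mul_add]; exact Submodule.add_mem _ hx hy
      | smul a x _ hx => rw [mul_smul_comm]; exact Submodule.smul_mem _ _ hx
      | mem x hx =>
        obtain ⟨W', h1, h2, rfl⟩ := hx
        exact Submodule.subset_span ⟨(p.1, h) :: W', by simp [h1], by simp [h2, hd], by simp [mono]⟩
    · rw [repr_eq_zero_of_mem 𝒜 b hdeg hp hd, zero_smul]
      exact Submodule.zero_mem _

/-- A product of homogeneous classes and of paths is, up to sign, a monomial with homogeneous
marks. -/
theorem exists_signEq_mono_homogeneous
    (hcomm : ∀ (d e : ℕ) (x y : H), x ∈ 𝒜 d → y ∈ 𝒜 e → x * y = (-1 : K) ^ (d * e) • (y * x))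
    (c : List (Fin n × ℕ × H)) (hc : ∀ p ∈ c, p.2.2 ∈ 𝒜 p.2.1) {W : List (List (Fin n))}
    (hW : IsWordPartition W) :
    ∃ W' : List (List (Fin n) × ℕ × H), (W'.map Prod.fst).Perm W ∧ (∀ p ∈ W', p.2.2 ∈ 𝒜 p.2.1) ∧
      (W'.map fun p => p.2.1).sum = (c.map fun p => p.2.1).sum ∧
      SignEq ((c.map fun p => cls 𝒜 p.1 p.2.2).prod * (W.map (path 𝒜)).prod)
        (mono 𝒜 (fun q : ℕ × H => q.2) W') := by
  induction c with
  | nil =>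
    refine ⟨W.map fun w => (w, 0, 1), by simp [List.map_map, Function.comp_def], ?_, ?_, ?_⟩
    · intro p hp
      obtain ⟨w, _, rfl⟩ := List.mem_map.mp hp
      exact SetLike.one_mem_graded 𝒜
    · simp [List.map_map, Function.comp_def]
    · have : mono 𝒜 (fun q : ℕ × H => q.2) (W.map fun w => (w, 0, 1)) = (W.map (path 𝒜)).prod := by
        rw [mono, List.map_map]
        congr 1
        refine List.map_congr_left fun w _ => ?_
        rw [Function.comp_apply]
        rcases List.eq_nil_or_concat w with rfl | ⟨u, z, rfl⟩
        · rfl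
        · rw [List.concat_eq_append, bamboo_append_singleton, cls_one, mul_one]
      rw [this]
      simpa using SignEq.refl _
  | cons p c ih =>
    obtain ⟨i, d, x⟩ := p
    obtain ⟨W', h1, h2, h3, h4⟩ := ih fun q hq => hc q (List.mem_cons_of_mem _ hq)
    have hx : x ∈ 𝒜 d := hc (i, d, x) (by simp)
    have hW' : IsWordPartition (W'.map Prod.fst) := hW.perm h1.symm
    obtain ⟨w, hw, hi⟩ := hW'.exists_mem i
    obtain ⟨⟨w', e, y⟩, hq, rfl⟩ := List.mem_map.mp hw
    obtain ⟨V, hV⟩ := exists_perm_cons_of_mem hq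
    have hy : y ∈ 𝒜 e := h2 _ hq
    have hxy : x * y ∈ 𝒜 (d + e) := SetLike.mul_mem_graded hx hy
    simp only at hi hw
    refine ⟨(w', d + e, x * y) :: V, ?_, ?_, ?_, ?_⟩
    · exact (hV.map Prod.fst).symm.trans h1
    · intro q hq
      rcases List.mem_cons.mp hq with rfl | hq
      · exact hxy
      · exact h2 q (hV.mem_iff.mpr (List.mem_cons_of_mem _ hq))
    · have := (hV.map fun p => p.2.1).sum_eq
      simp only [List.map_cons, List.sum_cons] at this ⊢
      omega
    · have e1 : SignEq (cls 𝒜 i x * bamboo 𝒜 y w') (bamboo 𝒜 (x * y) w') := by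
        rw [bamboo_eq_path_mul_cls 𝒜 hi hy, bamboo_eq_path_mul_cls 𝒜 hi hxy, cls_mul, ← mul_assoc,
          ← mul_assoc]
        exact (SignEq.of_smul (path_mul_cls_comm 𝒜 w' i hx)).symm.mul (SignEq.refl _)
      rw [List.map_cons, List.prod_cons, mul_assoc]
      refine ((SignEq.refl _).mul (h4.trans
        (signEq_mono_perm 𝒜 hcomm (fun p hp => ⟨_, h2 p hp⟩) hV))).trans ?_
      simp only [mono, List.map_cons, List.prod_cons]
      rw [← mul_assoc]
      exact e1.mul (SignEq.refl _)

theorem span_bigradedSet (hdeg : ∀ i, b i ∈ 𝒜 (deg i))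
    (hcomm : ∀ (d e : ℕ) (x y : H), x ∈ 𝒜 d → y ∈ 𝒜 e → x * y = (-1 : K) ^ (d * e) • (y * x))
    (m q : ℕ) (k : ℤ) :
    Submodule.span K (bigradedSet 𝒜 m n q k) =
      Submodule.span K {z | ∃ τ : BambooType n ι, (τ.lengthDeg = q ∧
        (τ.markDeg deg : ℤ) + (q : ℤ) * (2 * (m : ℤ) - 1) = k) ∧ ∃ σ, z = typeVec 𝒜 b τ σ} := by
  apply le_antisymm
  · rw [Submodule.span_le]
    rintro _ ⟨c, e, hc, he, hk, rfl⟩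
    set N := Submodule.span K {z | ∃ τ : BambooType n ι, (τ.lengthDeg = q ∧
        (τ.markDeg deg : ℤ) + (q : ℤ) * (2 * (m : ℤ) - 1) = k) ∧ ∃ σ, z = typeVec 𝒜 b τ σ} with hN
    set y := (c.map fun p => cls 𝒜 p.1 p.2.2).prod with hy
    have hmap : pathSpan 𝒜 e ≤ N.comap (LinearMap.mulLeft K y) := by
      rw [pathSpan, Submodule.span_le]
      rintro _ ⟨W, hW, hlen, -, rfl⟩
      change y * _ ∈ N
      obtain ⟨W', h1, h2, h3, h4⟩ := exists_signEq_mono_homogeneous 𝒜 hcomm c hc hW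
      refine h4.mem ?_
      have hW' : IsWordPartition (W'.map Prod.fst) := hW.perm h1.symm
      refine Submodule.span_le.mpr ?_ (mono_mem_span_of_homogeneous 𝒜 b hdeg W' hW'.2 h2)
      rintro _ ⟨V, hV, hVd, rfl⟩
      have hVW : IsWordPartition (V.map Prod.fst) := hV ▸ hW'
      obtain ⟨τ, σ, hτ, hs⟩ := exists_signEq_typeVec 𝒜 hcomm hdeg hVW
      refine hs.mem (Submodule.subset_span ⟨τ, ⟨?_, ?_⟩, σ, rfl⟩)
      · have e1 := hτ.length_eq
        have e2 := τ.lengthDeg_add_length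
        have e3 := congrArg List.length hV
        have e4 := h1.length_eq
        simp only [List.length_map] at e1 e3 e4
        omega
      · have e1 : τ.markDeg deg = (c.map fun p => p.2.1).sum := by
          rw [BambooType.markDeg, (hτ.map _).sum_eq, List.map_map, ← h3, ← hVd]
          rfl
        rw [e1]
        exact hk
    exact hmap (prod_G_mem_pathSpan 𝒜 e)
  · rw [Submodule.span_le]
    rintro _ ⟨τ, ⟨hq, hk⟩, σ, rfl⟩
    obtain ⟨c, e, -, he, hc, hs⟩ := typeVec_signEq_forest 𝒜 hcomm hdeg τ σ
    refine hs.mem (Submodule.subset_span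
      ⟨c.map fun p => (p.1, deg p.2, b p.2), e, ?_, he.trans hq, ?_, ?_⟩)
    · intro p hp
      obtain ⟨q, _, rfl⟩ := List.mem_map.mp hp
      exact hdeg _
    · rw [List.map_map]
      have : (c.map ((fun p : Fin n × ℕ × H => p.2.1) ∘ fun p => (p.1, deg p.2, b p.2))).sum =
          τ.markDeg deg := hc
      rw [this]
      exact hk
    · rw [List.map_map]
      rfl

theorem span_iUnion_bigradedSet (hdeg : ∀ i, b i ∈ 𝒜 (deg i))
    (hcomm : ∀ (d e : ℕ) (x y : H), x ∈ 𝒜 d → y ∈ 𝒜 e → x * y = (-1 : K) ^ (d * e) • (y * x)) :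
    Submodule.span K {z : Model 𝒜 n | ∃ q k, z ∈ bigradedSet 𝒜 0 n q k} = ⊤ := by
  set N := Submodule.span K {z : Model 𝒜 n | ∃ q k, z ∈ bigradedSet 𝒜 0 n q k} with hN
  have hcls : ∀ i d, ∀ x ∈ 𝒜 d, ∀ z ∈ N, cls 𝒜 i x * z ∈ N := by
    intro i d x hx z hz
    have : N ≤ N.comap (LinearMap.mulLeft K (cls 𝒜 i x)) := by
      conv_lhs => rw [hN]
      rw [Submodule.span_le]
      rintro _ ⟨q, k, c, e, h1, h2, h3, rfl⟩
      refine Submodule.subset_span ⟨q, _, (i, d, x) :: c, e, ?_, h2, rfl, ?_⟩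
      · intro p hp
        rcases List.mem_cons.mp hp with rfl | hp
        · exact hx
        · exact h1 p hp
      · rw [List.map_cons, List.prod_cons, mul_assoc]
        rfl
    exact this hz
  have hG : ∀ i j, ∀ z ∈ N, G 𝒜 i j * z ∈ N := by
    intro i j z hz
    have : N ≤ N.comap (LinearMap.mulLeft K (G 𝒜 i j)) := by
      conv_lhs => rw [hN]
      rw [Submodule.span_le]
      rintro _ ⟨q, k, c, e, h1, h2, h3, rfl⟩
      change G 𝒜 i j * _ ∈ N
      have hs := signEq_prod_comm_of_homGens 𝒜 hcomm (l := [G 𝒜 i j])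
        (l' := c.map fun p => cls 𝒜 p.1 p.2.2) (by simpa using G_mem_homGens 𝒜 i j) (by
          intro a ha
          obtain ⟨p, hp, rfl⟩ := List.mem_map.mp ha
          exact cls_mem_homGens 𝒜 _ (h1 p hp))
      rw [List.prod_singleton] at hs
      rw [← mul_assoc]
      refine (hs.mul (SignEq.refl _)).mem (Submodule.subset_span
        ⟨q + 1, _, c, (i, j) :: e, h1, by simp [h2], rfl, ?_⟩)
      rw [List.map_cons, List.prod_cons, mul_assoc]
    exact this hz
  have hone : (1 : Model 𝒜 n) ∈ N :=
    Submodule.subset_span ⟨0, _, [], [], by simp, rfl, rfl, by simp⟩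
  have hmul : ∀ (a : FreeAlgebra K (Gen n H)), ∀ z ∈ N,
      RingQuot.mkAlgHom K (Rel 𝒜 n) a * z ∈ N := by
    intro a
    induction a using FreeAlgebra.induction with
    | grade0 r =>
      intro z hz
      rw [AlgHom.commutes, ← Algebra.smul_def]
      exact N.smul_mem r hz
    | grade1 g =>
      intro z hz
      cases g with
      | cls i x =>
        change cls 𝒜 i x * z ∈ N
        have hx : cls 𝒜 i x = ∑ h, b.repr x h • cls 𝒜 i (b h) :=
          bamboo_eq_sum 𝒜 b (w := [i]) (by simp) x
        rw [hx, Finset.sum_mul]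
        refine N.sum_mem fun h _ => ?_
        rw [smul_mul_assoc]
        exact N.smul_mem _ (hcls i _ _ (hdeg h) z hz)
      | edge i j => exact hG i j z hz
    | mul x y hx hy =>
      intro z hz
      rw [map_mul, mul_assoc]
      exact hx _ (hy z hz)
    | add x y hx hy =>
      intro z hz
      rw [map_add, add_mul]
      exact N.add_mem (hx z hz) (hy z hz)
  rw [eq_top_iff]
  intro z _
  obtain ⟨a, rfl⟩ := RingQuot.mkAlgHom_surjective K (Rel 𝒜 n) z
  have := hmul a 1 hone
  rwa [mul_one] at this

theorem span_typeVec (hdeg : ∀ i, b i ∈ 𝒜 (deg i))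
    (hcomm : ∀ (d e : ℕ) (x y : H), x ∈ 𝒜 d → y ∈ 𝒜 e → x * y = (-1 : K) ^ (d * e) • (y * x)) :
    Submodule.span K {z : Model 𝒜 n | ∃ (τ : BambooType n ι) (σ : _), z = typeVec 𝒜 b τ σ} = ⊤ := by
  rw [eq_top_iff, ← span_iUnion_bigradedSet 𝒜 b hdeg hcomm, Submodule.span_le]
  rintro z ⟨q, k, hz⟩
  have h := Submodule.subset_span (R := K) hz
  rw [span_bigradedSet 𝒜 b hdeg hcomm] at h
  refine Submodule.span_mono ?_ h
  rintro _ ⟨τ, -, σ, rfl⟩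
  exact ⟨τ, σ, rfl⟩

end Bigraded
end Kriz

namespace Kriz

/-! ### Supercommuting copies of an algebra inside its tensor power -/

section JordanWigner

open scoped TensorProduct

variable {K : Type*} [Field K] {A : Type*} [Ring A] [Algebra K A] {n : ℕ} (S : A)

/-- The local factors of the operator `a` of degree `d` on the site `i`: the parity operator `S`
is inserted on the sites before `i`. -/
def siteFactor (i : Fin n) (d : ℕ) (a : A) : Fin n → A :=
  Function.update (fun j => if j < i then S ^ d else 1) i a

/-- The operator `a` of degree `d` on the site `i`, in the manner of Jordan and Wigner. -/
noncomputable def siteOp (K : Type*) [Field K] {A : Type*} [Ring A] [Algebra K A] {n : ℕ} (S : A)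
    (i : Fin n) (d : ℕ) : A →ₗ[K] ⨂[K] _ : Fin n, A :=
  (PiTensorProduct.tprod K).toLinearMap (fun j => if j < i then S ^ d else 1) i

theorem siteOp_apply (i : Fin n) (d : ℕ) (a : A) :
    siteOp K S i d a = PiTensorProduct.tprod K (siteFactor S i d a) := rfl

theorem siteFactor_of_lt {i j : Fin n} (d : ℕ) (a : A) (h : j < i) :
    siteFactor S i d a j = S ^ d := by
  rw [siteFactor, Function.update_of_ne h.ne, if_pos h]

theorem siteFactor_self (i : Fin n) (d : ℕ) (a : A) : siteFactor S i d a i = a :=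
  Function.update_self _ _ _

theorem siteFactor_of_gt {i j : Fin n} (d : ℕ) (a : A) (h : i < j) : siteFactor S i d a j = 1 := by
  rw [siteFactor, Function.update_of_ne h.ne', if_neg h.asymm]

theorem siteOp_mul_self (i : Fin n) (d e : ℕ) (a a' : A) :
    siteOp K S i d a * siteOp K S i e a' = siteOp K S i (d + e) (a * a') := by
  simp only [siteOp_apply, PiTensorProduct.tprod_mul_tprod]
  congr 1
  funext j
  rw [Pi.mul_apply]
  rcases lt_trichotomy j i with h | rfl | h
  · simp only [siteFactor_of_lt S _ _ h, pow_add]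
  · simp only [siteFactor_self]
  · simp only [siteFactor_of_gt S _ _ h, mul_one]

theorem siteOp_one (i : Fin n) : siteOp K S i 0 1 = 1 := by
  rw [siteOp_apply, PiTensorProduct.one_def]
  congr 1
  funext j
  rcases lt_trichotomy j i with h | rfl | h
  · simp only [siteFactor_of_lt S _ _ h, pow_zero, Pi.one_apply]
  · simp only [siteFactor_self, Pi.one_apply]
  · simp only [siteFactor_of_gt S _ _ h, Pi.one_apply]

variable {S}

theorem pow_mul_of_parity {d : ℕ} {a : A} (ha : S * a = (-1 : K) ^ d • (a * S)) (e : ℕ) :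
    S ^ e * a = (-1 : K) ^ (d * e) • (a * S ^ e) := by
  induction e with
  | zero => simp
  | succ e ih =>
    rw [pow_succ', mul_assoc, ih, mul_smul_comm, ← mul_assoc, ha, smul_mul_assoc, smul_smul,
      mul_assoc, mul_add, pow_add, mul_one]

theorem siteOp_mul_of_lt {i j : Fin n} (hij : i < j) {d e : ℕ} {a : A} (b : A)
    (ha : S * a = (-1 : K) ^ d • (a * S)) :
    siteOp K S j e b * siteOp K S i d a =
      (-1 : K) ^ (d * e) • (siteOp K S i d a * siteOp K S j e b) := by
  simp only [siteOp_apply, PiTensorProduct.tprod_mul_tprod]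
  have h : siteFactor S j e b * siteFactor S i d a =
      Function.update (siteFactor S i d a * siteFactor S j e b) i
        ((-1 : K) ^ (d * e) • (siteFactor S i d a * siteFactor S j e b) i) := by
    funext k
    by_cases hk : k = i
    · subst hk
      rw [Function.update_self, Pi.mul_apply, Pi.mul_apply, siteFactor_self,
        siteFactor_of_lt S _ _ hij, pow_mul_of_parity ha]
    · rw [Function.update_of_ne hk, Pi.mul_apply, Pi.mul_apply]
      rcases lt_or_gt_of_ne hk with h | h
      · rw [siteFactor_of_lt S _ _ h, siteFactor_of_lt S _ _ (h.trans hij), ← pow_add, ← pow_add,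
          add_comm]
      · rw [siteFactor_of_gt S _ _ h, one_mul, mul_one]
  rw [h, MultilinearMap.map_update_smul, Function.update_eq_self]

/-- Operators on different sites supercommute. -/
theorem siteOp_mul_of_ne {i j : Fin n} (hij : i ≠ j) {d e : ℕ} {a b : A}
    (ha : S * a = (-1 : K) ^ d • (a * S)) (hb : S * b = (-1 : K) ^ e • (b * S)) :
    siteOp K S i d a * siteOp K S j e b =
      (-1 : K) ^ (d * e) • (siteOp K S j e b * siteOp K S i d a) := by
  rcases lt_or_gt_of_ne hij with h | h
  · rw [siteOp_mul_of_lt h b ha, smul_smul, ← pow_add, Even.neg_one_pow ⟨_, rfl⟩, one_smul]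
  · rw [siteOp_mul_of_lt h a hb, mul_comm e d]

/-- A product of operators on sites is a pure tensor. -/
theorem prod_siteOp (l : List (Fin n × ℕ × A)) :
    (l.map fun p => siteOp K S p.1 p.2.1 p.2.2).prod =
      PiTensorProduct.tprod K fun j => (l.map fun p => siteFactor S p.1 p.2.1 p.2.2 j).prod := by
  induction l with
  | nil => rfl
  | cons p l ih =>
    rw [List.map_cons, List.prod_cons, ih, siteOp_apply, PiTensorProduct.tprod_mul_tprod]
    rfl

/-- The factor of a product of operators on the site `j` is, up to sign and powers of `S`, the
product of the operators on `j`. -/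
theorem prod_siteFactor (l : List (Fin n × ℕ × A))
    (hl : ∀ p ∈ l, S * p.2.2 = (-1 : K) ^ p.2.1 • (p.2.2 * S)) (j : Fin n) :
    ∃ e, SignEq (l.map fun p => siteFactor S p.1 p.2.1 p.2.2 j).prod
      (((l.filter fun p => p.1 = j).map fun p => p.2.2).prod * S ^ e) := by
  induction l with
  | nil => exact ⟨0, by simpa using SignEq.refl (1 : A)⟩
  | cons p l ih =>
    obtain ⟨e, he⟩ := ih fun q hq => hl q (List.mem_cons_of_mem _ hq)
    rw [List.map_cons, List.prod_cons]
    rcases lt_trichotomy j p.1 with h | h | h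
    · refine ⟨p.2.1 + e, ?_⟩
      rw [siteFactor_of_lt S _ _ h, List.filter_cons_of_neg (by simpa using h.ne')]
      refine ((SignEq.refl _).mul he).trans ?_
      rw [pow_add, ← mul_assoc, ← mul_assoc]
      refine SignEq.mul ?_ (SignEq.refl _)
      have key : ∀ m : List A, (∀ a ∈ m, SignEq (S ^ p.2.1 * a) (a * S ^ p.2.1)) →
          SignEq (S ^ p.2.1 * m.prod) (m.prod * S ^ p.2.1) := by
        intro m
        induction m with
        | nil => intro _; simpa using SignEq.refl _
        | cons a m ihm =>
          intro hm
          rw [List.prod_cons, ← mul_assoc]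
          refine ((hm a (by simp)).mul (SignEq.refl _)).trans ?_
          rw [mul_assoc, mul_assoc]
          exact (SignEq.refl _).mul (ihm fun b hb => hm b (List.mem_cons_of_mem _ hb))
      refine key _ fun a ha => ?_
      obtain ⟨q, hq, rfl⟩ := List.mem_map.mp ha
      exact SignEq.of_smul (pow_mul_of_parity
        (hl q (List.mem_cons_of_mem _ (List.mem_filter.mp hq).1)) _)
    · subst h
      refine ⟨e, ?_⟩
      rw [siteFactor_self, List.filter_cons_of_pos (by simp), List.map_cons, List.prod_cons,
        mul_assoc]
      exact (SignEq.refl _).mul he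
    · refine ⟨e, ?_⟩
      rw [siteFactor_of_gt S _ _ h, List.filter_cons_of_neg (by simpa using h.ne), one_mul]
      exact he

/-- The product of linear functionals on the sites. -/
noncomputable def siteFunctional (φ : Fin n → A →ₗ[K] K) : (⨂[K] _ : Fin n, A) →ₗ[K] K :=
  PiTensorProduct.lift ((MultilinearMap.mkPiAlgebra K (Fin n) K).compLinearMap φ)

theorem siteFunctional_tprod (φ : Fin n → A →ₗ[K] K) (f : Fin n → A) :
    siteFunctional φ (PiTensorProduct.tprod K f) = ∏ j, φ j (f j) := by
  rw [siteFunctional, PiTensorProduct.lift.tprod, MultilinearMap.compLinearMap_apply,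
    MultilinearMap.mkPiAlgebra_apply]

theorem siteFunctional_prod_ne_zero_iff (φ : Fin n → A →ₗ[K] K)
    (hφ : ∀ j a, φ j (a * S) = φ j a) (l : List (Fin n × ℕ × A))
    (hl : ∀ p ∈ l, S * p.2.2 = (-1 : K) ^ p.2.1 • (p.2.2 * S)) :
    siteFunctional φ (l.map fun p => siteOp K S p.1 p.2.1 p.2.2).prod ≠ 0 ↔
      ∀ j, φ j ((l.filter fun p => p.1 = j).map fun p => p.2.2).prod ≠ 0 := by
  have hpow : ∀ j a e, φ j (a * S ^ e) = φ j a := by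
    intro j a e
    induction e with
    | zero => simp
    | succ e ih => rw [pow_succ, ← mul_assoc, hφ, ih]
  rw [prod_siteOp, siteFunctional_tprod, Finset.prod_ne_zero_iff]
  refine ⟨fun h j => ?_, fun h j _ => ?_⟩
  · obtain ⟨e, s, hs⟩ := prod_siteFactor l hl j
    have := h j (Finset.mem_univ j)
    rw [hs, map_zsmul, hpow] at this
    exact fun h0 => this (by rw [h0, smul_zero])
  · obtain ⟨e, s, hs⟩ := prod_siteFactor l hl j
    rw [hs, map_zsmul, hpow]
    exact (IsUnit.smul_eq_zero (Units.isUnit s)).not.mpr (h j)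

end JordanWigner
end Kriz

namespace Kriz

/-! ### The algebra on a site -/

section SiteAlgebra

variable {K : Type*} [Field K] {H : Type*} [Ring H] [Algebra K H] {𝒜 : ℕ → Submodule K H}
  [GradedAlgebra 𝒜] {n : ℕ} {ι : Type*} [Fintype ι] [LinearOrder ι] (b : Module.Basis ι K H)
  (deg : ι → ℕ)

/-- The parity operator `x ↦ (-1)^{deg x} x`. -/
noncomputable def parityMap : H →ₗ[K] H := b.constr K fun h => (-1 : K) ^ deg h • b h

theorem parityMap_basis (h : ι) : parityMap b deg (b h) = (-1 : K) ^ deg h • b h := by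
  rw [parityMap, Module.Basis.constr_basis]

variable {deg}

theorem parityMap_of_mem (hdeg : ∀ i, b i ∈ 𝒜 (deg i)) {d : ℕ} {x : H} (hx : x ∈ 𝒜 d) :
    parityMap b deg x = (-1 : K) ^ d • x := by
  conv_lhs => rw [← b.sum_repr x]
  conv_rhs => rw [← b.sum_repr x]
  rw [map_sum, Finset.smul_sum]
  refine Finset.sum_congr rfl fun h _ => ?_
  rw [map_smul, parityMap_basis, smul_comm]
  by_cases hd : deg h = d
  · rw [hd]
  · rw [repr_eq_zero_of_mem 𝒜 b hdeg hx hd, zero_smul, smul_zero, smul_zero]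

theorem parityMap_mul (hdeg : ∀ i, b i ∈ 𝒜 (deg i)) {d : ℕ} {x : H} (hx : x ∈ 𝒜 d) (y : H) :
    parityMap b deg (x * y) = (-1 : K) ^ d • (x * parityMap b deg y) := by
  have h : parityMap b deg ∘ₗ LinearMap.mulLeft K x =
      (-1 : K) ^ d • (LinearMap.mulLeft K x ∘ₗ parityMap b deg) := by
    refine b.ext fun h => ?_
    have hm : x * b h ∈ 𝒜 (d + deg h) := SetLike.mul_mem_graded hx (hdeg h)
    simp only [LinearMap.comp_apply, LinearMap.smul_apply, LinearMap.mulLeft_apply]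
    rw [parityMap_of_mem b hdeg hm, parityMap_basis, mul_smul_comm, smul_smul, pow_add]
  exact LinearMap.congr_fun h y

variable (deg)

/-- The parity operator on `H × H`, the second copy of `H` being shifted by one. -/
noncomputable def siteParity : Module.End K (H × H) :=
  LinearMap.prodMap (parityMap b deg) (-parityMap b deg)

/-- Multiplication by an element of `H`. -/
noncomputable def siteMul (K : Type*) [Field K] {H : Type*} [Ring H] [Algebra K H] :
    H →ₐ[K] Module.End K (H × H) := Algebra.lsmul K K (H × H)

/-- The odd operator which maps the first copy of `H` identically onto the second one. -/
noncomputable def siteEps (K : Type*) [Field K] (H : Type*) [Ring H] [Algebra K H] :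
    Module.End K (H × H) := LinearMap.inr K H H ∘ₗ LinearMap.fst K H H

theorem siteMul_apply (x : H) (p : H × H) : siteMul K x p = (x * p.1, x * p.2) := rfl

theorem siteParity_apply (p : H × H) :
    siteParity b deg p = (parityMap b deg p.1, -parityMap b deg p.2) := rfl

theorem siteEps_apply (p : H × H) : siteEps K H p = (0, p.1) := rfl

theorem siteEps_mul_siteEps : siteEps K H * siteEps K H = 0 := by
  ext p <;> simp [siteEps_apply]

theorem siteParity_mul_siteEps :
    siteParity b deg * siteEps K H = (-1 : K) ^ 1 • (siteEps K H * siteParity b deg) := by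
  refine LinearMap.ext fun p => ?_
  rw [LinearMap.smul_apply, Module.End.mul_apply, Module.End.mul_apply, siteEps_apply,
    siteParity_apply, siteEps_apply, siteParity_apply]
  simp

variable {deg}

theorem siteParity_mul_siteMul (hdeg : ∀ i, b i ∈ 𝒜 (deg i)) {d : ℕ} {x : H} (hx : x ∈ 𝒜 d) :
    siteParity b deg * siteMul K x = (-1 : K) ^ d • (siteMul K x * siteParity b deg) := by
  refine LinearMap.ext fun p => ?_
  rw [LinearMap.smul_apply, Module.End.mul_apply, Module.End.mul_apply, siteMul_apply,
    siteParity_apply, siteParity_apply, siteMul_apply, parityMap_mul b hdeg hx,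
    parityMap_mul b hdeg hx]
  simp

end SiteAlgebra

/-! ### Representations of the Križ algebra -/

/-- A decomposition of `{1, …, n}` into blocks, with an injective position function, such that
the last element `rep i` of the block of `i` depends only on the block. -/
structure BlockOrder (n : ℕ) (κ : Type*) where
  blk : Fin n → κ
  rep : Fin n → Fin n
  pos : Fin n → Fin n
  blk_rep : ∀ i, blk (rep i) = blk i
  rep_eq : ∀ i j, blk i = blk j → rep i = rep j
  pos_injective : Function.Injective pos
  pos_le : ∀ i, pos i ≤ pos (rep i)

namespace BlockOrder

variable {n : ℕ} {κ : Type*} (o : BlockOrder n κ)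

/-- The endpoint of an edge with smaller position. -/
def site (i j : Fin n) : Fin n := if o.pos i < o.pos j then i else j

theorem site_comm (i j : Fin n) : o.site j i = o.site i j := by
  rw [site, site]
  rcases lt_trichotomy (o.pos i) (o.pos j) with h | h | h
  · rw [if_neg h.asymm, if_pos h]
  · rw [o.pos_injective h]
  · rw [if_pos h, if_neg h.asymm]

theorem site_of_lt {i j : Fin n} (h : o.pos i < o.pos j) : o.site i j = i := if_pos h

theorem site_ne_rep {i j : Fin n} (hb : o.blk i = o.blk j) (hij : i ≠ j) (k : Fin n) :
    o.site i j ≠ o.rep k := by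
  have key : ∀ i j, o.blk i = o.blk j → o.pos i < o.pos j → i ≠ o.rep k := by
    rintro i j hb hlt rfl
    have h1 := o.pos_le j
    rw [← o.rep_eq _ _ hb, o.rep_eq _ _ (o.blk_rep k)] at h1
    exact absurd hlt (not_lt.mpr h1)
  rcases lt_or_gt_of_ne (o.pos_injective.ne hij) with h | h
  · rw [o.site_of_lt h]
    exact key i j hb h
  · rw [← o.site_comm, o.site_of_lt h]
    exact key j i hb.symm h

section EdgeOp

variable [DecidableEq κ] {R : Type*} [Ring R] (X : Fin n → R)

/-- The operator of the generator `G_{ij}`, which lives on the earlier one of the sites `i`, `j`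
if they belong to the same block, and vanishes otherwise. -/
def edgeOp (i j : Fin n) : R := if o.blk i = o.blk j ∧ i ≠ j then X (o.site i j) else 0

variable {X}

theorem edgeOp_mul_edgeOp (hX : ∀ s t, X s * X t = -(X t * X s)) (i j k l : Fin n) :
    o.edgeOp X i j * o.edgeOp X k l = -(o.edgeOp X k l * o.edgeOp X i j) := by
  rw [edgeOp, edgeOp]
  split_ifs
  · exact hX _ _
  all_goals simp

theorem edgeOp_sq (hX0 : ∀ s, X s * X s = 0) (i j : Fin n) :
    o.edgeOp X i j * o.edgeOp X i j = 0 := by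
  rw [edgeOp]
  split_ifs with h
  · exact hX0 _
  · simp

theorem edgeOp_comm (i j : Fin n) : o.edgeOp X j i = o.edgeOp X i j := by
  have h : (o.blk j = o.blk i ∧ j ≠ i) ↔ (o.blk i = o.blk j ∧ i ≠ j) := by
    rw [eq_comm, ne_comm]
  simp only [edgeOp, o.site_comm i j, h]

theorem edgeOp_arnold (hX : ∀ s t, X s * X t = -(X t * X s)) (hX0 : ∀ s, X s * X s = 0)
    {i j k : Fin n} (hij : i ≠ j) (hjk : j ≠ k) (hik : i ≠ k) :
    o.edgeOp X i k * o.edgeOp X j k =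
      o.edgeOp X i j * o.edgeOp X j k - o.edgeOp X i j * o.edgeOp X i k := by
  by_cases h1 : o.blk i = o.blk j
  · by_cases h2 : o.blk j = o.blk k
    · have h3 := h1.trans h2
      rw [edgeOp, edgeOp, edgeOp, if_pos ⟨h3, hik⟩, if_pos ⟨h2, hjk⟩, if_pos ⟨h1, hij⟩]
      rw [site, site, site]
      have p1 := o.pos_injective.ne hij
      have p2 := o.pos_injective.ne hjk
      have p3 := o.pos_injective.ne hik
      by_cases q1 : o.pos i < o.pos j <;> by_cases q2 : o.pos j < o.pos k <;>
        by_cases q3 : o.pos i < o.pos k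
      · simp only [q1, q2, q3, if_true, hX0, sub_zero]
      · exact absurd (q1.trans q2) q3
      · simp only [q1, q2, q3, if_true, if_false, hX0, sub_zero]
      · simp only [q1, q2, q3, if_true, if_false, hX0, sub_self]
      · simp only [q1, q2, q3, if_true, if_false, hX0, zero_sub]
        exact hX _ _
      · simp only [q1, q2, q3, if_true, if_false, hX0, zero_sub]
        exact hX _ _
      · exact absurd ((lt_of_le_of_ne (not_lt.mp q1) p1.symm).trans q3) q2
      · simp only [q1, q2, q3, if_false, hX0, sub_self]
    · have h3 : ¬ o.blk i = o.blk k := fun h => h2 (h1.symm.trans h)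
      simp [edgeOp, h2, h3]
  · by_cases h2 : o.blk j = o.blk k
    · have h3 : ¬ o.blk i = o.blk k := fun h => h1 (h.trans h2.symm)
      simp [edgeOp, h1, h3]
    · simp [edgeOp, h1, h2]

end EdgeOp

section Hom

variable {K : Type*} [Field K] {H : Type*} [Ring H] [Algebra K H] {𝒜 : ℕ → Submodule K H}
  [DecidableEq κ] {R : Type*} [Ring R] [Algebra K R] (X : Fin n → R) (L : Fin n → H →ₗ[K] R)

/-- The operators of the generators: the class `p_i^*(x)` acts on the last site of its block. -/
def genOp : Gen n H → R
  | .cls i x => L (o.rep i) x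
  | .edge i j => o.edgeOp X i j

variable {X L}

theorem lift_genOp_rel (hX : ∀ s t, X s * X t = -(X t * X s)) (hX0 : ∀ s, X s * X s = 0)
    (hL1 : ∀ s, L s 1 = 1) (hLm : ∀ s x y, L s (x * y) = L s x * L s y)
    (hLL : ∀ s t d e, ∀ x ∈ 𝒜 d, ∀ y ∈ 𝒜 e, L s x * L t y = (-1 : K) ^ (d * e) • (L t y * L s x))
    (hXL : ∀ s t, s ≠ t → ∀ d, ∀ x ∈ 𝒜 d, X s * L t x = (-1 : K) ^ d • (L t x * X s))
    ⦃x y : FreeAlgebra K (Gen n H)⦄ (h : Rel 𝒜 n x y) :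
    FreeAlgebra.lift K (o.genOp X L) x = FreeAlgebra.lift K (o.genOp X L) y := by
  have hc : ∀ (i : Fin n) (x : H),
      FreeAlgebra.lift K (o.genOp X L) (fcls K i x) = L (o.rep i) x := by
    intro i x; simp [fcls, genOp]
  have he : ∀ i j : Fin n,
      FreeAlgebra.lift K (o.genOp X L) (fedge K H i j) = o.edgeOp X i j := by
    intro i j; simp [fedge, genOp]
  cases h with
  | cls_add i x y => simp only [map_add, hc]
  | cls_smul i a x => simp only [map_smul, hc]
  | cls_one i => simp only [map_one, hc, hL1]
  | cls_mul i x y => simp only [map_mul, hc, hLm]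
  | cls_comm i j hij d e x y hx hy =>
    simp only [map_mul, map_smul, hc]
    exact hLL _ _ d e x hx y hy
  | edge_diag i => simp [he, edgeOp]
  | edge_sq i j => simp only [map_mul, map_zero, he]; exact o.edgeOp_sq hX0 i j
  | edge_anticomm i j k l => simp only [map_mul, map_neg, he]; exact o.edgeOp_mul_edgeOp hX _ _ _ _
  | edge_cls i j k d x hx =>
    simp only [map_mul, map_smul, hc, he]
    rw [edgeOp]
    split_ifs with h
    · exact hXL _ _ (o.site_ne_rep h.1 h.2 k) d x hx
    · simp
  | edge_symm i j => simp only [he]; exact o.edgeOp_comm i j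
  | move i j hij x =>
    simp only [map_mul, hc, he]
    by_cases h : o.blk i = o.blk j
    · rw [o.rep_eq i j h]
    · simp [edgeOp, h]
  | arnold i j k hij hjk =>
    simp only [map_mul, map_sub, he]
    exact o.edgeOp_arnold hX hX0 hij.ne hjk.ne (hij.trans hjk).ne

/-- A family of operators on the sites with the appropriate commutation rules defines a
homomorphism on the Križ algebra. -/
theorem exists_hom (hX : ∀ s t, X s * X t = -(X t * X s)) (hX0 : ∀ s, X s * X s = 0)
    (hL1 : ∀ s, L s 1 = 1) (hLm : ∀ s x y, L s (x * y) = L s x * L s y)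
    (hLL : ∀ s t d e, ∀ x ∈ 𝒜 d, ∀ y ∈ 𝒜 e, L s x * L t y = (-1 : K) ^ (d * e) • (L t y * L s x))
    (hXL : ∀ s t, s ≠ t → ∀ d, ∀ x ∈ 𝒜 d, X s * L t x = (-1 : K) ^ d • (L t x * X s)) :
    ∃ Φ : Model 𝒜 n →ₐ[K] R, (∀ i x, Φ (cls 𝒜 i x) = L (o.rep i) x) ∧
      ∀ i j, Φ (G 𝒜 i j) = o.edgeOp X i j := by
  refine ⟨RingQuot.liftAlgHom K ⟨FreeAlgebra.lift K (o.genOp X L),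
    o.lift_genOp_rel hX hX0 hL1 hLm hLL hXL⟩, fun i x => ?_, fun i j => ?_⟩
  · rw [cls, RingQuot.liftAlgHom_mkAlgHom_apply]
    simp [fcls, genOp]
  · rw [G, RingQuot.liftAlgHom_mkAlgHom_apply]
    simp [fedge, genOp]

end Hom

end BlockOrder

section SiteHom

open scoped TensorProduct

variable {K : Type*} [Field K] {H : Type*} [Ring H] [Algebra K H] {𝒜 : ℕ → Submodule K H}
  [GradedAlgebra 𝒜] {n : ℕ} {ι : Type*} [Fintype ι] [LinearOrder ι] (b : Module.Basis ι K H)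
  {deg : ι → ℕ}

theorem siteOp_eps_anticomm (s t : Fin n) :
    siteOp K (siteParity b deg) s 1 (siteEps K H) * siteOp K (siteParity b deg) t 1 (siteEps K H) =
      -(siteOp K (siteParity b deg) t 1 (siteEps K H) *
        siteOp K (siteParity b deg) s 1 (siteEps K H)) := by
  by_cases h : s = t
  · rw [h, siteOp_mul_self, siteEps_mul_siteEps, map_zero]
    exact neg_zero.symm
  · rw [siteOp_mul_of_ne h (siteParity_mul_siteEps b deg) (siteParity_mul_siteEps b deg), one_mul,
      pow_one]
    exact neg_one_smul K _

/-- The homomorphism from the Križ algebra to the operators on the sites. -/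
theorem exists_siteHom
    (hcomm : ∀ (d e : ℕ) (x y : H), x ∈ 𝒜 d → y ∈ 𝒜 e → x * y = (-1 : K) ^ (d * e) • (y * x))
    (hdeg : ∀ i, b i ∈ 𝒜 (deg i)) {κ : Type*} [DecidableEq κ] (o : BlockOrder n κ) :
    ∃ Φ : Model 𝒜 n →ₐ[K] ⨂[K] _ : Fin n, Module.End K (H × H),
      (∀ i h, Φ (cls 𝒜 i (b h)) =
        siteOp K (siteParity b deg) (o.rep i) (deg h) (siteMul K (b h))) ∧
      ∀ i j, Φ (G 𝒜 i j) =
        o.edgeOp (fun s => siteOp K (siteParity b deg) s 1 (siteEps K H)) i j := by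
  let L : Fin n → H →ₗ[K] ⨂[K] _ : Fin n, Module.End K (H × H) := fun s =>
    b.constr K fun h => siteOp K (siteParity b deg) s (deg h) (siteMul K (b h))
  have hLb : ∀ s h, L s (b h) = siteOp K (siteParity b deg) s (deg h) (siteMul K (b h)) :=
    fun s h => b.constr_basis K _ h
  have hL : ∀ s d, ∀ x ∈ 𝒜 d, L s x = siteOp K (siteParity b deg) s d (siteMul K x) := by
    intro s d x hx
    conv_lhs => rw [← b.sum_repr x]
    conv_rhs => rw [← b.sum_repr x]
    rw [map_sum, map_sum, map_sum]
    refine Finset.sum_congr rfl fun h _ => ?_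
    rw [map_smul, hLb, map_smul, map_smul]
    by_cases hd : deg h = d
    · rw [hd]
    · rw [repr_eq_zero_of_mem 𝒜 b hdeg hx hd, zero_smul, zero_smul]
  obtain ⟨Φ, h1, h2⟩ := o.exists_hom (𝒜 := 𝒜) (L := L)
    (X := fun s => siteOp K (siteParity b deg) s 1 (siteEps K H))
    (siteOp_eps_anticomm b)
    (fun s => by rw [siteOp_mul_self, siteEps_mul_siteEps, map_zero])
    (fun s => by rw [hL s 0 1 SetLike.GradedOne.one_mem, map_one, siteOp_one])
    (fun s x y => by
      have key : ∀ h h', L s (b h * b h') = L s (b h) * L s (b h') := by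
        intro h h'
        rw [hLb, hLb, hL s _ _ (SetLike.mul_mem_graded (hdeg h) (hdeg h')), siteOp_mul_self,
          map_mul]
      rw [← b.sum_repr x, ← b.sum_repr y, Finset.sum_mul_sum, map_sum, map_sum, map_sum,
        Finset.sum_mul_sum]
      refine Finset.sum_congr rfl fun h _ => ?_
      rw [map_sum]
      refine Finset.sum_congr rfl fun h' _ => ?_
      rw [smul_mul_smul_comm, map_smul, key, map_smul, map_smul, smul_mul_smul_comm])
    (fun s t d e x hx y hy => by
      rw [hL s d x hx, hL t e y hy]
      by_cases h : s = t
      · rw [h, siteOp_mul_self, siteOp_mul_self, ← map_mul, ← map_mul, hcomm d e x y hx hy,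
          map_smul, map_smul, add_comm]
      · exact siteOp_mul_of_ne h (siteParity_mul_siteMul b hdeg hx)
          (siteParity_mul_siteMul b hdeg hy))
    (fun s t h d x hx => by
      rw [hL t d x hx, siteOp_mul_of_ne h (siteParity_mul_siteEps b deg)
        (siteParity_mul_siteMul b hdeg hx), one_mul])
  exact ⟨Φ, fun i h => (h1 i (b h)).trans (hLb _ h), h2⟩

end SiteHom
end Kriz

namespace Kriz

/-! ### Functionals which detect monomials -/

section Detect

open scoped TensorProduct

variable {K : Type*} [Field K] {H : Type*} [Ring H] [Algebra K H] {𝒜 : ℕ → Submodule K H}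
  [GradedAlgebra 𝒜] {n : ℕ} {ι : Type*} [Fintype ι] [LinearOrder ι] (b : Module.Basis ι K H)
  {deg : ι → ℕ}

theorem prod_map_siteMul (l : List H) (x : H) :
    (l.map fun y => siteMul K y).prod (x, (0 : H)) = (l.prod * x, 0) := by
  rw [← map_list_prod, siteMul_apply, mul_zero]

theorem siteEps_pow_apply (k : ℕ) (x : H) :
    ((siteEps K H) ^ k) (x, (0 : H)) = if k = 0 then (x, 0) else if k = 1 then (0, x) else 0 := by
  match k with
  | 0 => rfl
  | 1 => rw [pow_one]; rfl
  | k + 2 =>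
    rw [pow_add, pow_two, siteEps_mul_siteEps, mul_zero]
    simp

/-- For blocks with an order of their elements and a mark for each block, the functional `D` detects
the monomials such that each edge joins two elements of a block, each element of a block except
the last one is the earlier endpoint of exactly one edge, and the product of the marks on a block
involves the given mark. -/
def Detects (𝒜 : ℕ → Submodule K H) {κ : Type*} (o : BlockOrder n κ) (mark : Fin n → ι)
    (D : Model 𝒜 n →ₗ[K] K) : Prop :=
  ∀ (c : List (Fin n × ι)) (e : List (Fin n × Fin n)), (∀ q ∈ e, q.1 ≠ q.2) →
    (D ((c.map fun p => cls 𝒜 p.1 (b p.2)).prod * (e.map fun q => G 𝒜 q.1 q.2).prod) ≠ 0 ↔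
      (∀ q ∈ e, o.blk q.1 = o.blk q.2) ∧
      (∀ j, o.rep j = j →
        b.repr ((c.filter fun p => o.rep p.1 = j).map fun p => b p.2).prod (mark j) ≠ 0) ∧
      ∀ j, o.rep j ≠ j → (e.map fun q => o.site q.1 q.2).count j = 1)

/-- The functional is a product of matrix coefficients of the operators on the sites: at the last
element of a block it reads off the coefficient of the mark in the value at `1`, at the other
elements whether the odd operator occurs exactly once. -/
theorem exists_detects
    (hcomm : ∀ (d e : ℕ) (x y : H), x ∈ 𝒜 d → y ∈ 𝒜 e → x * y = (-1 : K) ^ (d * e) • (y * x))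
    (hdeg : ∀ i, b i ∈ 𝒜 (deg i)) {κ : Type*} [DecidableEq κ] (o : BlockOrder n κ)
    (mark : Fin n → ι) : ∃ D : Model 𝒜 n →ₗ[K] K, Detects b 𝒜 o mark D := by
  obtain ⟨ℓ, hℓ⟩ : ∃ ℓ : H →ₗ[K] K, Fin n → ℓ 1 ≠ 0 := by
    by_cases hn : Nonempty (Fin n)
    · obtain ⟨i⟩ := hn
      have : Nontrivial H := ⟨b (mark i), 0, b.ne_zero (mark i)⟩
      have h1 : b.repr 1 ≠ 0 := b.repr.map_ne_zero_iff.mpr one_ne_zero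
      obtain ⟨h, hh⟩ := Finsupp.ne_iff.mp h1
      exact ⟨b.coord h, fun _ => hh⟩
    · exact ⟨0, fun i => absurd ⟨i⟩ hn⟩
  obtain ⟨Φ, hΦc, hΦG⟩ := exists_siteHom b hcomm hdeg o
  set S := siteParity b deg with hS
  let ev : Module.End K (H × H) →ₗ[K] H × H := LinearMap.applyₗ ((1, 0) : H × H)
  let φ : Fin n → Module.End K (H × H) →ₗ[K] K := fun j =>
    if o.rep j = j then b.coord (mark j) ∘ₗ LinearMap.fst K H H ∘ₗ ev
    else ℓ ∘ₗ LinearMap.snd K H H ∘ₗ ev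
  -- `(1, 0)` is even, so that the powers of the parity operator do not matter
  have hφ : ∀ j a, φ j (a * S) = φ j a := by
    intro j a
    have : ev (a * S) = ev a := by
      change (a * S) (1, 0) = a (1, 0)
      rw [Module.End.mul_apply, hS, siteParity_apply,
        parityMap_of_mem b hdeg SetLike.GradedOne.one_mem]
      simp
    simp only [φ]
    split_ifs
    · simp only [LinearMap.comp_apply, this]
    · simp only [LinearMap.comp_apply, this]
  refine ⟨siteFunctional φ ∘ₗ Φ.toLinearMap, fun c e he => ?_⟩
  rw [LinearMap.comp_apply, AlgHom.toLinearMap_apply, map_mul, map_list_prod, map_list_prod,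
    List.map_map, List.map_map]
  by_cases hblk : ∀ q ∈ e, o.blk q.1 = o.blk q.2
  · rw [and_iff_right hblk]
    set l : List (Fin n × ℕ × Module.End K (H × H)) :=
      (c.map fun p => (o.rep p.1, deg p.2, siteMul K (b p.2))) ++
        e.map fun q => (o.site q.1 q.2, 1, siteEps K H) with hl
    have hprod : (c.map (Φ ∘ fun p => cls 𝒜 p.1 (b p.2))).prod *
        (e.map (Φ ∘ fun q => G 𝒜 q.1 q.2)).prod =
        (l.map fun p => siteOp K S p.1 p.2.1 p.2.2).prod := by
      rw [hl, List.map_append, List.prod_append, List.map_map, List.map_map]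
      congr 2
      · exact List.map_congr_left fun p _ => hΦc _ _
      · refine List.map_congr_left fun q hq => (hΦG _ _).trans ?_
        exact if_pos ⟨hblk q hq, he q hq⟩
    rw [hprod, siteFunctional_prod_ne_zero_iff φ hφ]
    · rw [← forall_and]
      refine forall_congr' fun j => ?_
      by_cases hj : o.rep j = j
      · have hf : l.filter (fun p => p.1 = j) = (c.filter fun p => o.rep p.1 = j).map
            fun p => (o.rep p.1, deg p.2, siteMul K (b p.2)) := by
          rw [hl, List.filter_append, List.filter_map, List.filter_map]
          have : (e.filter ((fun p : Fin n × ℕ × Module.End K (H × H) => decide (p.1 = j)) ∘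
              fun q => (o.site q.1 q.2, 1, siteEps K H))) = [] := by
            rw [List.filter_eq_nil_iff]
            intro q hq
            have := o.site_ne_rep (hblk q hq) (he q hq) j
            rw [hj] at this
            simpa using this
          rw [this, List.map_nil, List.append_nil]
          rfl
        have hval : φ j ((l.filter fun p => p.1 = j).map fun p => p.2.2).prod =
            b.repr ((c.filter fun p => o.rep p.1 = j).map fun p => b p.2).prod (mark j) := by
          rw [hf, List.map_map]
          simp only [φ, if_pos hj]
          have := prod_map_siteMul (K := K) ((c.filter fun p => o.rep p.1 = j).map fun p => b p.2) 1
          rw [List.map_map, mul_one] at this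
          exact congrArg (fun x : H × H => b.repr x.1 (mark j)) this
        rw [hval]
        exact ⟨fun h => ⟨fun _ => h, fun h' => absurd hj h'⟩, fun h => h.1 hj⟩
      · have hf : l.filter (fun p => p.1 = j) = (e.filter fun q => o.site q.1 q.2 = j).map
            fun q => (o.site q.1 q.2, 1, siteEps K H) := by
          rw [hl, List.filter_append, List.filter_map, List.filter_map]
          have : (c.filter ((fun p : Fin n × ℕ × Module.End K (H × H) => decide (p.1 = j)) ∘
              fun p => (o.rep p.1, deg p.2, siteMul K (b p.2)))) = [] := by
            rw [List.filter_eq_nil_iff]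
            intro p _
            have : o.rep p.1 ≠ j := fun h => hj (by
              rw [← h, o.rep_eq _ _ (o.blk_rep p.1)])
            simpa using this
          rw [this, List.map_nil, List.nil_append]
          rfl
        have hval : φ j ((l.filter fun p => p.1 = j).map fun p => p.2.2).prod =
            if (e.map fun q => o.site q.1 q.2).count j = 1 then ℓ 1 else 0 := by
          have hcount : (e.map fun q => o.site q.1 q.2).count j =
              (e.filter fun q => o.site q.1 q.2 = j).length := by
            rw [List.count, List.countP_map, List.countP_eq_length_filter]
            congr 2
          rw [hf, List.map_map, hcount]
          have hrep : (((e.filter fun q => o.site q.1 q.2 = j).map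
              ((fun p : Fin n × ℕ × Module.End K (H × H) => p.2.2) ∘
              fun q => (o.site q.1 q.2, 1, siteEps K H)))).prod =
              siteEps K H ^ (e.filter fun q => o.site q.1 q.2 = j).length := by
            rw [← List.prod_replicate, List.eq_replicate_of_mem (a := siteEps K H)
              (l := List.map _ _), List.length_map]
            intro x hx
            obtain ⟨q, _, rfl⟩ := List.mem_map.mp hx
            rfl
          rw [hrep]
          simp only [φ, if_neg hj]
          generalize (e.filter fun q => o.site q.1 q.2 = j).length = k
          have h1 := siteEps_pow_apply (K := K) k (1 : H)
          change ℓ ((siteEps K H ^ k) (1, 0)).2 = _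
          rw [h1]
          match k with
          | 0 => simp
          | 1 => simp
          | k + 2 => simp
        rw [hval]
        have hne := hℓ j
        constructor
        · intro h
          refine ⟨fun h' => absurd h' hj, fun _ => ?_⟩
          by_contra h'
          exact h (if_neg h')
        · intro h
          rw [if_pos (h.2 hj)]
          exact hne
    · intro p hp
      rcases List.mem_append.mp hp with hp | hp
      · obtain ⟨q, _, rfl⟩ := List.mem_map.mp hp
        exact siteParity_mul_siteMul b hdeg (hdeg _)
      · obtain ⟨q, _, rfl⟩ := List.mem_map.mp hp
        exact siteParity_mul_siteEps b deg
  · have h0 : (e.map (Φ ∘ fun q => G 𝒜 q.1 q.2)).prod = 0 := by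
      push Not at hblk
      obtain ⟨q, hq, hne⟩ := hblk
      obtain ⟨s, t, rfl⟩ := List.append_of_mem hq
      have : Φ (G 𝒜 q.1 q.2) = 0 := (hΦG _ _).trans (if_neg fun h => hne h.1)
      rw [List.map_append, List.prod_append, List.map_cons, List.prod_cons, Function.comp_apply,
        this, zero_mul, mul_zero]
    rw [h0, mul_zero, map_zero]
    exact ⟨fun h => absurd rfl h, fun h => absurd h.1 hblk⟩

end Detect
end Kriz

namespace Kriz

/-! ### The functional of an ordering of the blocks -/

namespace BambooType

variable {n : ℕ} {ι : Type*} [LinearOrder ι] (τ : BambooType n ι)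

/-- The last element of the block `k`. -/
def blockLast (k : Fin τ.parts.length) : Fin n := (τ.block k).getLast (τ.block_ne_nil k.2)

theorem blockLast_mem (k : Fin τ.parts.length) : τ.blockLast k ∈ τ.block k := List.getLast_mem _

theorem blockIdx_blockLast (k : Fin τ.parts.length) : τ.blockIdx (τ.blockLast k) = k :=
  τ.mem_block_iff.mp (τ.blockLast_mem k)

theorem dropLast_append_blockLast (k : Fin τ.parts.length) :
    (τ.block k).dropLast ++ [τ.blockLast k] = τ.block k :=
  List.dropLast_append_getLast (τ.block_ne_nil k.2)

theorem le_blockLast {k : Fin τ.parts.length} {i : Fin n} (hi : i ∈ τ.block k) :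
    i ≤ τ.blockLast k := by
  have h := τ.block_pairwise k
  rw [← τ.dropLast_append_blockLast k] at h hi
  rcases List.mem_append.mp hi with hi | hi
  · exact ((List.pairwise_append.mp h).2.2 i hi _ (by simp)).le
  · rw [List.mem_singleton.mp hi]

/-- The permutations preserving each block. -/
def IsYoung (a : Equiv.Perm (Fin n)) : Prop := ∀ i, τ.blockIdx (a i) = τ.blockIdx i

/-- The permutations preserving each block and fixing its last element. -/
def IsNormal (a : Equiv.Perm (Fin n)) : Prop :=
  τ.IsYoung a ∧ ∀ k, a (τ.blockLast k) = τ.blockLast k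

/-- The blocks with the order of their elements given by `a`. -/
noncomputable def order (a : Equiv.Perm (Fin n)) (ha : τ.IsNormal a) :
    BlockOrder n (Fin τ.parts.length) where
  blk := τ.blockIdx
  rep i := τ.blockLast (τ.blockIdx i)
  pos := a.symm
  blk_rep i := τ.blockIdx_blockLast _
  rep_eq i j h := by rw [h]
  pos_injective := a.symm.injective
  pos_le i := by
    have h1 : a.symm (τ.blockLast (τ.blockIdx i)) = τ.blockLast (τ.blockIdx i) := by
      rw [Equiv.symm_apply_eq, ha.2]
    rw [h1]
    refine τ.le_blockLast (τ.mem_block_iff.mpr ?_)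
    rw [← ha.1, Equiv.apply_symm_apply]

theorem order_rep_blockLast {a : Equiv.Perm (Fin n)} (ha : τ.IsNormal a)
    (k : Fin τ.parts.length) : (τ.order a ha).rep (τ.blockLast k) = τ.blockLast k := by
  change τ.blockLast (τ.blockIdx (τ.blockLast k)) = _
  rw [τ.blockIdx_blockLast]

theorem card_filter_rep {a : Equiv.Perm (Fin n)} (ha : τ.IsNormal a) :
    (Finset.univ.filter fun j => (τ.order a ha).rep j = j).card = τ.parts.length := by
  have : (Finset.univ.filter fun j => (τ.order a ha).rep j = j) =
      Finset.univ.image τ.blockLast := by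
    ext j
    simp only [Finset.mem_filter, Finset.mem_univ, true_and, Finset.mem_image]
    constructor
    · intro h
      exact ⟨_, h⟩
    · rintro ⟨k, rfl⟩
      exact τ.order_rep_blockLast ha k
  rw [this, Finset.card_image_of_injective, Finset.card_univ, Fintype.card_fin]
  intro k l h
  rw [← τ.blockIdx_blockLast k, h, τ.blockIdx_blockLast]

theorem parts_eq_map : τ.parts = (List.finRange τ.parts.length).map τ.part := by
  apply List.ext_getElem
  · simp
  · intro i h1 h2
    simp [part]

end BambooType

theorem filter_finRange_eq {t : ℕ} (k : Fin t) :
    (List.finRange t).filter (fun k' => k' = k) = [k] := by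
  refine List.perm_singleton.mp ?_
  rw [List.perm_ext_iff_of_nodup ((List.nodup_finRange t).filter _) (List.nodup_singleton k)]
  simp

theorem blk_eq_of_pathEdges {n : ℕ} {κ : Type*} (f : Fin n → κ) {w : List (Fin n)}
    (h : ∀ q ∈ pathEdges w, f q.1 = f q.2) : ∀ i ∈ w, ∀ j ∈ w, f i = f j := by
  induction w with
  | nil => simp
  | cons x w ih =>
    cases w with
    | nil =>
      intro i hi j hj
      rw [List.mem_singleton] at hi hj
      rw [hi, hj]
    | cons y l =>
      have h1 := ih fun q hq => h q (by rw [pathEdges]; exact List.mem_cons_of_mem _ hq)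
      have h2 : f x = f y := h (x, y) (by simp [pathEdges])
      have key : ∀ i ∈ x :: y :: l, f i = f y := by
        intro i hi
        rcases List.mem_cons.mp hi with rfl | hi
        · exact h2
        · exact h1 i hi y (by simp)
      exact fun i hi j hj => (key i hi).trans (key j hj).symm

theorem BlockOrder.map_site_pathEdges {n : ℕ} {κ : Type*} (o : BlockOrder n κ) {w : List (Fin n)}
    (hw : w.Pairwise fun i j => o.pos i < o.pos j) :
    (pathEdges w).map (fun q => o.site q.1 q.2) = w.dropLast := by
  induction w with
  | nil => rfl
  | cons x w ih =>
    cases w with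
    | nil => rfl
    | cons y l =>
      rw [List.pairwise_cons] at hw
      rw [pathEdges, List.map_cons, ih hw.2, List.dropLast_cons_cons,
        o.site_of_lt (hw.1 y (by simp))]

/-- If the earlier endpoints of the edges of a word are distinct, and different from its last
letter, then the word is increasing. -/
theorem BlockOrder.pairwise_of_nodup {n : ℕ} {κ : Type*} (o : BlockOrder n κ) (u : List (Fin n))
    (z : Fin n) (hu : (u ++ [z]).Nodup)
    (hnd : ((pathEdges (u ++ [z])).map fun q => o.site q.1 q.2).Nodup)
    (hz : z ∉ (pathEdges (u ++ [z])).map fun q => o.site q.1 q.2) :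
    (u ++ [z]).Pairwise fun i j => o.pos i < o.pos j := by
  induction u with
  | nil => simp
  | cons x u ih =>
    obtain ⟨y, l, hl⟩ : ∃ y l, u ++ [z] = y :: l := by
      cases u with
      | nil => exact ⟨z, [], rfl⟩
      | cons y u => exact ⟨y, u ++ [z], rfl⟩
    rw [List.cons_append, hl] at hu hnd hz ⊢
    rw [hl] at ih
    rw [pathEdges, List.map_cons] at hnd hz
    rw [List.nodup_cons] at hnd hu
    rw [List.mem_cons, not_or] at hz
    have h := ih hu.2 hnd.2 hz.2
    have hd := o.map_site_pathEdges h
    have hxy : o.site x y ≠ y := by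
      intro he
      rw [he, hd] at hnd
      have hyl : y ∈ (y :: l).dropLast ++ [z] := by
        rw [← hl, List.dropLast_concat, hl]
        simp
      rcases List.mem_append.mp hyl with h' | h'
      · exact hnd.1 h'
      · exact hz.1 (by rw [he, List.mem_singleton.mp h'])
    have hlt : o.pos x < o.pos y := by
      by_contra hlt
      exact hxy (if_neg hlt)
    refine List.pairwise_cons.mpr ⟨fun j hj => ?_, h⟩
    rcases List.mem_cons.mp hj with rfl | hj
    · exact hlt
    · exact hlt.trans ((List.pairwise_cons.mp h).1 j hj)

section DetectTypes

variable {K : Type*} [Field K] {H : Type*} [Ring H] [Algebra K H] {𝒜 : ℕ → Submodule K H}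
  [GradedAlgebra 𝒜] {n : ℕ} {ι : Type*} [Fintype ι] [LinearOrder ι] {b : Module.Basis ι K H}
  {deg : ι → ℕ}

theorem SignEq.map_ne_zero_iff {M : Type*} [Ring M] [Module K M] (D : M →ₗ[K] K) {x y : M}
    (h : SignEq x y) : D x ≠ 0 ↔ D y ≠ 0 := by
  obtain ⟨s, rfl⟩ := h
  rw [map_zsmul]
  exact (IsUnit.smul_eq_zero (Units.isUnit s)).not

theorem Detects.typeVec_ne_zero_iff
    (hcomm : ∀ (d e : ℕ) (x y : H), x ∈ 𝒜 d → y ∈ 𝒜 e → x * y = (-1 : K) ^ (d * e) • (y * x))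
    (hdeg : ∀ i, b i ∈ 𝒜 (deg i)) {κ : Type*} {o : BlockOrder n κ} {mark : Fin n → ι}
    {D : Model 𝒜 n →ₗ[K] K} (hD : Detects b 𝒜 o mark D) (τ : BambooType n ι)
    (σ : Equiv.Perm (Fin n)) (v : Fin τ.parts.length → Fin n)
    (hv : ∀ k : Fin τ.parts.length, v k ∈ (τ.block k).map σ) :
    D (typeVec 𝒜 b τ σ) ≠ 0 ↔
      (∀ k : Fin τ.parts.length, ∀ q ∈ pathEdges ((τ.block k).map σ), o.blk q.1 = o.blk q.2) ∧
      (∀ j, o.rep j = j → b.repr (((List.finRange τ.parts.length).filter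
        fun k => o.rep (v k) = j).map fun k => b (τ.part k).2).prod (mark j) ≠ 0) ∧
      ∀ j, o.rep j ≠ j → ((List.finRange τ.parts.length).flatMap fun k : Fin τ.parts.length =>
        (pathEdges ((τ.block k).map σ)).map fun q => o.site q.1 q.2).count j = 1 := by
  set c : List (Fin n × List (Fin n) × ι) := (List.finRange τ.parts.length).map
    fun k : Fin τ.parts.length => (v k, (τ.block k).map σ, (τ.part k).2) with hc
  have hwords : (c.map fun p => p.2) = τ.words σ := by
    rw [hc, List.map_map, BambooType.words, List.ofFn_eq_map]
    rfl
  have hW : IsWordPartition (c.map fun p => p.2.1) := by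
    have := τ.isWordPartition_words σ
    rw [← hwords, List.map_map] at this
    exact this
  have hcv : ∀ p ∈ c, p.1 ∈ p.2.1 := by
    intro p hp
    obtain ⟨k, _, rfl⟩ := List.mem_map.mp hp
    exact hv k
  have hs := signEq_mono 𝒜 hcomm hdeg c hcv
  rw [hwords, prod_path_eq] at hs
  have hpr := isPruned_flatMap_pathEdges hW.nodup_flatten
  have h1 := hD (c.map fun p => (p.1, p.2.2)) ((c.map fun p => p.2.1).flatMap pathEdges) hpr.2
  rw [List.map_map] at h1
  rw [typeVec, ← hs.map_ne_zero_iff D]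
  refine h1.trans ?_
  have e1 : (c.map fun p => p.2.1).flatMap pathEdges =
      (List.finRange τ.parts.length).flatMap fun k : Fin τ.parts.length =>
        pathEdges ((τ.block k).map σ) := by
    rw [hc, List.map_map, List.flatMap_map]
    rfl
  rw [e1, List.map_flatMap]
  refine and_congr ?_ (and_congr ?_ Iff.rfl)
  · constructor
    · intro h k q hq
      exact h q (List.mem_flatMap.mpr ⟨k, List.mem_finRange k, hq⟩)
    · intro h q hq
      obtain ⟨k, _, hq⟩ := List.mem_flatMap.mp hq
      exact h k q hq
  · refine forall_congr' fun j => forall_congr' fun _ => ?_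
    rw [hc, List.map_map, List.filter_map, List.map_map]
    rfl

/-- A functional detecting orderings of the blocks of `τ` vanishes on the monomials of the other
types, and those of `τ` which it detects arise from `τ` by a permutation respecting the blocks. -/
theorem Detects.support
    (hcomm : ∀ (d e : ℕ) (x y : H), x ∈ 𝒜 d → y ∈ 𝒜 e → x * y = (-1 : K) ^ (d * e) • (y * x))
    (hdeg : ∀ i, b i ∈ 𝒜 (deg i)) {τ τ' : BambooType n ι} {a : Equiv.Perm (Fin n)}
    {ha : τ.IsNormal a} {D : Model 𝒜 n →ₗ[K] K}
    (hD : Detects b 𝒜 (τ.order a ha) (fun j => (τ.part (τ.blockIdx j)).2) D)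
    {σ : Equiv.Perm (Fin n)} (h0 : D (typeVec 𝒜 b τ' σ) ≠ 0) :
    τ' = τ ∧ ∃ g : Fin τ'.parts.length → Fin τ.parts.length, Function.Bijective g ∧
      (∀ k, τ'.part k = τ.part (g k)) ∧ ∀ i, τ.blockIdx (σ i) = g (τ'.blockIdx i) := by
  have hv : ∀ k : Fin τ'.parts.length, σ (τ'.blockLast k) ∈ (τ'.block k).map σ :=
    fun k => List.mem_map_of_mem (τ'.blockLast_mem k)
  obtain ⟨h1, h2, h3⟩ := (hD.typeVec_ne_zero_iff hcomm hdeg τ' σ _ hv).mp h0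
  let g : Fin τ'.parts.length → Fin τ.parts.length := fun k => τ.blockIdx (σ (τ'.blockLast k))
  have hg : ∀ i, τ.blockIdx (σ i) = g (τ'.blockIdx i) := fun i =>
    blk_eq_of_pathEdges τ.blockIdx (h1 _) _ (List.mem_map_of_mem (τ'.mem_block_blockIdx i)) _
      (hv _)
  have hsurj : Function.Surjective g := by
    intro k
    refine ⟨τ'.blockIdx (σ.symm (τ.blockLast k)), ?_⟩
    rw [← hg, Equiv.apply_symm_apply, τ.blockIdx_blockLast]
  -- counting the edges, there are as many words as blocks
  have hcard : τ'.parts.length = τ.parts.length := by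
    set E := (List.finRange τ'.parts.length).flatMap fun k : Fin τ'.parts.length =>
        (pathEdges ((τ'.block k).map σ)).map fun q => (τ.order a ha).site q.1 q.2 with hE
    have hE0 : ∀ j, (τ.order a ha).rep j = j → E.count j = 0 := by
      intro j hj
      rw [List.count_eq_zero]
      intro hmem
      obtain ⟨k, _, hq⟩ := List.mem_flatMap.mp hmem
      obtain ⟨q, hq, hqj⟩ := List.mem_map.mp hq
      have hne : q.1 ≠ q.2 := (isPruned_pathEdges ((τ'.nodup_block k).map σ.injective)).2 q hq
      exact (τ.order a ha).site_ne_rep (h1 k q hq) hne j (hqj.trans hj.symm)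
    have hlen : E.length = (Finset.univ.filter fun j => ¬ (τ.order a ha).rep j = j).card := by
      have e1 : E.length = ∑ j, E.count j := by
        have := Multiset.sum_count_eq_card (s := Finset.univ) (m := (E : Multiset (Fin n)))
          (fun _ _ => Finset.mem_univ _)
        simpa using this.symm
      rw [e1, Finset.card_filter]
      refine Finset.sum_congr rfl fun j _ => ?_
      split_ifs with hj
      · exact hE0 j hj
      · exact h3 j hj
    have hlen' : E.length = τ'.lengthDeg := by
      rw [hE, List.length_flatMap, BambooType.lengthDeg]
      conv_rhs => rw [τ'.parts_eq_map]
      rw [List.map_map]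
      congr 1
      refine List.map_congr_left fun k _ => ?_
      rw [List.length_map, length_pathEdges, List.length_map, τ'.length_block k.2]
      rfl
    have e2 := Finset.card_filter_add_card_filter_not (s := (Finset.univ : Finset (Fin n)))
      (fun j => (τ.order a ha).rep j = j)
    rw [τ.card_filter_rep ha, ← hlen, hlen', Finset.card_univ, Fintype.card_fin] at e2
    have e3 := τ'.lengthDeg_add_length
    omega
  have hbij : Function.Bijective g :=
    (Fintype.bijective_iff_surjective_and_card g).mpr ⟨hsurj, by simp [hcard]⟩
  have hperm : ∀ k : Fin τ'.parts.length, ((τ'.block k).map σ).Perm (τ.block (g k)) := by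
    intro k
    rw [List.perm_ext_iff_of_nodup ((τ'.nodup_block k).map σ.injective) (τ.nodup_block _)]
    intro x
    rw [τ.mem_block_iff, List.mem_map]
    constructor
    · rintro ⟨i, hi, rfl⟩
      rw [hg, τ'.mem_block_iff.mp hi]
    · intro hx
      refine ⟨σ.symm x, τ'.mem_block_iff.mpr (hbij.1 ?_), Equiv.apply_symm_apply _ _⟩
      rw [← hg, Equiv.apply_symm_apply, hx]
  have hpart : ∀ k, τ'.part k = τ.part (g k) := by
    intro k
    have e1 := (hperm k).length_eq
    rw [List.length_map, τ'.length_block k.2, τ.length_block (g k).2] at e1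
    refine Prod.ext e1 ?_
    have e2 := h2 _ (τ.order_rep_blockLast ha (g k))
    have e3 : ((List.finRange τ'.parts.length).filter fun k' =>
        (τ.order a ha).rep (σ (τ'.blockLast k')) = τ.blockLast (g k)) = [k] := by
      have : ∀ k', (τ.order a ha).rep (σ (τ'.blockLast k')) = τ.blockLast (g k) ↔ k' = k := by
        intro k'
        change τ.blockLast (g k') = _ ↔ _
        constructor
        · intro h
          apply hbij.1
          rw [← τ.blockIdx_blockLast (g k'), h, τ.blockIdx_blockLast]
        · rintro rfl
          rfl
      simp only [this]
      exact filter_finRange_eq k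
    rw [e3, List.map_singleton, List.prod_singleton, Module.Basis.repr_self,
      τ.blockIdx_blockLast, Finsupp.single_apply] at e2
    by_contra hne
    exact e2 (if_neg hne)
  refine ⟨BambooType.eq_of_perm ?_, g, hbij, hpart, hg⟩
  have hp : ((List.finRange τ'.parts.length).map g).Perm (List.finRange τ.parts.length) := by
    rw [List.perm_ext_iff_of_nodup ((List.nodup_finRange _).map hbij.1) (List.nodup_finRange _)]
    intro k
    simp only [List.mem_map, List.mem_finRange, true_and, iff_true]
    exact hsurj k
  have hp' := hp.map τ.part
  rw [List.map_map, ← τ.parts_eq_map] at hp'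
  rw [τ'.parts_eq_map, List.map_congr_left (g := τ.part ∘ g) fun k _ => hpart k]
  exact hp'

/-- On normal permutations, the functional of the ordering `a` detects exactly `a`. -/
theorem Detects.normal
    (hcomm : ∀ (d e : ℕ) (x y : H), x ∈ 𝒜 d → y ∈ 𝒜 e → x * y = (-1 : K) ^ (d * e) • (y * x))
    (hdeg : ∀ i, b i ∈ 𝒜 (deg i)) {τ : BambooType n ι} {a a' : Equiv.Perm (Fin n)}
    {ha : τ.IsNormal a} (ha' : τ.IsNormal a') {D : Model 𝒜 n →ₗ[K] K}
    (hD : Detects b 𝒜 (τ.order a ha) (fun j => (τ.part (τ.blockIdx j)).2) D) :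
    D (typeVec 𝒜 b τ a') ≠ 0 ↔ a = a' := by
  have hv : ∀ k : Fin τ.parts.length, τ.blockLast k ∈ (τ.block k).map a' :=
    fun k => List.mem_map.mpr ⟨_, τ.blockLast_mem k, ha'.2 k⟩
  have hword : ∀ k : Fin τ.parts.length,
      (τ.block k).map a' = (τ.block k).dropLast.map a' ++ [τ.blockLast k] := by
    intro k
    conv_lhs => rw [← τ.dropLast_append_blockLast k, List.map_append, List.map_singleton, ha'.2]
  have hnd : ∀ k : Fin τ.parts.length, ((τ.block k).map a').Nodup := fun k =>
    (τ.nodup_block k).map a'.injective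
  have hblk : ∀ k : Fin τ.parts.length, ∀ q ∈ pathEdges ((τ.block k).map a'),
      τ.blockIdx q.1 = τ.blockIdx q.2 := by
    have key : ∀ k : Fin τ.parts.length, ∀ i ∈ (τ.block k).map a', τ.blockIdx i = k := by
      intro k i hi
      obtain ⟨j, hj, rfl⟩ := List.mem_map.mp hi
      rw [ha'.1, τ.mem_block_iff.mp hj]
    intro k q hq
    obtain ⟨h1, h2⟩ := mem_of_mem_pathEdges hq
    rw [key k _ h1, key k _ h2]
  rw [hD.typeVec_ne_zero_iff hcomm hdeg τ a' _ hv]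
  set E := (List.finRange τ.parts.length).flatMap fun k : Fin τ.parts.length =>
        (pathEdges ((τ.block k).map a')).map fun q => (τ.order a ha).site q.1 q.2 with hE
  constructor
  · rintro ⟨-, -, h3⟩
    have hE0 : ∀ j, (τ.order a ha).rep j = j → j ∉ E := by
      intro j hj hmem
      obtain ⟨k, _, hq⟩ := List.mem_flatMap.mp hmem
      obtain ⟨q, hq, hqj⟩ := List.mem_map.mp hq
      have hne : q.1 ≠ q.2 := (isPruned_pathEdges (hnd k)).2 q hq
      exact (τ.order a ha).site_ne_rep (hblk k q hq) hne j (hqj.trans hj.symm)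
    have hEnd : E.Nodup := by
      rw [List.nodup_iff_count_le_one]
      intro j
      by_cases hj : (τ.order a ha).rep j = j
      · rw [List.count_eq_zero.mpr (hE0 j hj)]
        exact Nat.zero_le _
      · exact (h3 j hj).le
    refine τ.perm_ext_blocks fun k => ?_
    have hsub : ((pathEdges ((τ.block k).map a')).map fun q => (τ.order a ha).site q.1 q.2).Nodup :=
      (List.nodup_flatMap.mp hEnd).1 k (List.mem_finRange k)
    have hz : τ.blockLast k ∉
        (pathEdges ((τ.block k).map a')).map fun q => (τ.order a ha).site q.1 q.2 := fun hm =>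
      hE0 _ (τ.order_rep_blockLast ha k) (List.mem_flatMap.mpr ⟨k, List.mem_finRange k, hm⟩)
    have hndk := hnd k
    rw [hword k] at hsub hz hndk
    have hinc := (τ.order a ha).pairwise_of_nodup _ _ hndk hsub hz
    rw [← hword k, List.pairwise_map] at hinc
    have hp : ((τ.block k).map fun i => a.symm (a' i)) = τ.block k := by
      refine List.Perm.eq_of_pairwise (le := (· < ·)) (fun x y _ _ h h' => absurd h' h.asymm)
        (List.pairwise_map.mpr hinc) (τ.block_pairwise k) ?_
      refine (List.perm_ext_iff_of_nodup
        ((τ.nodup_block k).map (a.symm.injective.comp a'.injective)) (τ.nodup_block k)).mpr ?_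
      have hY : ∀ i, τ.blockIdx (a.symm (a' i)) = τ.blockIdx i := by
        intro i
        rw [← ha.1, Equiv.apply_symm_apply, ha'.1]
      intro x
      rw [List.mem_map]
      constructor
      · rintro ⟨i, hi, rfl⟩
        rw [Function.comp_apply, τ.mem_block_iff, hY]
        exact τ.mem_block_iff.mp hi
      · intro hx
        refine ⟨a'.symm (a x), ?_, by simp⟩
        rw [τ.mem_block_iff, ← hY]
        simpa using τ.mem_block_iff.mp hx
    conv_lhs => rw [← hp]
    rw [List.map_map]
    exact List.map_congr_left fun i _ => by simp
  · rintro rfl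
    refine ⟨hblk, fun j hj => ?_, fun j hj => ?_⟩
    · have e3 : ((List.finRange τ.parts.length).filter fun k' =>
          (τ.order a ha).rep (τ.blockLast k') = j) = [τ.blockIdx j] := by
        have : ∀ k', (τ.order a ha).rep (τ.blockLast k') = j ↔ k' = τ.blockIdx j := by
          intro k'
          rw [τ.order_rep_blockLast]
          constructor
          · rintro rfl
            rw [τ.blockIdx_blockLast]
          · rintro rfl
            exact hj
        simp only [this]
        exact filter_finRange_eq _
      rw [e3, List.map_singleton, List.prod_singleton, Module.Basis.repr_self,
        Finsupp.single_eq_same]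
      exact one_ne_zero
    · have hsites : ∀ k : Fin τ.parts.length,
          ((pathEdges ((τ.block k).map a)).map fun q => (τ.order a ha).site q.1 q.2) =
            (τ.block k).dropLast.map a := by
        intro k
        rw [(τ.order a ha).map_site_pathEdges, hword k, List.dropLast_concat]
        rw [List.pairwise_map]
        refine (τ.block_pairwise k).imp fun {i j} hij => ?_
        change a.symm (a i) < a.symm (a j)
        simpa using hij
      have hE' : E = (List.finRange τ.parts.length).flatMap
          fun k : Fin τ.parts.length => (τ.block k).dropLast.map a := by
        rw [hE]
        congr 1
        exact funext hsites
      rw [hE']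
      refine List.count_eq_one_of_mem ?_ ?_
      · rw [List.nodup_flatMap]
        refine ⟨fun k _ =>
          ((τ.nodup_block k).sublist (List.dropLast_sublist _)).map a.injective, ?_⟩
        refine (List.nodup_finRange _).imp fun {k l} hkl => ?_
        intro x hx hx'
        obtain ⟨i, hi, rfl⟩ := List.mem_map.mp hx
        obtain ⟨i', hi', hii⟩ := List.mem_map.mp hx'
        rw [a.injective hii] at hi'
        exact hkl (Fin.ext
          (τ.block_unique (List.dropLast_subset _ hi) (List.dropLast_subset _ hi')))
      · rw [List.mem_flatMap]
        refine ⟨τ.blockIdx j, List.mem_finRange _, ?_⟩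
        have hm : a.symm j ∈ τ.block (τ.blockIdx j) := by
          rw [τ.mem_block_iff, ← ha.1, Equiv.apply_symm_apply]
        rw [← τ.dropLast_append_blockLast] at hm
        rcases List.mem_append.mp hm with hm | hm
        · exact List.mem_map.mpr ⟨_, hm, Equiv.apply_symm_apply _ _⟩
        · refine absurd ?_ hj
          have := List.mem_singleton.mp hm
          rw [Equiv.symm_apply_eq, ha.2] at this
          exact this.symm

end DetectTypes
end Kriz

namespace Kriz

/-! ### Replacing one word of a monomial -/

theorem exists_perm_map_eq {α : Type*} [DecidableEq α] {l l' : List α} (h : l.Perm l')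
    (hnd : l.Nodup) : ∃ e : Equiv.Perm α, l.map e = l' ∧ ∀ a ∉ l, e a = a := by
  induction h with
  | nil => exact ⟨1, rfl, fun _ _ => rfl⟩
  | cons x _ ih =>
    rw [List.nodup_cons] at hnd
    obtain ⟨e, h1, h2⟩ := ih hnd.2
    exact ⟨e, by rw [List.map_cons, h1, h2 x hnd.1],
      fun a ha => h2 a fun h => ha (List.mem_cons_of_mem _ h)⟩
  | swap x y l =>
    refine ⟨Equiv.swap x y, ?_, fun a ha => Equiv.swap_apply_of_ne_of_ne ?_ ?_⟩
    · rw [List.nodup_cons, List.nodup_cons, List.mem_cons, not_or] at hnd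
      rw [List.map_cons, List.map_cons, Equiv.swap_apply_left, Equiv.swap_apply_right]
      congr 2
      conv_rhs => rw [← List.map_id l]
      refine List.map_congr_left fun a ha => Equiv.swap_apply_of_ne_of_ne ?_ ?_
      · rintro rfl; exact hnd.2.1 ha
      · rintro rfl; exact hnd.1.2 ha
    · rintro rfl; simp at ha
    · rintro rfl; simp at ha
  | trans h1 _ ih1 ih2 =>
    obtain ⟨e, h3, h4⟩ := ih1 hnd
    obtain ⟨e', h5, h6⟩ := ih2 (h1.nodup_iff.mp hnd)
    refine ⟨e' * e, by rw [Equiv.Perm.coe_mul, ← List.map_map, h3, h5], fun a ha => ?_⟩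
    rw [Equiv.Perm.mul_apply, h4 a ha, h6 a fun h => ha (h1.mem_iff.mpr h)]

theorem exists_prod_map_update {κ M : Type*} [DecidableEq κ] [Monoid M] {l : List κ}
    (hl : l.Nodup) {k : κ} (hk : k ∈ l) (F : κ → M) :
    ∃ A B : M, ∀ F' : κ → M, (∀ j, j ≠ k → F' j = F j) → (l.map F').prod = A * F' k * B := by
  obtain ⟨l₁, l₂, rfl⟩ := List.append_of_mem hk
  rw [List.nodup_middle, List.nodup_cons, List.mem_append, not_or] at hl
  refine ⟨(l₁.map F).prod, (l₂.map F).prod, fun F' h => ?_⟩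
  rw [List.map_append, List.prod_append, List.map_cons, List.prod_cons, ← mul_assoc,
    List.map_congr_left (g := F) fun j hj => h j fun hjk => hl.1.1 (hjk ▸ hj),
    List.map_congr_left (l := l₂) (g := F) fun j hj => h j fun hjk => hl.1.2 (hjk ▸ hj)]

namespace BambooType

variable {n : ℕ} {ι : Type*} [LinearOrder ι] (τ : BambooType n ι)

/-- The word of the block `k` can be reordered, without changing the words of the other blocks. -/
theorem exists_reorder (σ : Equiv.Perm (Fin n)) (k : Fin τ.parts.length) {s : List (Fin n)}
    (hs : s.Perm ((τ.block k).map σ)) :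
    ∃ σ' : Equiv.Perm (Fin n), (τ.block k).map σ' = s ∧
      ∀ l : Fin τ.parts.length, l ≠ k → (τ.block l).map σ' = (τ.block l).map σ := by
  obtain ⟨e, h1, h2⟩ := exists_perm_map_eq hs.symm ((τ.nodup_block k).map σ.injective)
  refine ⟨e * σ, by rw [Equiv.Perm.coe_mul, ← List.map_map, h1], fun l hl => ?_⟩
  refine List.map_congr_left fun a ha => h2 _ fun h => ?_
  obtain ⟨a', ha', haa⟩ := List.mem_map.mp h
  rw [σ.injective haa] at ha'
  exact hl (Fin.ext (τ.block_unique ha ha'))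

/-- To prove a property of the permutations `σ` such that each word `σ (block k)` contains a given
letter `y k`, one may reduce to those where `y k` is the last letter, provided that the property
passes from the words `s ++ [y k]` to the words `u ++ y k :: v` having the same letters. -/
theorem word_induction (y : Fin τ.parts.length → Fin n) {P : Equiv.Perm (Fin n) → Prop}
    (h0 : ∀ σ : Equiv.Perm (Fin n), (∀ k, σ (τ.blockLast k) = y k) → P σ)
    (hstep : ∀ (σ : Equiv.Perm (Fin n)) (k : Fin τ.parts.length) (u v : List (Fin n)),
      (τ.block k).map σ = u ++ y k :: v →
      (∀ (σ' : Equiv.Perm (Fin n)) (s : List (Fin n)), s.Perm (u ++ v) →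
        (τ.block k).map σ' = s ++ [y k] →
        (∀ l : Fin τ.parts.length, l ≠ k → (τ.block l).map σ' = (τ.block l).map σ) →
        P σ') → P σ)
    (σ : Equiv.Perm (Fin n)) (hσ : ∀ k : Fin τ.parts.length, y k ∈ (τ.block k).map σ) : P σ := by
  classical
  induction hc : (Finset.univ.filter fun k => σ (τ.blockLast k) ≠ y k).card using
    Nat.strong_induction_on generalizing σ with
  | _ c ih =>
    by_cases h : ∀ k, σ (τ.blockLast k) = y k
    · exact h0 σ h
    · push Not at h
      obtain ⟨k, hk⟩ := h
      obtain ⟨u, v, huv⟩ := List.append_of_mem (hσ k)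
      refine hstep σ k u v huv fun σ' s hs hk' hl => ?_
      have hlast : σ' (τ.blockLast k) = y k := by
        rw [← τ.dropLast_append_blockLast k, List.map_append] at hk'
        have := (List.append_inj' hk' rfl).2
        simpa using this
      have hsame : ∀ l, l ≠ k → σ' (τ.blockLast l) = σ (τ.blockLast l) := fun l hlk =>
        List.map_inj_left.mp (hl l hlk) _ (τ.blockLast_mem l)
      have hlt : (Finset.univ.filter fun k => σ' (τ.blockLast k) ≠ y k) ⊂
          Finset.univ.filter fun k => σ (τ.blockLast k) ≠ y k := by
        refine Finset.ssubset_iff_subset_ne.mpr ⟨fun l hl' => ?_, fun heq => ?_⟩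
        · rw [Finset.mem_filter] at hl' ⊢
          refine ⟨Finset.mem_univ _, ?_⟩
          by_cases hlk : l = k
          · rw [hlk]
            exact hk
          · rw [← hsame l hlk]
            exact hl'.2
        · have hmem : k ∈ Finset.univ.filter fun k => σ (τ.blockLast k) ≠ y k := by simpa using hk
          rw [← heq] at hmem
          exact (Finset.mem_filter.mp hmem).2 hlast
      refine ih _ (hc ▸ Finset.card_lt_card hlt) σ' (fun l => ?_) rfl
      by_cases hlk : l = k
      · subst hlk
        rw [hk']
        simp
      · rw [hl l hlk]
        exact hσ l

variable {τ} in
theorem IsYoung.map_perm {π : Equiv.Perm (Fin n)} (hπ : τ.IsYoung π) (k : Fin τ.parts.length) :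
    ((τ.block k).map π).Perm (τ.block k) := by
  rw [List.perm_ext_iff_of_nodup ((τ.nodup_block k).map π.injective) (τ.nodup_block k)]
  intro a
  rw [List.mem_map]
  constructor
  · rintro ⟨i, hi, rfl⟩
    rw [τ.mem_block_iff, hπ]
    exact τ.mem_block_iff.mp hi
  · intro ha
    refine ⟨π.symm a, ?_, π.apply_symm_apply a⟩
    rw [τ.mem_block_iff, ← hπ, π.apply_symm_apply]
    exact τ.mem_block_iff.mp ha

theorem isYoung_of_map_perm {π : Equiv.Perm (Fin n)}
    (h : ∀ k : Fin τ.parts.length, ((τ.block k).map π).Perm (τ.block k)) : τ.IsYoung π := fun i =>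
  τ.mem_block_iff.mp ((h (τ.blockIdx i)).subset (List.mem_map_of_mem (τ.mem_block_blockIdx i)))

end BambooType

section Replace

variable {K : Type*} [Field K] {H : Type*} [Ring H] [Algebra K H] (𝒜 : ℕ → Submodule K H)
  {n : ℕ} {ι : Type*} [LinearOrder ι]

theorem typeVec_eq_prod (x : ι → H) (τ : BambooType n ι) (σ : Equiv.Perm (Fin n)) :
    typeVec 𝒜 x τ σ = ((List.finRange τ.parts.length).map fun k : Fin τ.parts.length =>
      bamboo 𝒜 (x (τ.part k).2) ((τ.block k).map σ)).prod := by
  rw [typeVec, mono, BambooType.words, List.ofFn_eq_map, List.map_map]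
  rfl

/-- The shuffle expansion of the monomial of `σ` with respect to a letter of the block `k`. -/
theorem exists_typeVec_eq_shSum {deg : ι → ℕ} {x : ι → H} (hx : ∀ h, x h ∈ 𝒜 (deg h))
    (τ : BambooType n ι) (σ : Equiv.Perm (Fin n)) (k : Fin τ.parts.length) {u v : List (Fin n)}
    {z : Fin n} (h : (τ.block k).map σ = u ++ z :: v) :
    ∃ φ : List (Fin n) → Model 𝒜 n,
      typeVec 𝒜 x τ σ = (-1 : ℤ) ^ (v.length * (v.length - 1) / 2) • shSum φ u.reverse v [z] ∧
      ∀ s, s.Perm (u ++ v) → ∃ σ' : Equiv.Perm (Fin n), (τ.block k).map σ' = s ++ [z] ∧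
        (∀ l : Fin τ.parts.length, l ≠ k → (τ.block l).map σ' = (τ.block l).map σ) ∧
        φ (s ++ [z]) = typeVec 𝒜 x τ σ' := by
  obtain ⟨A, B, hAB⟩ := exists_prod_map_update (List.nodup_finRange _) (List.mem_finRange k)
    fun k : Fin τ.parts.length => bamboo 𝒜 (x (τ.part k).2) ((τ.block k).map σ)
  let f : Model 𝒜 n →+ Model 𝒜 n := (AddMonoidHom.mulRight B).comp (AddMonoidHom.mulLeft A)
  have hf : ∀ σ' : Equiv.Perm (Fin n),
      (∀ l : Fin τ.parts.length, l ≠ k → (τ.block l).map σ' = (τ.block l).map σ) →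
      typeVec 𝒜 x τ σ' = f (bamboo 𝒜 (x (τ.part k).2) ((τ.block k).map σ')) := by
    intro σ' hσ'
    rw [typeVec_eq_prod]
    exact hAB _ fun l hl => by rw [hσ' l hl]
  refine ⟨fun s => f (bamboo 𝒜 (x (τ.part k).2) s), ?_, fun s hs => ?_⟩
  · have hnd := (τ.nodup_block k).map σ.injective
    rw [h] at hnd
    rw [hf σ fun _ _ => rfl, h, bamboo_middle 𝒜 u v z hnd (hx _), map_zsmul, map_shSum]
  · obtain ⟨σ', h1, h2⟩ := τ.exists_reorder σ k (s := s ++ [z]) (by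
      rw [h]
      exact (List.perm_append_singleton z s).trans ((hs.cons z).trans List.perm_middle.symm))
    exact ⟨σ', h1, h2, by rw [hf σ' h2, h1]⟩

end Replace

/-! ### The functional of a type -/

namespace BambooType

variable {n : ℕ} {ι : Type*} [LinearOrder ι] (τ : BambooType n ι)

/-- The primitive root of unity `e^{2π√-1/λ_k}`. -/
noncomputable def root (k : Fin τ.parts.length) : ℂ :=
  Complex.exp (2 * Real.pi * Complex.I / ((τ.part k).1 : ℂ))

theorem length_block_eq (k : Fin τ.parts.length) : (τ.block k).length = (τ.part k).1 :=
  τ.length_block k.2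

theorem part_fst_ne_zero (k : Fin τ.parts.length) : (τ.part k).1 ≠ 0 := by
  have := τ.pos _ (List.getElem_mem k.2)
  exact Nat.one_le_iff_ne_zero.mp this

theorem isPrimitiveRoot_root (k : Fin τ.parts.length) :
    IsPrimitiveRoot (τ.root k) (τ.part k).1 :=
  Complex.isPrimitiveRoot_exp _ (τ.part_fst_ne_zero k)

theorem root_ne_zero (k : Fin τ.parts.length) : τ.root k ≠ 0 := Complex.exp_ne_zero _

/-- The product over the blocks of the values of the words on the block. -/
noncomputable def wordProd (π : Equiv.Perm (Fin n)) : ℂ :=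
  ∏ k : Fin τ.parts.length, wordVal (τ.root k) ((τ.block k).map π)

theorem wordProd_ne_zero (π : Equiv.Perm (Fin n)) : τ.wordProd π ≠ 0 :=
  Finset.prod_ne_zero_iff.mpr fun k _ => wordVal_ne_zero (τ.root_ne_zero k) _

end BambooType

section TypeFunctional

variable {K : Type*} [Field K] [Algebra K ℂ] {H : Type*} [Ring H] [Algebra K H]
  (𝒜 : ℕ → Submodule K H) [GradedAlgebra 𝒜] {n : ℕ} {ι : Type*} [Fintype ι] [LinearOrder ι]
  {b : Module.Basis ι K H} {deg : ι → ℕ}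

/-- A functional which on the monomials of the permutations preserving the blocks takes the
prescribed values: both sides have the same shuffle expansions, so that it suffices to prescribe
the values on the normal permutations. -/
theorem exists_typeFunctional
    (hcomm : ∀ (d e : ℕ) (x y : H), x ∈ 𝒜 d → y ∈ 𝒜 e → x * y = (-1 : K) ^ (d * e) • (y * x))
    (hdeg : ∀ i, b i ∈ 𝒜 (deg i)) (τ : BambooType n ι) :
    ∃ m : Model 𝒜 n →ₗ[K] ℂ,
      (∀ π, τ.IsYoung π → m (typeVec 𝒜 b τ π) = τ.wordProd π) ∧
      ∀ (τ' : BambooType n ι) (σ : Equiv.Perm (Fin n)), m (typeVec 𝒜 b τ' σ) ≠ 0 →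
        τ' = τ ∧ ∃ g : Fin τ'.parts.length → Fin τ.parts.length, Function.Bijective g ∧
          (∀ k, τ'.part k = τ.part (g k)) ∧ ∀ i, τ.blockIdx (σ i) = g (τ'.blockIdx i) := by
  classical
  have hD : ∀ a : {a // τ.IsNormal a}, ∃ D : Model 𝒜 n →ₗ[K] K,
      Detects b 𝒜 (τ.order a.1 a.2) (fun j => (τ.part (τ.blockIdx j)).2) D := fun a =>
    exists_detects b hcomm hdeg _ _
  choose D hD using hD
  let m : Model 𝒜 n →ₗ[K] ℂ := ∑ a : {a // τ.IsNormal a},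
    (τ.wordProd a.1 * (algebraMap K ℂ (D a (typeVec 𝒜 b τ a.1)))⁻¹) •
      (Algebra.linearMap K ℂ ∘ₗ D a)
  have hm : ∀ y, m y = ∑ a : {a // τ.IsNormal a},
      (τ.wordProd a.1 * (algebraMap K ℂ (D a (typeVec 𝒜 b τ a.1)))⁻¹) *
        algebraMap K ℂ (D a y) := by
    intro y
    simp only [m, LinearMap.sum_apply, LinearMap.smul_apply, LinearMap.comp_apply,
      Algebra.linearMap_apply, smul_eq_mul]
  refine ⟨m, fun π hπ => ?_, fun τ' σ h => ?_⟩
  · have hy : ∀ k : Fin τ.parts.length, τ.blockLast k ∈ (τ.block k).map π := fun k =>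
      (hπ.map_perm k).mem_iff.mpr (τ.blockLast_mem k)
    refine τ.word_induction τ.blockLast
      (P := fun π => τ.IsYoung π → m (typeVec 𝒜 b τ π) = τ.wordProd π) ?_ ?_ π hy hπ
    · intro π hlast hπ
      have hn : τ.IsNormal π := ⟨hπ, hlast⟩
      rw [hm, Finset.sum_eq_single ⟨π, hn⟩]
      · have h0 : D ⟨π, hn⟩ (typeVec 𝒜 b τ π) ≠ 0 := ((hD ⟨π, hn⟩).normal hcomm hdeg hn).mpr rfl
        rw [mul_assoc, inv_mul_cancel₀, mul_one]
        exact (map_ne_zero _).mpr h0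
      · intro a _ ha
        have : D a (typeVec 𝒜 b τ π) = 0 := by
          by_contra h0
          exact ha (Subtype.ext (((hD a).normal hcomm hdeg hn).mp h0))
        rw [this, map_zero, mul_zero]
      · intro h
        exact absurd (Finset.mem_univ _) h
    · intro π k u v huv ih hπ
      obtain ⟨φ, h1, h2⟩ := exists_typeVec_eq_shSum 𝒜 hdeg τ π k huv
      have hp := hπ.map_perm k
      have hlen : u.length + v.length + 1 = (τ.part k).1 := by
        rw [← τ.length_block_eq, ← hp.length_eq, huv]
        simp only [List.length_append, List.length_cons]
        omega
      have hnd := (τ.nodup_block k).map π.injective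
      rw [huv] at hnd hp
      have hz : ∀ i ∈ u ++ v, i < τ.blockLast k := by
        intro i hi
        have h3 : i ∈ u ++ τ.blockLast k :: v := by
          rw [List.mem_append] at hi
          rcases hi with hi | hi <;> simp [hi]
        refine lt_of_le_of_ne (τ.le_blockLast (hp.mem_iff.mp h3)) ?_
        rintro rfl
        rw [List.nodup_middle, List.nodup_cons] at hnd
        exact hnd.1 hi
      have hq : IsPrimitiveRoot (τ.root k)⁻¹ (u.length + v.length + 1) := by
        rw [hlen]
        exact (τ.isPrimitiveRoot_root k).inv
      have hmid := wordVal_middle (inv_mul_cancel₀ (τ.root_ne_zero k)) u v _ hq hnd hz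
      set A : ℂ := ∏ l ∈ Finset.univ.erase k, wordVal (τ.root l) ((τ.block l).map π) with hA
      have hval : ∀ π' : Equiv.Perm (Fin n),
          (∀ l : Fin τ.parts.length, l ≠ k → (τ.block l).map π' = (τ.block l).map π) →
          τ.wordProd π' = A * wordVal (τ.root k) ((τ.block k).map π') := by
        intro π' hl
        rw [BambooType.wordProd, ← Finset.prod_erase_mul _ _ (Finset.mem_univ k), hA]
        congr 1
        exact Finset.prod_congr rfl fun l hlk => by rw [hl l (Finset.ne_of_mem_erase hlk)]
      rw [h1, map_zsmul, hval π fun _ _ => rfl, huv, hmid, ← LinearMap.toAddMonoidHom_coe,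
        map_shSum, zsmul_eq_mul]
      push_cast
      rw [mul_left_comm]
      congr 1
      have := map_shSum (AddMonoidHom.mulLeft A) (wordVal (τ.root k)) u.reverse v
        [τ.blockLast k]
      refine Eq.trans (shSum_congr _ _ _ _ _ fun s hs => ?_) this.symm
      have hs' : s.Perm (u ++ v) := hs.trans ((List.reverse_perm u).append_right v)
      obtain ⟨π', h3, h4, h5⟩ := h2 s hs'
      have hY : τ.IsYoung π' := by
        refine τ.isYoung_of_map_perm fun l => ?_
        by_cases hlk : l = k
        · subst hlk
          rw [h3]
          exact ((List.perm_append_singleton _ s).trans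
            ((hs'.cons _).trans List.perm_middle.symm)).trans hp
        · rw [h4 l hlk]
          exact hπ.map_perm l
      change m (φ (s ++ [τ.blockLast k])) = A * wordVal (τ.root k) (s ++ [τ.blockLast k])
      rw [h5, ih π' s hs' h3 h4 hY, hval π' h4, h3]
  · rw [hm] at h
    obtain ⟨a, _, ha⟩ := Finset.exists_ne_zero_of_sum_ne_zero h
    refine (hD a).support hcomm hdeg fun h0 => ha ?_
    rw [h0, map_zero, mul_zero]

end TypeFunctional
end Kriz

namespace Kriz

/-! ### The action of the block transpositions -/

theorem lt_iff_lt_of_pairwise_map {α : Type*} [LinearOrder α] {l : List α} {f : α → α}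
    (hl : l.Pairwise (· < ·)) (hf : (l.map f).Pairwise (· < ·)) :
    ∀ x ∈ l, ∀ y ∈ l, (f x < f y ↔ x < y) := by
  have key : ∀ x ∈ l, ∀ y ∈ l, x < y → f x < f y := by
    rw [List.pairwise_map] at hf
    induction l with
    | nil => simp
    | cons a l ih =>
      rw [List.pairwise_cons] at hl hf
      intro x hx y hy hxy
      rcases List.mem_cons.mp hx with rfl | hx' <;> rcases List.mem_cons.mp hy with rfl | hy'
      · exact absurd hxy (lt_irrefl _)
      · exact hf.1 y hy'
      · exact absurd hxy (hl.1 x hx').not_gt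
      · exact ih hl.2 hf.2 x hx' y hy' hxy
  intro x hx y hy
  refine ⟨fun h => ?_, key x hx y hy⟩
  rcases lt_trichotomy x y with h' | rfl | h'
  · exact h'
  · exact absurd h (lt_irrefl _)
  · exact absurd h (key y hy x hx h').not_gt

theorem prod_map_comp_swap {K M : Type*} [Field K] [Ring M] [Algebra K M] {t i : ℕ}
    (hi : i + 1 < t) (F : Fin t → M) (c : K)
    (h : F ⟨i + 1, hi⟩ * F ⟨i, by omega⟩ = c • (F ⟨i, by omega⟩ * F ⟨i + 1, hi⟩)) :
    ((List.finRange t).map fun k => F (Equiv.swap (⟨i, by omega⟩ : Fin t) ⟨i + 1, hi⟩ k)).prod =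
      c • ((List.finRange t).map F).prod := by
  have hl : List.finRange t = (List.finRange t).take i ++ (⟨i, by omega⟩ : Fin t) ::
      ⟨i + 1, hi⟩ :: (List.finRange t).drop (i + 1 + 1) := by
    conv_lhs => rw [← List.take_append_drop i (List.finRange t)]
    rw [List.drop_eq_getElem_cons (by simp; omega), List.drop_eq_getElem_cons (by simp; omega),
      List.getElem_finRange, List.getElem_finRange]
    rfl
  have hnd := List.nodup_finRange t
  rw [hl] at hnd ⊢
  set l₁ := (List.finRange t).take i
  set l₂ := (List.finRange t).drop (i + 1 + 1)
  have hd := List.nodup_append.mp hnd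
  rw [List.nodup_cons, List.nodup_cons, List.mem_cons, not_or] at hd
  have h1 : l₁.map (fun k => F (Equiv.swap (⟨i, by omega⟩ : Fin t) ⟨i + 1, hi⟩ k)) = l₁.map F :=
    List.map_congr_left fun k hk => by
      rw [Equiv.swap_apply_of_ne_of_ne (hd.2.2 k hk _ (by simp)) (hd.2.2 k hk _ (by simp))]
  have h2 : l₂.map (fun k => F (Equiv.swap (⟨i, by omega⟩ : Fin t) ⟨i + 1, hi⟩ k)) = l₂.map F :=
    List.map_congr_left fun k hk => by
      rw [Equiv.swap_apply_of_ne_of_ne]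
      · rintro rfl; exact hd.2.1.1.2 hk
      · rintro rfl; exact hd.2.1.2.1 hk
  simp only [List.map_append, List.map_cons, List.prod_append, List.prod_cons, h1, h2,
    Equiv.swap_apply_left, Equiv.swap_apply_right]
  rw [← mul_assoc (F _) (F _), h, ← mul_assoc (F _) (F _), smul_mul_assoc, mul_smul_comm]

section SwapAction

variable {K : Type*} [Field K] {H : Type*} [Ring H] [Algebra K H] (𝒜 : ℕ → Submodule K H)
  {n : ℕ} {ι : Type*} [LinearOrder ι]

/-- Exchanging two adjacent words of the same type produces the sign of their degree. -/
theorem typeVec_mul_blockSwap {deg : ι → ℕ} {x : ι → H} (hx : ∀ h, x h ∈ 𝒜 (deg h))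
    (τ : BambooType n ι) (σ : Equiv.Perm (Fin n)) {i : ℕ} (hi : i + 1 < τ.parts.length)
    (h : τ.parts[i] = τ.parts[i + 1]) :
    typeVec 𝒜 x τ (σ * τ.blockSwap i) =
      (-1 : K) ^ (deg τ.parts[i].2 + (τ.parts[i].1 - 1)) • typeVec 𝒜 x τ σ := by
  rw [typeVec_eq_prod, typeVec_eq_prod]
  have hF : ∀ k : Fin τ.parts.length,
      bamboo 𝒜 (x (τ.part k).2) ((τ.block k).map (σ * τ.blockSwap i : Equiv.Perm (Fin n))) =
        (fun k : Fin τ.parts.length => bamboo 𝒜 (x (τ.part k).2) ((τ.block k).map σ))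
          (Equiv.swap (⟨i, by omega⟩ : Fin τ.parts.length) ⟨i + 1, hi⟩ k) := by
    intro k
    have hp : τ.part k =
        τ.part (Equiv.swap (⟨i, by omega⟩ : Fin τ.parts.length) ⟨i + 1, hi⟩ k) := by
      by_cases hk : k = ⟨i, by omega⟩
      · subst hk
        rw [Equiv.swap_apply_left]
        exact h
      by_cases hk' : k = ⟨i + 1, hi⟩
      · subst hk'
        rw [Equiv.swap_apply_right]
        exact h.symm
      · rw [Equiv.swap_apply_of_ne_of_ne hk hk']
    rw [Equiv.Perm.coe_mul, ← List.map_map, τ.map_blockSwap hi h, hp]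
  rw [List.map_congr_left fun k _ => hF k]
  refine prod_map_comp_swap (K := K) hi
    (fun k : Fin τ.parts.length => bamboo 𝒜 (x (τ.part k).2) ((τ.block k).map σ)) _ ?_
  have hpi : τ.part ⟨i, by omega⟩ = τ.parts[i] := rfl
  have hpi' : τ.part ⟨i + 1, hi⟩ = τ.parts[i] := h.symm
  have hne : ∀ k : Fin τ.parts.length, (τ.block k).map σ ≠ [] := fun k h0 =>
    τ.block_ne_nil k.2 (List.map_eq_nil_iff.mp h0)
  have hc := bamboo_mul_bamboo 𝒜 (hne ⟨i + 1, hi⟩) (hne ⟨i, by omega⟩) (fun a ha ha' => by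
    obtain ⟨a₁, h1, rfl⟩ := List.mem_map.mp ha
    obtain ⟨a₂, h2, h3⟩ := List.mem_map.mp ha'
    rw [σ.injective h3] at h2
    have := τ.block_unique h1 h2
    simp at this) (hx τ.parts[i].2) (hx τ.parts[i].2)
  rw [List.length_map, List.length_map, τ.length_block hi, τ.length_block (i := i) (by omega),
    ← h] at hc
  simp only [hpi, hpi']
  rw [hc]
  congr 1
  -- the exponent is the square of the degree, which has the same parity
  rcases Nat.even_or_odd (deg τ.parts[i].2 + (τ.parts[i].1 - 1)) with he | ho
  · rw [he.neg_one_pow, (he.mul_right _).neg_one_pow]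
  · rw [ho.neg_one_pow, (ho.mul ho).neg_one_pow]

/-- The elements of `N` change the monomials of the type by signs. -/
theorem exists_typeVec_mul_eq {deg : ι → ℕ} {x : ι → H} (hx : ∀ h, x h ∈ 𝒜 (deg h))
    (τ : BambooType n ι) {ν : Equiv.Perm (Fin n)} (hν : ν ∈ τ.N) :
    ∃ s : ℤˣ, ∀ σ, typeVec 𝒜 x τ (σ * ν) = (s : ℤ) • typeVec 𝒜 x τ σ := by
  induction hν using Subgroup.closure_induction with
  | one => exact ⟨1, fun σ => by simp⟩
  | mul y z _ _ hy hz =>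
    obtain ⟨s, hs⟩ := hy
    obtain ⟨s', hs'⟩ := hz
    exact ⟨s' * s, fun σ => by rw [← mul_assoc, hs', hs, smul_smul, Units.val_mul]⟩
  | inv y _ hy =>
    obtain ⟨s, hs⟩ := hy
    refine ⟨s, fun σ => ?_⟩
    have := hs (σ * y⁻¹)
    rw [inv_mul_cancel_right] at this
    rw [this, smul_smul, ← Units.val_mul, Int.units_mul_self, Units.val_one, one_smul]
  | mem y hy =>
    obtain ⟨i, hi, h, rfl⟩ := hy
    rcases neg_one_pow_eq_or K (deg τ.parts[i].2 + (τ.parts[i].1 - 1)) with hk | hk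
    · exact ⟨1, fun σ => by rw [typeVec_mul_blockSwap 𝒜 hx τ σ hi h, hk]; simp⟩
    · refine ⟨-1, fun σ => ?_⟩
      rw [typeVec_mul_blockSwap 𝒜 hx τ σ hi h, hk]
      exact (neg_one_smul K (typeVec 𝒜 x τ σ)).trans (neg_one_smul ℤ (typeVec 𝒜 x τ σ)).symm

end SwapAction

/-! ### Permutations of the blocks -/

namespace BambooType

variable {n : ℕ} {ι : Type*} [LinearOrder ι] (τ : BambooType n ι)

/-- The permutations which permute the blocks, preserving the parts. -/
def PermutesBlocks (σ : Equiv.Perm (Fin n)) : Prop :=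
  ∃ β : Equiv.Perm (Fin τ.parts.length), (∀ k, τ.part (β k) = τ.part k) ∧
    ∀ i, τ.blockIdx (σ i) = β (τ.blockIdx i)

variable {τ}

theorem MovesBlocks.blockIdx_apply {σ : Equiv.Perm (Fin n)}
    {β : Equiv.Perm (Fin τ.parts.length)} (h : τ.MovesBlocks σ β) (i : Fin n) :
    τ.blockIdx (σ i) = β (τ.blockIdx i) := by
  rw [← τ.mem_block_iff, ← h]
  exact List.mem_map_of_mem (τ.mem_block_blockIdx i)

theorem IsYoung.permutesBlocks {π : Equiv.Perm (Fin n)} (h : τ.IsYoung π) : τ.PermutesBlocks π :=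
  ⟨1, fun _ => rfl, h⟩

theorem permutesBlocks_of_mem_N {ν : Equiv.Perm (Fin n)} (h : ν ∈ τ.N) : τ.PermutesBlocks ν := by
  obtain ⟨β, h1, h2⟩ := τ.exists_movesBlocks_of_mem_N h
  exact ⟨β, h2, h1.blockIdx_apply⟩

theorem PermutesBlocks.mul {σ σ' : Equiv.Perm (Fin n)} (h : τ.PermutesBlocks σ)
    (h' : τ.PermutesBlocks σ') : τ.PermutesBlocks (σ * σ') := by
  obtain ⟨β, h1, h2⟩ := h
  obtain ⟨β', h1', h2'⟩ := h'
  exact ⟨β * β', fun k => by rw [Equiv.Perm.mul_apply, h1, h1'],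
    fun i => by rw [Equiv.Perm.mul_apply, Equiv.Perm.mul_apply, h2, h2']⟩

theorem PermutesBlocks.inv {σ : Equiv.Perm (Fin n)} (h : τ.PermutesBlocks σ) :
    τ.PermutesBlocks σ⁻¹ := by
  obtain ⟨β, h1, h2⟩ := h
  refine ⟨β⁻¹, fun k => ?_, fun i => ?_⟩
  · rw [← h1, ← Equiv.Perm.mul_apply, mul_inv_cancel, Equiv.Perm.one_apply]
  · rw [Equiv.Perm.eq_inv_iff_eq, ← h2, ← Equiv.Perm.mul_apply, mul_inv_cancel,
      Equiv.Perm.one_apply]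

theorem isYoung_of_mem_C {c : Equiv.Perm (Fin n)} (h : c ∈ τ.C) : τ.IsYoung c := fun i => by
  rw [← τ.mem_block_iff, τ.mem_block_of_mem_C h]
  exact τ.mem_block_blockIdx i

theorem IsYoung.mul {σ σ' : Equiv.Perm (Fin n)} (h : τ.IsYoung σ) (h' : τ.IsYoung σ') :
    τ.IsYoung (σ * σ') := fun i => by rw [Equiv.Perm.mul_apply, h, h']

theorem PermutesBlocks.exists_eq_mul {σ : Equiv.Perm (Fin n)} (h : τ.PermutesBlocks σ) :
    ∃ ν ∈ τ.N, ∃ π, τ.IsYoung π ∧ σ = π * ν := by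
  obtain ⟨β, h1, h2⟩ := h
  obtain ⟨ν, hν, hβ⟩ := τ.exists_mem_N_of_perm β h1
  refine ⟨ν, hν, σ * ν⁻¹, fun i => ?_, by group⟩
  have h3 := hβ.blockIdx_apply (ν⁻¹ i)
  rw [← Equiv.Perm.mul_apply, mul_inv_cancel, Equiv.Perm.one_apply] at h3
  rw [Equiv.Perm.mul_apply, h2, h3]

theorem isYoung_conj {ν π : Equiv.Perm (Fin n)} (hν : ν ∈ τ.N) (hπ : τ.IsYoung π) :
    τ.IsYoung (ν * π * ν⁻¹) := by
  obtain ⟨β, hβ, _⟩ := τ.exists_movesBlocks_of_mem_N hν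
  intro i
  rw [Equiv.Perm.mul_apply, Equiv.Perm.mul_apply, hβ.blockIdx_apply, hπ, ← hβ.blockIdx_apply,
    ← Equiv.Perm.mul_apply, mul_inv_cancel, Equiv.Perm.one_apply]

/-- Conjugation by an element of `N` permutes the words, up to a relabelling preserving the
order. -/
theorem wordProd_conj {ν π : Equiv.Perm (Fin n)} (hν : ν ∈ τ.N) (hπ : τ.IsYoung π) :
    τ.wordProd (ν * π * ν⁻¹) = τ.wordProd π := by
  obtain ⟨β, hβ, hp⟩ := τ.exists_movesBlocks_of_mem_N hν
  rw [wordProd, wordProd, ← Equiv.prod_comp β]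
  refine Finset.prod_congr rfl fun k _ => ?_
  have hr : τ.root (β k) = τ.root k := by rw [root, hp, root]
  have hw : (τ.block (β k)).map (ν * π * ν⁻¹ : Equiv.Perm (Fin n)) =
      ((τ.block k).map π).map ν := by
    rw [← hβ k, List.map_map, List.map_map]
    exact List.map_congr_left fun i _ => by simp
  rw [hr, hw]
  refine wordVal_map _ _ _ fun x hx y hy => ?_
  refine lt_iff_lt_of_pairwise_map (τ.block_pairwise k) ?_ x ((hπ.map_perm k).subset hx) y
    ((hπ.map_perm k).subset hy)
  rw [hβ k]
  exact τ.block_pairwise _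

/-- Multiplication by a block cycle: in one of the words the letters are shifted cyclically. -/
theorem wordProd_blockCycle_mul {π : Equiv.Perm (Fin n)} (hπ : τ.IsYoung π)
    (k : Fin τ.parts.length) :
    τ.wordProd (τ.blockCycle k * π) =
      (-1) ^ ((τ.part k).1 - 1) * τ.root k * τ.wordProd π := by
  have h1 := τ.map_blockCycle_pow_self k 1
  have h2 := fun l (hne : (k : ℕ) ≠ l) a (ha : a ∈ τ.block l) =>
    τ.blockCycle_pow_apply_of_notMem (i := k) (a := a) 1 fun h' => hne (τ.block_unique h' ha)
  simp only [pow_one] at h1 h2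
  rw [wordProd, wordProd, ← Finset.mul_prod_erase _ _ (Finset.mem_univ k),
    ← Finset.mul_prod_erase _ _ (Finset.mem_univ k), ← mul_assoc]
  congr 1
  · have hp := hπ.map_perm k
    obtain ⟨u, v, huv⟩ := List.append_of_mem (hp.mem_iff.mpr (τ.blockLast_mem k))
    have hlen : u.length + v.length + 1 = (τ.part k).1 := by
      rw [← τ.length_block_eq, ← hp.length_eq, huv]
      simp only [List.length_append, List.length_cons]
      omega
    have hnd := (τ.nodup_block k).map π.injective
    rw [huv] at hnd
    have hp' : (u ++ v).Perm (τ.block k).dropLast := by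
      rw [huv, ← τ.dropLast_append_blockLast k] at hp
      exact ((List.perm_middle.symm.trans hp).trans (List.perm_append_singleton _ _)).cons_inv
    have hb := τ.block_pairwise k
    obtain ⟨a, l, hal⟩ := List.exists_cons_of_ne_nil (τ.block_ne_nil k.2)
    have hmap : (τ.block k).dropLast.map (τ.blockCycle k) = l ∧
        τ.blockCycle k (τ.blockLast k) = a := by
      have h3 : (τ.block k).dropLast.map (τ.blockCycle k) ++ [τ.blockCycle k (τ.blockLast k)] =
          l ++ [a] := by
        rw [← List.map_singleton, ← List.map_append, τ.dropLast_append_blockLast, h1, hal]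
        simp
      have h4 := List.append_inj' h3 rfl
      exact ⟨h4.1, by simpa using h4.2⟩
    have hz : ∀ x ∈ u ++ v, x < τ.blockLast k := by
      intro x hx
      rw [← τ.dropLast_append_blockLast k] at hb
      exact (List.pairwise_append.mp hb).2.2 x (hp'.subset hx) _ (by simp)
    have hal' : l.Pairwise (· < ·) ∧ ∀ x ∈ l, a < x := by
      rw [hal] at hb
      exact ⟨(List.pairwise_cons.mp hb).2, (List.pairwise_cons.mp hb).1⟩
    rw [Equiv.Perm.coe_mul, ← List.map_map, huv]
    have hlen' : u.length + v.length = (τ.part k).1 - 1 := by omega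
    rw [wordVal_cyclic_shift (inv_mul_cancel₀ (τ.root_ne_zero k)) u v _ ?_ hnd hz, hlen']
    · intro x hx y hy
      exact lt_iff_lt_of_pairwise_map (hb.sublist (List.dropLast_sublist _))
        (by rw [hmap.1]; exact hal'.1) x (hp'.subset hx) y (hp'.subset hy)
    · intro x hx
      rw [hmap.2]
      refine hal'.2 _ ?_
      rw [← hmap.1]
      exact List.mem_map_of_mem (hp'.subset hx)
    · rw [hlen]
      exact (τ.isPrimitiveRoot_root k).pow_eq_one
  · refine Finset.prod_congr rfl fun l hl => ?_
    congr 1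
    refine List.map_congr_left fun i hi => ?_
    rw [Equiv.Perm.mul_apply]
    refine h2 l (fun h => Finset.ne_of_mem_erase hl (Fin.ext h.symm)) _ ?_
    exact (hπ.map_perm l).subset (List.mem_map_of_mem hi)

end BambooType
end Kriz

namespace Kriz

/-! ### The character of the functional of a type -/

namespace BambooType

variable {n : ℕ} {ι : Type*} [LinearOrder ι] {τ : BambooType n ι}

/-- The values of `ξ` on the generators determine it. -/
theorem IsXi.unique {deg : ι → ℕ} {ξ ξ' : τ.Z →* ℂˣ} (h : τ.IsXi deg ξ) (h' : τ.IsXi deg ξ') :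
    ξ = ξ' := by
  have hle : τ.Z ≤ (MonoidHom.eqLocus ξ ξ').map τ.Z.subtype := by
    refine sup_le ?_ ?_
    · rw [C, Subgroup.closure_le]
      rintro _ ⟨i, hi, rfl⟩
      exact ⟨⟨_, τ.blockCycle_mem hi⟩,
        Units.ext ((h.on_cycle i hi).trans (h'.on_cycle i hi).symm), rfl⟩
    · rw [N, Subgroup.closure_le]
      rintro _ ⟨i, hi, hp, rfl⟩
      refine ⟨⟨_, τ.blockSwap_mem hi hp⟩, Units.ext ?_, rfl⟩
      rcases Nat.even_or_odd (deg τ.parts[i].2) with he | ho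
      · exact (h.on_swap_even i hi hp he).trans (h'.on_swap_even i hi hp he).symm
      · exact (h.on_swap_odd i hi hp ho).trans (h'.on_swap_odd i hi hp ho).symm
  ext z
  obtain ⟨z', h1, h2⟩ := hle z.2
  have : z' = z := Subtype.ext h2
  rw [← this]
  exact congrArg Units.val h1

end BambooType

/-- A functional on a representation which is an eigenvector of each element of a subgroup `Z`
determines a linear character of `Z`. -/
theorem exists_monoidHom_of_eigen {K G V : Type*} [Field K] [Algebra K ℂ] [Group G]
    [AddCommGroup V] [Module K V] (ρ : Representation K G V) (Z : Subgroup G) (m : V →ₗ[K] ℂ)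
    (hm : m ≠ 0) (h : ∀ z ∈ Z, ∃ c : ℂˣ, ∀ x, m (ρ z x) = c * m x) :
    ∃ ξ : Z →* ℂˣ, ∀ (z : Z) x, m (ρ z x) = ξ z * m x := by
  choose c hc using h
  obtain ⟨x, hx⟩ : ∃ x, m x ≠ 0 := by
    by_contra! h0
    exact hm (LinearMap.ext h0)
  refine ⟨MonoidHom.mk' (fun z => c z z.2) fun z z' => Units.ext ?_, fun z x => hc z z.2 x⟩
  apply mul_right_cancel₀ hx
  rw [← hc _ (z * z').2 x, Subgroup.coe_mul, map_mul, Module.End.mul_apply, hc z z.2, hc z' z'.2,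
    Units.val_mul, mul_assoc]

section TypeFunctional

variable {K : Type*} [Field K] [Algebra K ℂ] {H : Type*} [Ring H] [Algebra K H]
  (𝒜 : ℕ → Submodule K H) [GradedAlgebra 𝒜] {n : ℕ} {ι : Type*} [Fintype ι] [LinearOrder ι]
  {b : Module.Basis ι K H} {deg : ι → ℕ}

/-- For each type there are the character `ξ` and a `ξ`-equivariant functional which vanishes on
the monomials of all the other types. -/
theorem exists_xi_functional
    (hcomm : ∀ (d e : ℕ) (x y : H), x ∈ 𝒜 d → y ∈ 𝒜 e → x * y = (-1 : K) ^ (d * e) • (y * x))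
    (hdeg : ∀ i, b i ∈ 𝒜 (deg i)) (τ : BambooType n ι) :
    ∃ (ξ : τ.Z →* ℂˣ) (m : Model 𝒜 n →ₗ[K] ℂ), τ.IsXi deg ξ ∧
      (∀ (z : τ.Z) x, m (rep 𝒜 n z x) = ξ z * m x) ∧
      (∀ π, τ.IsYoung π → m (typeVec 𝒜 b τ π) = τ.wordProd π) ∧
      (∀ (τ' : BambooType n ι) (σ : Equiv.Perm (Fin n)), τ ≠ τ' → m (typeVec 𝒜 b τ' σ) = 0) ∧
      ∀ σ : Equiv.Perm (Fin n), m (typeVec 𝒜 b τ σ) ≠ 0 → τ.PermutesBlocks σ := by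
  obtain ⟨m, hval, hsupp⟩ := exists_typeFunctional 𝒜 hcomm hdeg τ
  have hother : ∀ (τ' : BambooType n ι) (σ : Equiv.Perm (Fin n)), τ ≠ τ' →
      m (typeVec 𝒜 b τ' σ) = 0 := by
    intro τ' σ hne
    by_contra h0
    exact hne (hsupp τ' σ h0).1.symm
  have hperm : ∀ σ : Equiv.Perm (Fin n), m (typeVec 𝒜 b τ σ) ≠ 0 → τ.PermutesBlocks σ := by
    intro σ h0
    obtain ⟨-, g, hg, h1, h2⟩ := hsupp τ σ h0
    exact ⟨Equiv.ofBijective g hg, fun k => (h1 k).symm, h2⟩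
  -- an eigenvector equation can be checked on the permutations preserving the blocks
  have heig : ∀ (z : Equiv.Perm (Fin n)) (c : ℂ), τ.PermutesBlocks z →
      (∀ π, τ.IsYoung π → m (typeVec 𝒜 b τ (z * π)) = c * τ.wordProd π) →
      ∀ x, m (rep 𝒜 n z x) = c * m x := by
    intro z c hz h x
    have hx : x ∈ Submodule.span K
        {z : Model 𝒜 n | ∃ (τ : BambooType n ι) (σ : _), z = typeVec 𝒜 b τ σ} := by
      rw [span_typeVec 𝒜 b hdeg hcomm]
      trivial
    induction hx using Submodule.span_induction with
    | mem x hx =>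
      obtain ⟨τ', σ, rfl⟩ := hx
      rw [rep_typeVec]
      by_cases hne : τ = τ'
      · subst hne
        by_cases hσ : τ.PermutesBlocks σ
        · obtain ⟨ν, hν, π, hπ, rfl⟩ := hσ.exists_eq_mul
          obtain ⟨s, hs⟩ := exists_typeVec_mul_eq 𝒜 hdeg τ hν
          rw [← mul_assoc, hs, hs, map_zsmul, map_zsmul, h π hπ, hval π hπ]
          exact (mul_smul_comm _ _ _).symm
        · have h1 : m (typeVec 𝒜 b τ σ) = 0 := by
            by_contra h0
            exact hσ (hperm _ h0)
          have h2 : m (typeVec 𝒜 b τ (z * σ)) = 0 := by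
            by_contra h0
            apply hσ
            have h3 := hz.inv.mul (hperm _ h0)
            rwa [inv_mul_cancel_left] at h3
          rw [h1, h2, mul_zero]
      · rw [hother _ _ hne, hother _ _ hne, mul_zero]
    | zero => simp
    | add x y _ _ hx hy => rw [map_add, map_add, map_add, hx, hy, mul_add]
    | smul a x _ hx => rw [map_smul, map_smul, map_smul, hx, mul_smul_comm]
  have hcyc : ∀ (k : Fin τ.parts.length) x, m (rep 𝒜 n (τ.blockCycle k) x) =
      (-1) ^ ((τ.part k).1 - 1) * τ.root k * m x := by
    intro k
    have hC : τ.blockCycle k ∈ τ.C := Subgroup.subset_closure ⟨k, k.2, rfl⟩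
    have hY := BambooType.isYoung_of_mem_C hC
    refine heig _ _ hY.permutesBlocks fun π hπ => ?_
    rw [hval _ (hY.mul hπ), BambooType.wordProd_blockCycle_mul hπ]
  have hN : ∀ ν ∈ τ.N, ∀ s : ℤ, (∀ σ, typeVec 𝒜 b τ (σ * ν) = s • typeVec 𝒜 b τ σ) →
      ∀ x, m (rep 𝒜 n ν x) = s * m x := by
    intro ν hν s hs
    refine heig _ _ (BambooType.permutesBlocks_of_mem_N hν) fun π hπ => ?_
    have : ν * π = ν * π * ν⁻¹ * ν := by group
    rw [this, hs, map_zsmul, hval _ (BambooType.isYoung_conj hν hπ), BambooType.wordProd_conj hν hπ,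
      zsmul_eq_mul]
  have hone : m (typeVec 𝒜 b τ 1) ≠ 0 := by
    rw [hval 1 fun _ => rfl]
    exact τ.wordProd_ne_zero 1
  have hm0 : m ≠ 0 := by
    rintro rfl
    exact hone rfl
  let S : Subgroup (Equiv.Perm (Fin n)) :=
    { carrier := {z | ∃ c : ℂˣ, ∀ x, m (rep 𝒜 n z x) = c * m x}
      one_mem' := ⟨1, fun x => by simp⟩
      mul_mem' := by
        rintro z z' ⟨c, hc⟩ ⟨c', hc'⟩
        exact ⟨c * c', fun x => by
          rw [map_mul, Module.End.mul_apply, hc, hc', Units.val_mul, mul_assoc]⟩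
      inv_mem' := by
        rintro z ⟨c, hc⟩
        refine ⟨c⁻¹, fun x => ?_⟩
        have h1 := hc (rep 𝒜 n z⁻¹ x)
        rw [← Module.End.mul_apply, ← map_mul, mul_inv_cancel, map_one, Module.End.one_apply] at h1
        rw [h1, Units.inv_mul_cancel_left] }
  have hZS : τ.Z ≤ S := by
    refine sup_le ?_ ?_
    · rw [BambooType.C, Subgroup.closure_le]
      rintro _ ⟨i, hi, rfl⟩
      have hu : (-1 : ℂ) ^ ((τ.part ⟨i, hi⟩).1 - 1) * τ.root ⟨i, hi⟩ ≠ 0 :=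
        mul_ne_zero (pow_ne_zero _ (by norm_num)) (τ.root_ne_zero _)
      exact ⟨Units.mk0 _ hu, hcyc ⟨i, hi⟩⟩
    · intro ν hν
      obtain ⟨s, hs⟩ := exists_typeVec_mul_eq 𝒜 hdeg τ hν
      have hs0 : ((s : ℤ) : ℂ) ≠ 0 := by exact_mod_cast s.ne_zero
      exact ⟨Units.mk0 _ hs0, hN ν hν s hs⟩
  obtain ⟨ξ, hξ⟩ := exists_monoidHom_of_eigen (rep 𝒜 n) τ.Z m hm0 fun z hz => hZS hz
  have hswap : ∀ (i : ℕ) (hi : i + 1 < τ.parts.length) (h : τ.parts[i] = τ.parts[i + 1]),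
      (ξ ⟨τ.blockSwap i, τ.blockSwap_mem hi h⟩ : ℂ) =
        (-1) ^ (deg τ.parts[i].2 + (τ.parts[i].1 - 1)) := by
    intro i hi h
    apply mul_right_cancel₀ hone
    rw [← hξ]
    have hs : ∀ σ, typeVec 𝒜 b τ (σ * τ.blockSwap i) =
        (-1 : ℤ) ^ (deg τ.parts[i].2 + (τ.parts[i].1 - 1)) • typeVec 𝒜 b τ σ := by
      intro σ
      rw [typeVec_mul_blockSwap 𝒜 hdeg τ σ hi h]
      rcases Nat.even_or_odd (deg τ.parts[i].2 + (τ.parts[i].1 - 1)) with he | ho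
      · rw [he.neg_one_pow, he.neg_one_pow, one_smul, one_smul]
      · rw [ho.neg_one_pow, ho.neg_one_pow]
        exact (neg_one_smul K (typeVec 𝒜 b τ σ)).trans (neg_one_smul ℤ (typeVec 𝒜 b τ σ)).symm
    have h1 := hN _ (Subgroup.subset_closure ⟨i, hi, h, rfl⟩) _ hs (typeVec 𝒜 b τ 1)
    push_cast at h1
    exact h1
  refine ⟨ξ, m, ⟨fun i hi => ?_, fun i hi h he => ?_, fun i hi h ho => ?_⟩, hξ, hval, hother, hperm⟩
  · apply mul_right_cancel₀ hone
    rw [← hξ]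
    refine (hcyc ⟨i, hi⟩ _).trans ?_
    rw [BambooType.blockCycle, BambooType.sign_formPerm _ (τ.nodup_block i), τ.length_block hi]
    push_cast
    rw [mul_comm ((-1 : ℂ) ^ _)]
    rfl
  · have hpos := τ.pos _ (List.getElem_mem (show i < τ.parts.length by omega))
    rw [hswap i hi h, pow_add, he.neg_one_pow, one_mul]
    obtain ⟨l, hl⟩ := Nat.exists_eq_add_of_le' hpos
    rw [hl, Nat.add_sub_cancel, pow_add, pow_add]
    norm_num
  · have hpos := τ.pos _ (List.getElem_mem (show i < τ.parts.length by omega))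
    rw [hswap i hi h, pow_add, ho.neg_one_pow]
    obtain ⟨l, hl⟩ := Nat.exists_eq_add_of_le' hpos
    rw [hl, Nat.add_sub_cancel, pow_add]
    ring

end TypeFunctional
end Kriz

namespace Kriz

/-! ### Separating the cosets -/

namespace BambooType

variable {n : ℕ} {ι : Type*} [LinearOrder ι] {τ : BambooType n ι}

theorem map_mul_cyclePow (π : Equiv.Perm (Fin n)) (j : Fin τ.parts.length → ℕ)
    (k : Fin τ.parts.length) : (τ.block k).map (π * τ.cyclePow j : Equiv.Perm (Fin n)) =
      ((τ.block k).map π).rotate (j k) := by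
  rw [Equiv.Perm.coe_mul, ← List.map_map, τ.map_cyclePow, List.map_rotate]

/-- The indices of the exponents of the products of powers of the block cycles. -/
def exponents (τ : BambooType n ι) : Finset (Fin τ.parts.length → ℕ) :=
  Fintype.piFinset fun k => Finset.range (τ.part k).1

/-- The coefficients of (a multiple of) the projection to the eigenspace of `C` with the
character `ξ`. -/
noncomputable def cycleWeight (τ : BambooType n ι) (j : Fin τ.parts.length → ℕ) : ℂ :=
  ∏ k : Fin τ.parts.length, ((-1) ^ ((τ.part k).1 - 1) * (τ.root k)⁻¹) ^ j k

theorem sum_cycleWeight_mul_wordProd (π : Equiv.Perm (Fin n)) :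
    ∑ j ∈ τ.exponents, τ.cycleWeight j * τ.wordProd (π * τ.cyclePow j) =
      ∏ k : Fin τ.parts.length, ∑ i ∈ Finset.range ((τ.block k).map π).length,
        ((-1) ^ (((τ.block k).map π).length - 1) * (τ.root k)⁻¹) ^ i *
          wordVal (τ.root k) (((τ.block k).map π).rotate i) := by
  simp only [List.length_map, τ.length_block_eq]
  rw [Finset.prod_univ_sum]
  refine Finset.sum_congr rfl fun j _ => ?_
  rw [cycleWeight, wordProd, ← Finset.prod_mul_distrib]
  exact Finset.prod_congr rfl fun k _ => by rw [map_mul_cyclePow]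

theorem sum_cycleWeight_one_ne_zero (τ : BambooType n ι) :
    ∑ j ∈ τ.exponents, τ.cycleWeight j * τ.wordProd (1 * τ.cyclePow j) ≠ 0 := by
  rw [sum_cycleWeight_mul_wordProd, Finset.prod_ne_zero_iff]
  intro k _
  have h1 : (τ.block k).map (1 : Equiv.Perm (Fin n)) = τ.block k := by simp
  rw [h1]
  refine sum_rotate_ne_zero_of_sorted (inv_mul_cancel₀ (τ.root_ne_zero k)) _ (τ.block_ne_nil k.2)
    (τ.block_pairwise k) ?_
  rw [τ.length_block_eq]
  exact τ.isPrimitiveRoot_root k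

theorem mem_C_of_sum_cycleWeight_ne_zero {π : Equiv.Perm (Fin n)} (hπ : τ.IsYoung π)
    (h : ∑ j ∈ τ.exponents, τ.cycleWeight j * τ.wordProd (π * τ.cyclePow j) ≠ 0) : π ∈ τ.C := by
  rw [sum_cycleWeight_mul_wordProd, Finset.prod_ne_zero_iff] at h
  refine τ.mem_C_of_forall_rotate fun k => ?_
  obtain ⟨i, hi⟩ := exists_rotate_sorted_of_sum_ne_zero (inv_mul_cancel₀ (τ.root_ne_zero k)) _
    ((τ.nodup_block k).map π.injective) (by
      rw [List.length_map, τ.length_block_eq]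
      exact τ.isPrimitiveRoot_root k) (h k (Finset.mem_univ k))
  have hp : (((τ.block k).map π).rotate i).Perm (τ.block k) :=
    (List.rotate_perm _ _).trans (hπ.map_perm k)
  have heq := List.Perm.eq_of_pairwise (le := (· < ·)) (fun x y _ _ h h' => absurd h' h.asymm)
    hi (τ.block_pairwise k) hp
  exact ⟨_, List.rotate_eq_iff.mp heq⟩

/-! ### Representatives of the cosets -/

/-- On each block, `σ` takes its greatest value at the last element. -/
def IsTopped (τ : BambooType n ι) (σ : Equiv.Perm (Fin n)) : Prop :=
  ∀ k : Fin τ.parts.length, ∀ i ∈ τ.block k, σ i ≤ σ (τ.blockLast k)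

theorem exists_greatest (τ : BambooType n ι) (σ : Equiv.Perm (Fin n))
    (k : Fin τ.parts.length) : ∃ y ∈ (τ.block k).map σ, ∀ i ∈ τ.block k, σ i ≤ y := by
  obtain ⟨a, ha, h⟩ := (τ.block k).toFinset.exists_max_image σ
    ⟨_, List.mem_toFinset.mpr (τ.blockLast_mem k)⟩
  exact ⟨σ a, List.mem_map_of_mem (List.mem_toFinset.mp ha),
    fun i hi => h i (List.mem_toFinset.mpr hi)⟩

theorem isTopped_of_forall_eq_append {σ : Equiv.Perm (Fin n)} {y : Fin τ.parts.length → Fin n}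
    (h : ∀ k : Fin τ.parts.length, ∃ s, (τ.block k).map σ = s ++ [y k])
    (hy : ∀ k : Fin τ.parts.length, ∀ i ∈ τ.block k, σ i ≤ y k) : τ.IsTopped σ := by
  intro k i hi
  obtain ⟨s, hs⟩ := h k
  rw [← τ.dropLast_append_blockLast k, List.map_append] at hs
  have h1 := (List.append_inj' hs rfl).2
  rw [List.map_singleton, List.singleton_inj] at h1
  rw [h1]
  exact hy k i hi

theorem exists_isTopped_mul (τ : BambooType n ι) (σ : Equiv.Perm (Fin n)) :
    ∃ c ∈ τ.C, τ.IsTopped (σ * c) := by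
  choose y hy hle using τ.exists_greatest σ
  choose u v huv using fun k : Fin τ.parts.length => List.append_of_mem (hy k)
  refine ⟨_, τ.cyclePow_mem fun k => (u k ++ [y k]).length,
    isTopped_of_forall_eq_append (y := y) (fun k => ⟨v k ++ u k, ?_⟩) fun k i hi => ?_⟩
  · have : u k ++ y k :: v k = (u k ++ [y k]) ++ v k := by simp
    rw [map_mul_cyclePow, huv, this, List.rotate_append_length_eq, List.append_assoc]
  · have hC := τ.cyclePow_mem fun k => (u k ++ [y k]).length
    exact hle k _ ((τ.mem_block_of_mem_C hC k i).mpr hi)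

theorem exists_rotate_of_mem_C {c : Equiv.Perm (Fin n)} (hc : c ∈ τ.C) (k : Fin τ.parts.length) :
    ∃ j, (τ.block k).map c = (τ.block k).rotate j := by
  induction hc using Subgroup.closure_induction with
  | one => exact ⟨0, by simp⟩
  | mul x y _ _ hx hy =>
    obtain ⟨j, hj⟩ := hx
    obtain ⟨j', hj'⟩ := hy
    exact ⟨j + j', by
      rw [Equiv.Perm.coe_mul, ← List.map_map, hj', List.map_rotate, hj, List.rotate_rotate]⟩
  | inv x _ hx =>
    obtain ⟨j, hj⟩ := hx
    refine ⟨_, (List.rotate_eq_iff (n := j)).mp ?_⟩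
    rw [← List.map_rotate, ← hj, List.map_map]
    conv_rhs => rw [← List.map_id (τ.block k)]
    exact List.map_congr_left fun a _ => by simp
  | mem x hx =>
    obtain ⟨i, hi, rfl⟩ := hx
    by_cases hik : i = k
    · subst hik
      refine ⟨1, ?_⟩
      have := τ.map_blockCycle_pow_self k 1
      rwa [pow_one] at this
    · refine ⟨0, ?_⟩
      rw [List.rotate_zero]
      have := τ.map_blockCycle_pow_of_ne hik 1
      rwa [pow_one] at this

theorem eq_one_of_mem_C {c : Equiv.Perm (Fin n)} (hc : c ∈ τ.C)
    (h : ∀ k, c (τ.blockLast k) = τ.blockLast k) : c = 1 := by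
  refine τ.perm_ext_blocks fun k => ?_
  obtain ⟨j, hj⟩ := exists_rotate_of_mem_C hc k
  have hpos : 0 < (τ.block k).length := List.length_pos_iff.mpr (τ.block_ne_nil k.2)
  have h1 : ((τ.block k).map c)[(τ.block k).length - 1]'(by simp; omega) =
      (τ.block k)[(τ.block k).length - 1] := by
    rw [List.getElem_map, ← List.getLast_eq_getElem (τ.block_ne_nil k.2)]
    exact h k
  simp only [hj, List.getElem_rotate] at h1
  have h2 := (τ.nodup_block k).getElem_inj_iff.mp h1
  have h3 : j % (τ.block k).length = 0 := by
    have h4 : ((τ.block k).length - 1 + j) % (τ.block k).length =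
        ((τ.block k).length - 1 + 0) % (τ.block k).length := by
      rw [h2, add_zero, Nat.mod_eq_of_lt (by omega)]
    exact Nat.ModEq.add_left_cancel' ((τ.block k).length - 1) h4
  rw [hj, ← List.rotate_mod, h3, List.rotate_zero]
  simp

theorem MovesBlocks.apply_blockLast {ν : Equiv.Perm (Fin n)}
    {β : Equiv.Perm (Fin τ.parts.length)} (h : τ.MovesBlocks ν β) (k : Fin τ.parts.length) :
    ν (τ.blockLast k) = τ.blockLast (β k) := by
  have h1 := h k
  rw [← τ.dropLast_append_blockLast k, ← τ.dropLast_append_blockLast (β k), List.map_append] at h1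
  have h2 := (List.append_inj' h1 rfl).2
  simpa using h2

theorem IsTopped.mul_of_mem_N {σ ν : Equiv.Perm (Fin n)} (h : τ.IsTopped σ) (hν : ν ∈ τ.N) :
    τ.IsTopped (σ * ν) := by
  obtain ⟨β, hβ, _⟩ := τ.exists_movesBlocks_of_mem_N hν
  intro k i hi
  rw [Equiv.Perm.mul_apply, Equiv.Perm.mul_apply, hβ.apply_blockLast]
  refine h _ _ ?_
  rw [← hβ k]
  exact List.mem_map_of_mem hi

theorem exists_eq_mul_of_mem_Z {z : Equiv.Perm (Fin n)} (hz : z ∈ τ.Z) :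
    ∃ c ∈ τ.C, ∃ ν ∈ τ.N, z = c * ν := by
  have h : z ∈ ((τ.C ⊔ τ.N : Subgroup (Equiv.Perm (Fin n))) : Set (Equiv.Perm (Fin n))) := hz
  rw [Subgroup.coe_mul_of_right_le_normalizer_left _ _ τ.N_le_normalizer_C] at h
  obtain ⟨c, hc, ν, hν, rfl⟩ := Set.mem_mul.mp h
  exact ⟨c, hc, ν, hν, rfl⟩

/-- In each coset of `Z`, the permutations taking their greatest values at the ends of the blocks
form a single coset of `N`. -/
theorem IsTopped.inv_mul_mem_N {σ σ' : Equiv.Perm (Fin n)} (h : τ.IsTopped σ)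
    (h' : τ.IsTopped σ') (hz : σ⁻¹ * σ' ∈ τ.Z) : σ⁻¹ * σ' ∈ τ.N := by
  obtain ⟨c, hc, ν, hν, heq⟩ := exists_eq_mul_of_mem_Z hz
  have hσ : σ * c = σ' * ν⁻¹ := by
    rw [eq_mul_inv_iff_mul_eq, mul_assoc, ← heq, mul_inv_cancel_left]
  have ht : τ.IsTopped (σ * c) := by
    rw [hσ]
    exact h'.mul_of_mem_N (inv_mem hν)
  have hc1 : c = 1 := by
    refine eq_one_of_mem_C hc fun k => σ.injective (le_antisymm ?_ ?_)
    · exact h k _ ((τ.mem_block_of_mem_C hc k _).mpr (τ.blockLast_mem k))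
    · have h1 := ht k (c⁻¹ (τ.blockLast k))
        ((τ.mem_block_of_mem_C (inv_mem hc) k _).mpr (τ.blockLast_mem k))
      rwa [Equiv.Perm.mul_apply, Equiv.Perm.mul_apply, ← Equiv.Perm.mul_apply c,
        mul_inv_cancel, Equiv.Perm.one_apply] at h1
  rw [heq, hc1, one_mul]
  exact hν

end BambooType

section CosetVectors

variable {K : Type*} [Field K] {H : Type*} [Ring H] [Algebra K H] (𝒜 : ℕ → Submodule K H)
  {n : ℕ} {ι : Type*} [LinearOrder ι]

/-- By the shuffle expansion with respect to the greatest letter of each word. -/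
theorem typeVec_mem_span_isTopped {deg : ι → ℕ} {x : ι → H} (hx : ∀ h, x h ∈ 𝒜 (deg h))
    (τ : BambooType n ι) (σ : Equiv.Perm (Fin n)) :
    typeVec 𝒜 x τ σ ∈ Submodule.span K (typeVec 𝒜 x τ '' {σ' | τ.IsTopped σ'}) := by
  choose y hy hle using τ.exists_greatest σ
  refine τ.word_induction y (P := fun σ =>
    (∀ k : Fin τ.parts.length, ∀ i ∈ τ.block k, σ i ≤ y k) → typeVec 𝒜 x τ σ ∈
      Submodule.span K (typeVec 𝒜 x τ '' {σ' | τ.IsTopped σ'})) ?_ ?_ σ hy hle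
  · intro σ hlast hle
    refine Submodule.subset_span ⟨σ, fun k i hi => ?_, rfl⟩
    rw [hlast]
    exact hle k i hi
  · intro σ k u v huv ih hle
    obtain ⟨φ, h1, h2⟩ := exists_typeVec_eq_shSum 𝒜 hx τ σ k huv
    rw [h1]
    refine zsmul_mem (shSum_mem _ _ _ _ _ fun s hs => ?_) _
    have hs' : s.Perm (u ++ v) := hs.trans ((List.reverse_perm u).append_right v)
    obtain ⟨σ', h3, h4, h5⟩ := h2 s hs'
    rw [h5]
    refine ih σ' s hs' h3 h4 fun l i hi => ?_
    have hsub : ((τ.block l).map σ').Perm ((τ.block l).map σ) := by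
      by_cases hlk : l = k
      · subst hlk
        rw [h3, huv]
        exact (List.perm_append_singleton _ s).trans ((hs'.cons _).trans List.perm_middle.symm)
      · rw [h4 l hlk]
    obtain ⟨i', hi', heq⟩ := List.mem_map.mp (hsub.subset (List.mem_map_of_mem hi))
    rw [← heq]
    exact hle l i' hi'

/-- One monomial for each coset of `Z` suffices to span the type submodule. -/
theorem exists_coset_vectors {deg : ι → ℕ} {x : ι → H} (hx : ∀ h, x h ∈ 𝒜 (deg h))
    (τ : BambooType n ι) :
    ∃ v : Equiv.Perm (Fin n) ⧸ τ.Z → Model 𝒜 n, (∀ q, ∃ σ, v q = typeVec 𝒜 x τ σ) ∧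
      ∀ σ, typeVec 𝒜 x τ σ ∈ Submodule.span K (Set.range v) := by
  have hrep : ∀ q : Equiv.Perm (Fin n) ⧸ τ.Z, ∃ σ : Equiv.Perm (Fin n),
      (QuotientGroup.mk σ : Equiv.Perm (Fin n) ⧸ τ.Z) = q ∧ τ.IsTopped σ := by
    intro q
    obtain ⟨c, hc, h⟩ := τ.exists_isTopped_mul q.out
    refine ⟨_, ?_, h⟩
    have hz : c ∈ τ.Z := (le_sup_left : τ.C ≤ τ.Z) hc
    rw [QuotientGroup.mk_mul_of_mem _ hz, QuotientGroup.out_eq']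
  choose r hr ht using hrep
  refine ⟨fun q => typeVec 𝒜 x τ (r q), fun q => ⟨_, rfl⟩, fun σ => ?_⟩
  refine (Submodule.span_le.mpr ?_) (typeVec_mem_span_isTopped 𝒜 hx τ σ)
  rintro _ ⟨σ', hσ', rfl⟩
  have hN := (ht (QuotientGroup.mk σ')).inv_mul_mem_N hσ' (QuotientGroup.eq.mp (hr _))
  obtain ⟨s, hs⟩ := exists_typeVec_mul_eq 𝒜 hx τ hN
  have h1 := hs (r (QuotientGroup.mk σ'))
  rw [mul_inv_cancel_left] at h1
  rw [h1]
  exact zsmul_mem (Submodule.subset_span (Set.mem_range_self _)) _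

end CosetVectors
end Kriz

namespace Kriz

/-! ### The characters of the type submodules and of their sums -/

section Characters

variable {K : Type*} [Field K] [Algebra K ℂ] {H : Type*} [Ring H] [Algebra K H]
  (𝒜 : ℕ → Submodule K H) [GradedAlgebra 𝒜] {n : ℕ} {ι : Type*} [Fintype ι] [LinearOrder ι]
  (b : Module.Basis ι K H) {deg : ι → ℕ}

/-- The character of a representation which embeds into the Križ algebra with image spanned by
the monomials of some types. -/
theorem complexChar_of_embedding
    (hcomm : ∀ (d e : ℕ) (x y : H), x ∈ 𝒜 d → y ∈ 𝒜 e → x * y = (-1 : K) ^ (d * e) • (y * x))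
    (hdeg : ∀ i, b i ∈ 𝒜 (deg i)) (ξ : (τ : BambooType n ι) → (τ.Z →* ℂˣ))
    (hξ : ∀ τ : BambooType n ι, τ.IsXi deg (ξ τ)) (A : Finset (BambooType n ι))
    {V : Type*} [AddCommGroup V] [Module K V] (ρ : Representation K (Equiv.Perm (Fin n)) V)
    (f : V →ₗ[K] Model 𝒜 n) (hf : Function.Injective f)
    (hρ : ∀ g x, f (ρ g x) = rep 𝒜 n g (f x))
    (hrange : LinearMap.range f = Submodule.span K {z | ∃ τ ∈ A, ∃ σ, z = typeVec 𝒜 b τ σ})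
    (g : Equiv.Perm (Fin n)) :
    complexChar ρ g = ∑ τ ∈ A, inducedChar τ.Z (ξ τ) g := by
  classical
  have hm : ∀ τ : BambooType n ι, ∃ m : Model 𝒜 n →ₗ[K] ℂ,
      (∀ (z : τ.Z) x, m (rep 𝒜 n z x) = ξ τ z * m x) ∧
      (∀ π, τ.IsYoung π → m (typeVec 𝒜 b τ π) = τ.wordProd π) ∧
      (∀ (τ' : BambooType n ι) (σ : Equiv.Perm (Fin n)), τ ≠ τ' → m (typeVec 𝒜 b τ' σ) = 0) ∧
      ∀ σ : Equiv.Perm (Fin n), m (typeVec 𝒜 b τ σ) ≠ 0 → τ.PermutesBlocks σ := by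
    intro τ
    obtain ⟨ξ', m, h1, h2, h3⟩ := exists_xi_functional 𝒜 hcomm hdeg τ
    rw [(hξ τ).unique h1]
    exact ⟨m, h2, h3⟩
  choose m hmξ hmval hmother hmperm using hm
  choose v hv hvspan using fun τ : BambooType n ι => exists_coset_vectors 𝒜 hdeg τ
  have hmem : ∀ (τ : A) (σ : Equiv.Perm (Fin n)), ∃ x : V, f x = typeVec 𝒜 b τ.1 σ := by
    intro τ σ
    have : typeVec 𝒜 b τ.1 σ ∈ LinearMap.range f := by
      rw [hrange]
      exact Submodule.subset_span ⟨τ.1, τ.2, σ, rfl⟩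
    exact this
  choose P hP using fun τ : A => hmem τ 1
  have hw : ∀ p : (Σ τ : A, Equiv.Perm (Fin n) ⧸ τ.1.Z), ∃ x : V, f x = v p.1.1 p.2 := by
    rintro ⟨τ, q⟩
    obtain ⟨σ, hσ⟩ := hv τ.1 q
    rw [hσ]
    exact hmem τ σ
  choose w hw using hw
  have hPg : ∀ (τ : A) (g : Equiv.Perm (Fin n)), f (ρ g (P τ)) = typeVec 𝒜 b τ.1 g := by
    intro τ g
    rw [hρ, hP, rep_typeVec, mul_one]
  -- the weights of the powers of the cycles, as a function on the group
  let γ : A → Equiv.Perm (Fin n) → ℂ := fun τ s =>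
    ∑ j ∈ τ.1.exponents, if τ.1.cyclePow j = s then τ.1.cycleWeight j else 0
  have hγ : ∀ (τ : A) (F : Equiv.Perm (Fin n) → ℂ),
      ∑ s, γ τ s * F s = ∑ j ∈ τ.1.exponents, τ.1.cycleWeight j * F (τ.1.cyclePow j) := by
    intro τ F
    simp only [γ, Finset.sum_mul, ite_mul, zero_mul]
    rw [Finset.sum_comm]
    exact Finset.sum_congr rfl fun j _ => by rw [Finset.sum_ite_eq, if_pos (Finset.mem_univ _)]
  rw [← Finset.sum_coe_sort A fun τ => inducedChar τ.Z (ξ τ) g]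
  refine complexChar_eq_sum_inducedChar ρ (fun τ : A => τ.1.Z) (fun τ => ξ τ.1) w ?_
    (fun τ => m τ.1 ∘ₗ f) (fun τ z x => ?_) P γ (fun τ τ' g hne => ?_) (fun τ g hg => ?_)
    (fun τ => ?_) g
  · intro x _
    have h1 : f x ∈ (Submodule.span K (Set.range w)).map f := by
      have h2 : f x ∈ LinearMap.range f := ⟨x, rfl⟩
      rw [hrange] at h2
      refine (Submodule.span_le.mpr ?_) h2
      rintro _ ⟨τ, hτ, σ, rfl⟩
      rw [Submodule.map_span]
      refine Submodule.span_mono ?_ (hvspan τ σ)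
      rintro _ ⟨q, rfl⟩
      exact ⟨_, ⟨⟨⟨τ, hτ⟩, q⟩, rfl⟩, hw _⟩
    obtain ⟨y, hy, hyx⟩ := h1
    rwa [← hf hyx]
  · rw [LinearMap.comp_apply, LinearMap.comp_apply, hρ, hmξ]
  · rw [LinearMap.comp_apply, hPg]
    exact hmother _ _ _ fun h => hne (Subtype.ext h)
  · rw [hγ τ fun s => (m τ.1 ∘ₗ f) (ρ (g * s) (P τ))]
    simp only [LinearMap.comp_apply, hPg]
    by_contra hsum
    apply hg
    -- a term which is not zero shows that `g` permutes the blocks; up to an element of `N` it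
    -- preserves them, and then the sum is a product over the blocks
    obtain ⟨j, _, hj⟩ := Finset.exists_ne_zero_of_sum_ne_zero hsum
    have hC : ∀ j, τ.1.cyclePow j ∈ τ.1.C := τ.1.cyclePow_mem
    have hgp : τ.1.PermutesBlocks g := by
      have h1 := (hmperm _ _ (right_ne_zero_of_mul hj)).mul
        (BambooType.isYoung_of_mem_C (hC j)).permutesBlocks.inv
      rwa [mul_inv_cancel_right] at h1
    obtain ⟨ν, hν, π, hπ, rfl⟩ := hgp.exists_eq_mul
    have hπ' := BambooType.isYoung_conj (inv_mem hν) hπ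
    have hνZ : ν ∈ τ.1.Z := (le_sup_right : τ.1.N ≤ τ.1.Z) hν
    have hterm : ∀ j, m τ.1 (typeVec 𝒜 b τ.1 (π * ν * τ.1.cyclePow j)) =
        ξ τ.1 ⟨ν, hνZ⟩ * τ.1.wordProd (ν⁻¹ * π * ν⁻¹⁻¹ * τ.1.cyclePow j) := by
      intro j
      rw [← hmval _ _ (hπ'.mul (BambooType.isYoung_of_mem_C (hC j))), ← hmξ, rep_typeVec]
      congr 2
      group
    have hsum' : ∑ j ∈ τ.1.exponents, τ.1.cycleWeight j *
        τ.1.wordProd (ν⁻¹ * π * ν⁻¹⁻¹ * τ.1.cyclePow j) ≠ 0 := by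
      intro h0
      apply hsum
      simp only [hterm]
      rw [← mul_zero ((ξ τ.1 ⟨ν, hνZ⟩ : ℂˣ) : ℂ), ← h0, Finset.mul_sum]
      exact Finset.sum_congr rfl fun j _ => mul_left_comm _ _ _
    have hc := BambooType.mem_C_of_sum_cycleWeight_ne_zero hπ' hsum'
    have heq : π * ν = ν * (ν⁻¹ * π * ν⁻¹⁻¹) := by group
    rw [heq]
    exact mul_mem hνZ ((le_sup_left : τ.1.C ≤ τ.1.Z) hc)
  · rw [hγ τ fun s => (m τ.1 ∘ₗ f) (ρ s (P τ))]
    simp only [LinearMap.comp_apply, hPg]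
    have h1 := τ.1.sum_cycleWeight_one_ne_zero
    simp only [one_mul] at h1
    simpa only [hmval _ _ (BambooType.isYoung_of_mem_C (τ.1.cyclePow_mem _))] using h1

theorem finite_model
    (hcomm : ∀ (d e : ℕ) (x y : H), x ∈ 𝒜 d → y ∈ 𝒜 e → x * y = (-1 : K) ^ (d * e) • (y * x))
    (hdeg : ∀ i, b i ∈ 𝒜 (deg i)) (n : ℕ) : Module.Finite K (Model 𝒜 n) := by
  refine ⟨⟨(Set.range fun p : BambooType n ι × Equiv.Perm (Fin n) =>
    typeVec 𝒜 b p.1 p.2).toFinite.toFinset, ?_⟩⟩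
  rw [Set.Finite.coe_toFinset, ← span_typeVec 𝒜 b hdeg hcomm]
  congr 1
  ext z
  constructor
  · rintro ⟨⟨τ, σ⟩, rfl⟩
    exact ⟨τ, σ, rfl⟩
  · rintro ⟨τ, σ, rfl⟩
    exact ⟨⟨τ, σ⟩, rfl⟩

end Characters
end Kriz

theorem theorem3p15 {K : Type*} [Field K] [Algebra K ℂ]
    {H : Type*} [Ring H] [Algebra K H] [FiniteDimensional K H]
    (𝒜 : ℕ → Submodule K H) [GradedAlgebra 𝒜]
    (hcomm : ∀ (d e : ℕ) (x y : H), x ∈ 𝒜 d → y ∈ 𝒜 e →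
      x * y = (-1 : K) ^ (d * e) • (y * x))
    {ι : Type*} [Fintype ι] [LinearOrder ι] (b : Module.Basis ι K H)
    (deg : ι → ℕ) (hdeg : ∀ i, b i ∈ 𝒜 (deg i)) (m n : ℕ) :
    Module.Finite K (Kriz.Model 𝒜 n) ∧
    (∀ τ : Kriz.BambooType n ι, τ.C ⊓ τ.N = ⊥ ∧ τ.N ≤ Subgroup.normalizer τ.C) ∧
    (∀ τ : Kriz.BambooType n ι, ∃! ξ : τ.Z →* ℂˣ, τ.IsXi deg ξ) ∧
    ∀ ξ : (τ : Kriz.BambooType n ι) → (τ.Z →* ℂˣ), (∀ τ : Kriz.BambooType n ι, τ.IsXi deg (ξ τ)) →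
      (∀ (τ : Kriz.BambooType n ι) (g : Equiv.Perm (Fin n)),
        Kriz.complexChar (Kriz.typeSub 𝒜 b τ).toRepresentation g =
          Kriz.inducedChar τ.Z (ξ τ) g) ∧
      (∀ (q : ℕ) (k : ℤ) (g : Equiv.Perm (Fin n)),
        Kriz.complexChar (Kriz.bigraded 𝒜 m n q k).toRepresentation g =
          ∑ τ : Kriz.BambooType n ι with
            τ.lengthDeg = q ∧ (τ.markDeg deg : ℤ) + (q : ℤ) * (2 * (m : ℤ) - 1) = k,
            Kriz.inducedChar τ.Z (ξ τ) g) ∧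
      (∀ g : Equiv.Perm (Fin n),
        Kriz.complexChar (Kriz.rep 𝒜 n) g =
          ∑ τ : Kriz.BambooType n ι, Kriz.inducedChar τ.Z (ξ τ) g) := by
  refine ⟨Kriz.finite_model 𝒜 b hcomm hdeg n, fun τ => ⟨τ.C_inf_N, τ.N_le_normalizer_C⟩,
    fun τ => ?_, fun ξ hξ => ⟨fun τ g => ?_, fun q k g => ?_, fun g => ?_⟩⟩
  · obtain ⟨ξ, _, h, _⟩ := Kriz.exists_xi_functional 𝒜 hcomm hdeg τ
    exact ⟨ξ, h, fun ξ' h' => h'.unique h⟩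
  · refine (Kriz.complexChar_of_embedding 𝒜 b hcomm hdeg ξ hξ {τ}
      (V := (Kriz.typeSub 𝒜 b τ).toSubmodule)
      (Kriz.typeSub 𝒜 b τ).toRepresentation (Kriz.typeSub 𝒜 b τ).toSubmodule.subtype
      (Submodule.injective_subtype _) (fun _ _ => rfl) ?_ g).trans (Finset.sum_singleton _ _)
    rw [Submodule.range_subtype]
    refine (Kriz.span_typeSet 𝒜 hcomm hdeg τ).trans (congrArg _ (Set.ext fun z => ?_))
    constructor
    · rintro ⟨σ, rfl⟩
      exact ⟨τ, Finset.mem_singleton_self τ, σ, rfl⟩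
    · rintro ⟨τ', hτ', σ, rfl⟩
      rw [Finset.mem_singleton.mp hτ']
      exact ⟨σ, rfl⟩
  · refine Kriz.complexChar_of_embedding 𝒜 b hcomm hdeg ξ hξ _
      (V := (Kriz.bigraded 𝒜 m n q k).toSubmodule)
      (Kriz.bigraded 𝒜 m n q k).toRepresentation (Kriz.bigraded 𝒜 m n q k).toSubmodule.subtype
      (Submodule.injective_subtype _) (fun _ _ => rfl) ?_ g
    rw [Submodule.range_subtype]
    refine (Kriz.span_bigradedSet 𝒜 b hdeg hcomm m q k).trans (congrArg _ (Set.ext fun z => ?_))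
    simp only [Set.mem_ofPred_eq, Finset.mem_filter, Finset.mem_univ, true_and]
  · refine Kriz.complexChar_of_embedding 𝒜 b hcomm hdeg ξ hξ Finset.univ (Kriz.rep 𝒜 n)
      LinearMap.id Function.injective_id (fun _ _ => rfl) ?_ g
    rw [LinearMap.range_id, ← Kriz.span_typeVec 𝒜 b hdeg hcomm]
    simp only [Finset.mem_univ, true_and]
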